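/- Notation. For a function $F$ of a complex variable put $F^\sharp(z)=\overline{F(\bar z)}$, and let $\mathbb{C}_+=\{z:\Im z>0\}$. For a function $f$ on $\mathbb{R}$ put $(\mathsf{F}f)(z)=\int_{-\infty}^{\infty}f(x)e^{ixz}\,dx$ whenever the integral converges absolutely. For $t\in\mathbb{R}$ let $\mathsf{K}[t]$ be the operator $$(\mathsf{K}[t]f)(x)=\mathbf{1}_{(-\infty,t)}(x)\int_{-\infty}^{t}K(x+y)f(y)\,dy .$$ $H^2$ is the Hardy space of analytic $F$ on $\mathbb{C}_+$ with $\sup_{v>0}\int_{\mathbb{R}}|F(u+iv)|^2\,du<\infty$, with the inner product of the boundary functions in $L^2(\mathbb{R})$. An inner function is a bounded analytic function $\theta$ on $\mathbb{C}_+$ with $\lim_{y\to0+}|\theta(x+iy)|=1$ for almost every $x\in\mathbb{R}$, and $\mathcal{K}(\theta)=H^2\ominus\theta H^2$ is its model subspace. Assumptions. Let $c>0$, let $\mathcal{Z}\subset\mathbb{C}$, let $E$ be a function that is not identically zero on $\mathbb{C}\setminus\mathcal{Z}$, and let $K:\mathbb{R}\to\mathbb{R}$. Assume: (K1) $\mathcal{Z}$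 is a discrete (possibly empty or infinite) subset of the strip $-c\le\Im z\le c$ with $0\notin\mathcal{Z}$, closed under $z\mapsto\bar z$ and $z\mapsto-z$; $E$ is analytic in $\mathbb{C}\setminus\mathcal{Z}$ (that is, in a neighbourhood of each point of it) and $E^\sharp(z)=E(-z)$ for $z\in\mathbb{C}\setminus\mathcal{Z}$. (K2) $K$ is continuous, $|K(x)|\ll e^{c|x|}$ as $|x|\to\infty$, and $E^\sharp(z)/E(z)=(\mathsf{F}K)(z)$ for $\Im z>c$ (as meromorphic functions). (K3) $K(x)=0$ for $x<0$. (K4) $K$ is continuously differentiable outside a discrete subset of $\mathbb{R}$, and $K'\in L^1_{\rm loc}(\mathbb{R})$. (K5) with $\tau=\infty$: for every $0\le t<\infty$, neither $1$ nor $-1$ is an eigenvalue of $\mathsf{K}[t]$ on $L^2(-\infty,t)$. Statement. As $t\to\infty$ the operators $\mathsf{K}[t]$ converge strongly on $L^2(\mathbb{R})$ to a bounded operator $\mathsf{K}$. Put $\mathcal{V}_t=L^2(t,\infty)\cap\mathsf{K}(L^2(t,\infty))$. Let $t\ge0$. Then there are unique continuous functions $\Phi(t,\cdot),\Psi(t,\cdot):\mathbb{R}\to\mathbb{R}$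 with $$\Phi(t,x)+\int_{-\infty}^{t}K(x+y)\Phi(t,y)\,dy=1,\qquad \Psi(t,x)-\int_{-\infty}^{t}K(x+y)\Psi(t,y)\,dy=1\qquad(x\in\mathbb{R}).$$ The functions $$A(t,z)=-\frac{iz}{2}E(z)\int_t^\infty\Psi(t,x)e^{izx}\,dx,\qquad -iB(t,z)=-\frac{iz}{2}E(z)\int_t^\infty\Phi(t,x)e^{izx}\,dx ,$$ where the integrals converge absolutely for $\Im z>c$, continue analytically from $\Im z>c$ to $\mathbb{C}\setminus\mathcal{Z}$. Put $E(t,z)=A(t,z)-iB(t,z)$ and $\Theta(t,z)=\overline{E(t,\bar z)}/E(t,z)$. Then $E(t,z)/E(z)$ and $\Theta(t,z)$, defined outside $\mathcal{Z}$ and the zeros of the respective denominators (neither of which vanishes identically on $\mathbb{C}_+\setminus\mathcal{Z}$), extend to analytic functions on $\mathbb{C}_+$; $\Theta(t,\cdot)$ is an inner function; and, as sets of analytic functions on $\mathbb{C}_+$, $$\mathsf{F}(\mathcal{V}_t)=\frac{E(t,z)}{E(z)}\,\mathcal{K}(\Theta(t,\cdot)).$$ -/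

import Mathlib

open MeasureTheory Filter Topology Set

noncomputable section

namespace LacunaryCanonical

/-- The open upper half-plane. -/
def upperHalf : Set ℂ := {z | 0 < z.im}

/-- The involution sending `F` to the function with value `conj (F (conj z))` at `z`. -/
def sharp (F : ℂ → ℂ) (z : ℂ) : ℂ :=
  (starRingEnd ℂ) (F ((starRingEnd ℂ) z))

/-- The Fourier integral, the integral of `f x * exp (i x z)` over the real line. -/
def fourier (f : ℝ → ℂ) (z : ℂ) : ℂ :=
  ∫ x : ℝ, f x * Complex.exp (Complex.I * x * z)

/-! ### The conditions on the function `E` -/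

/-- `E` is analytic outside a discrete, symmetric set `Z` in the strip `|Im z| ≤ c` that omits the
origin, and its functional equation holds outside `Z`. -/
structure CondK1 (E : ℂ → ℂ) (c : ℝ) (Z : Set ℂ) : Prop where
  c_pos : 0 < c
  discrete : IsDiscrete Z
  zero_notMem : (0 : ℂ) ∉ Z
  strip : ∀ z ∈ Z, -c ≤ z.im ∧ z.im ≤ c
  conj_mem : ∀ z ∈ Z, (starRingEnd ℂ) z ∈ Z
  neg_mem : ∀ z ∈ Z, -z ∈ Z
  analytic : AnalyticOnNhd ℂ E Zᶜ
  functional_eq : ∀ z ∉ Z, sharp E z = E (-z)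

/-- `K` is continuous, `O(exp (c |x|))`, and the quotient of `sharp E` by `E` is its Fourier
integral on `Im z > c` (as meromorphic functions, that is, wherever `E` does not vanish). -/
structure CondK2 (E : ℂ → ℂ) (c : ℝ) (K : ℝ → ℝ) : Prop where
  cont : Continuous K
  growth : K =O[cocompact ℝ] fun x : ℝ => Real.exp (c * |x|)
  fourier_eq : ∀ z : ℂ, c < z.im → E z ≠ 0 →
    sharp E z / E z = fourier (fun x => (K x : ℂ)) z

/-- `K` vanishes on the negative half-line. -/
def CondK3 (K : ℝ → ℝ) : Prop := ∀ x < 0, K x = 0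

/-- `K` is continuously differentiable outside a discrete set, and its derivative is locally
integrable. -/
def CondK4 (K : ℝ → ℝ) : Prop :=
  (∃ L : Set ℝ, IsDiscrete L ∧ ∀ x ∉ L, ContDiffAt ℝ 1 K x) ∧ LocallyIntegrable (deriv K)

/-- The truncated Hankel operator `K[t]`. -/
def truncHankel (K : ℝ → ℝ) (t : ℝ) (f : ℝ → ℂ) : ℝ → ℂ :=
  (Iio t).indicator fun x => ∫ y in Iio t, (K (x + y) : ℂ) * f y

/-- `lam` is an eigenvalue of `K[t]` on the complex Hilbert space `L²(-∞, t)`. -/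
def IsTruncEigenvalue (K : ℝ → ℝ) (t : ℝ) (lam : ℂ) : Prop :=
  ∃ f : ℝ → ℂ, MemLp f 2 (volume.restrict (Iio t)) ∧
    ¬ (f =ᵐ[volume.restrict (Iio t)] 0) ∧
    truncHankel K t f =ᵐ[volume.restrict (Iio t)] fun x => lam * f x

/-- Neither `1` nor `-1` is an eigenvalue of `K[t]`, for any `0 ≤ t < ∞`. -/
def CondK5 (K : ℝ → ℝ) : Prop :=
  ∀ t : ℝ, 0 ≤ t → ¬ IsTruncEigenvalue K t 1 ∧ ¬ IsTruncEigenvalue K t (-1)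

/-! ### The functions attached to `E` -/

/-- `φ` is a continuous solution of `φ(x) + ∫_{-∞}^t K(x+y) φ(y) dy = 1` on the real line.
(If `K` is continuous and vanishes on the negative half-line, the integrand is continuous in `y`
and vanishes for `y < -x`, so the integral converges absolutely.) -/
def IsPhi (K : ℝ → ℝ) (t : ℝ) (φ : ℝ → ℝ) : Prop :=
  Continuous φ ∧ ∀ x : ℝ, φ x + ∫ y in Iio t, K (x + y) * φ y = 1

/-- `ψ` is a continuous solution of `ψ(x) - ∫_{-∞}^t K(x+y) ψ(y) dy = 1` on the real line. -/
def IsPsi (K : ℝ → ℝ) (t : ℝ) (ψ : ℝ → ℝ) : Prop :=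
  Continuous ψ ∧ ∀ x : ℝ, ψ x - ∫ y in Iio t, K (x + y) * ψ y = 1

/-- `g` is the analytic continuation, from `Im z > c` to the complement of `Z`, of
`-(i z / 2) E(z) ∫_t^∞ φ(x) exp(i z x) dx`, the integral being absolutely convergent
for `Im z > c`. -/
def IsContinuation (E : ℂ → ℂ) (c : ℝ) (Z : Set ℂ) (t : ℝ) (φ : ℝ → ℝ) (g : ℂ → ℂ) : Prop :=
  AnalyticOnNhd ℂ g Zᶜ ∧ ∀ z : ℂ, c < z.im →
    IntegrableOn (fun x : ℝ => (φ x : ℂ) * Complex.exp (Complex.I * z * x)) (Ioi t) ∧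
    g z = -(Complex.I * z / 2) * E z *
      ∫ x in Ioi t, (φ x : ℂ) * Complex.exp (Complex.I * z * x)

/-! ### Hardy space, inner functions, model subspaces

A function on the upper half-plane is represented by a function on `ℂ` whose values elsewhere are
irrelevant. -/

/-- The horizontal slice `u ↦ F (u + i v)`. -/
def slice (F : ℂ → ℂ) (v : ℝ) (u : ℝ) : ℂ := F (u + v * Complex.I)

/-- The Hardy space `H²` of the upper half-plane. -/
def hardySpace : Set (ℂ → ℂ) :=
  {F | DifferentiableOn ℂ F upperHalf ∧
    (⨆ v ∈ Ioi (0 : ℝ), ∫⁻ u : ℝ, ‖slice F v u‖ₑ ^ 2) < ⊤}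

/-- `θ` is an inner function in the upper half-plane. -/
structure IsInner (θ : ℂ → ℂ) : Prop where
  differentiableOn : DifferentiableOn ℂ θ upperHalf
  bounded : ∃ M : ℝ, ∀ z ∈ upperHalf, ‖θ z‖ ≤ M
  boundary : ∀ᵐ x : ℝ, Tendsto (fun y : ℝ => ‖slice θ y x‖) (𝓝[>] 0) (𝓝 1)

/-- Orthogonality in `H²`. For `F`, `G` in `H²` the slices at height `v` converge in `L²(ℝ)` to the
boundary functions as `v → 0+`, so the limit of the integrals below is the inner product of the
boundary functions, which is the inner product of `H²`. -/
def HardyOrthogonal (F G : ℂ → ℂ) : Prop :=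
  Tendsto (fun v : ℝ => ∫ u : ℝ, slice F v u * (starRingEnd ℂ) (slice G v u)) (𝓝[>] 0) (𝓝 0)

/-- The model subspace: the orthogonal complement of `θ H²` in `H²`. -/
def modelSpace (θ : ℂ → ℂ) : Set (ℂ → ℂ) :=
  {F | F ∈ hardySpace ∧ ∀ h ∈ hardySpace, HardyOrthogonal F (fun z => θ z * h z)}

/-! ### The operator `K` on `L²(ℝ)` and the spaces `V_t` -/

/-- The space `L²(ℝ)`. -/
abbrev L2 : Type := Lp ℂ 2 (volume : Measure ℝ)

/-- The bounded operator `T` on `L²(ℝ)` is the strong limit of `K[t]` as `t → ∞`. -/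
def IsHankelLimit (K : ℝ → ℝ) (T : L2 →L[ℂ] L2) : Prop :=
  ∀ f : L2, Tendsto (fun t : ℝ => eLpNorm (fun x => truncHankel K t f x - T f x) 2 volume)
    atTop (𝓝 0)

/-- `L²(t, ∞)` as a subspace of `L²(ℝ)`. -/
def L2Above (t : ℝ) : Set L2 := {f | ∀ᵐ x : ℝ, x < t → f x = 0}

/-- `V_t`, the intersection of `L²(t, ∞)` with its image under `T`. -/
def spaceV (T : L2 →L[ℂ] L2) (t : ℝ) : Set L2 := L2Above t ∩ T '' L2Above t

/-- The set of Fourier transforms, as functions on the upper half-plane, of the elements of `V`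
(used for `V` contained in `L²(0, ∞)`, where the Fourier integral converges absolutely). -/
def fourierImage (V : Set L2) : Set (ℂ → ℂ) :=
  {F | ∃ f ∈ V, ∀ z ∈ upperHalf, F z = fourier f z}

/-- The set of all products `q G` on the upper half-plane with `G` in `S`. -/
def multiple (q : ℂ → ℂ) (S : Set (ℂ → ℂ)) : Set (ℂ → ℂ) :=
  {F | ∃ G ∈ S, ∀ z ∈ upperHalf, F z = q z * G z}

/-- `q` is the analytic function on the upper half-plane that is given by the quotient `f / g`
outside `Z` and the zeros of `g`. -/
def IsQuotient (Z : Set ℂ) (f g q : ℂ → ℂ) : Prop :=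
  (∃ z ∈ upperHalf, z ∉ Z ∧ g z ≠ 0) ∧ DifferentiableOn ℂ q upperHalf ∧
    ∀ z ∈ upperHalf, z ∉ Z → g z ≠ 0 → q z = f z / g z

end LacunaryCanonical

end

/-! Put Θ = E^♯/E. Since K vanishes on the negative axis, K[t] has a bounded kernel supported in the
square (-t,t)×(-t,t); hence it is compact and selfadjoint, and its norm is continuous in t. The norm
is 0 at t = 0. It is never 1, because the norm of a compact selfadjoint operator is, if nonzero,
attained at an eigenvalue up to sign. So ‖K[t]‖ < 1 for every t (`norm_truncOp_lt_one`). A Neumann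
series then produces Φ and Ψ (`exists_isSol`), and the strong limit T exists as a contraction,
because for f of bounded support the K[t]f are eventually cutoffs of one fixed function
(`exists_strongLimit`).

On the Fourier side (F Tf)(z) = Θ(z)(F f)(-z) for f supported in a left half-line. Boundedness of T,
tested on a single exponential, continues Θ to the upper half-plane (`exists_symbol`). Its boundary
values are unimodular because |E^♯| = |E| on the real line, so Plancherel and Fatou make T
isometric; being symmetric, T is an involution (`exists_hankelSystem`).

Let p be the function `entirePart` of a solution, with σ = 1 for Φ and σ = -1 for Ψ. The part of the
solution on (-∞,t) has transform p(z)/(iz). The integral equation then says that -iz times the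
transform of the part on [t,∞) is p(z) - σΘ(z)p(-z) (`fourier_upperPart`). Multiplying by E/2 gives
A and -iB in terms of E, E^♯ and entire functions, hence the continuation, and it makes e = E(t,·)/E
and f = E(t,·)^♯/E explicit (`quotE`, `quotF`). Growth estimates on both sides and Liouville give
p_Ψ(z)p_Φ(-z) + p_Φ(z)p_Ψ(-z) = 2 (`wronskian`).

The heart is the computation of the reproducing kernels of V_t. Applying to a truncated solution an
operator that multiplies transforms by iz/(z+ξ) gives an element r of L²(t,∞) with transform (p(z) -
σΘ(z)p(-z))/(z+ξ), for which Tr is a multiple of exp(-ixξ) to the left of t (`exists_resolvent`). A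
combination of the elements for Φ and Ψ cancels this exponential and so lies in V_t; the Wronskian
identity is exactly its normalisation. The kernel is i(e(z)conj e(w) - f(z)conj f(w))/(z - conj w),
first for Im w > c (`exists_kernel_of_lt`) and then on the whole half-plane (`exists_kernel`).

Positivity on the diagonal gives |f| ≤ |e|, the Wronskian identity excludes common zeros, and f = Θ
conj e on the boundary; so θ = f/e is inner (`isInner_quotient`). The kernel of V_t is e(z)conj e(w)
times that of the model space of θ. Two closed subspaces with total families of equal Gram matrix
have the same coordinate functions (`exists_inner_eq_of_gram_eq`), and this is the claimed equality
of sets. The passage between H², defined by horizontal slices, and L²(0,∞) is the Paley–Wiener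
theorem (`exists_fourier_of_mem_hardySpace`), derived from Cauchy's theorem. -/

namespace LacunaryCanonical

open scoped FourierTransform ENNReal NNReal Convolution

/-! ### Fourier integrals: analyticity, Parseval and Plancherel -/

theorem norm_cexp_I_mul (x : ℝ) (z : ℂ) :
    ‖Complex.exp (Complex.I * x * z)‖ = Real.exp (-(x * z.im)) := by
  rw [Complex.norm_exp]; congr 1; simp

theorem aestronglyMeasurable_mul_cexp {f : ℝ → ℂ} (hf : AEStronglyMeasurable f volume) (z : ℂ) :
    AEStronglyMeasurable (fun x : ℝ => f x * Complex.exp (Complex.I * x * z)) volume :=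
  hf.mul (by fun_prop : Continuous fun x : ℝ => Complex.exp (Complex.I * x * z)).aestronglyMeasurable

theorem integrable_mul_cexp_iff {f : ℝ → ℂ} (hf : AEStronglyMeasurable f volume) (z : ℂ) :
    Integrable (fun x : ℝ => f x * Complex.exp (Complex.I * x * z)) ↔
      Integrable (fun x : ℝ => ‖f x‖ * Real.exp (-(x * z.im))) := by
  rw [← integrable_norm_iff (aestronglyMeasurable_mul_cexp hf z)]
  simp only [norm_mul, norm_cexp_I_mul]

/-- A Fourier integral that converges absolutely on an open strip is analytic there. -/
theorem differentiableAt_fourier {f : ℝ → ℂ} (hf : AEStronglyMeasurable f volume) {a b : ℝ}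
    (h : ∀ v, a < v → v < b → Integrable (fun x : ℝ => ‖f x‖ * Real.exp (-(x * v)))) {z : ℂ}
    (ha : a < z.im) (hb : z.im < b) : DifferentiableAt ℂ (fourier f) z := by
  obtain ⟨δ, hδ, h1, h2⟩ : ∃ δ > 0, a < z.im - 2 * δ ∧ z.im + 2 * δ < b := by
    refine ⟨min (z.im - a) (b - z.im) / 4, by positivity, ?_, ?_⟩ <;>
    · have := min_le_left (z.im - a) (b - z.im)
      have := min_le_right (z.im - a) (b - z.im)
      have : 0 < min (z.im - a) (b - z.im) := by positivity
      linarith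
  have key := hasDerivAt_integral_of_dominated_loc_of_deriv_le (μ := volume) (𝕜 := ℂ)
    (F := fun (w : ℂ) (x : ℝ) => f x * Complex.exp (Complex.I * x * w))
    (F' := fun (w : ℂ) (x : ℝ) => f x * (Complex.exp (Complex.I * x * w) * (Complex.I * x)))
    (x₀ := z) (s := Metric.ball z δ)
    (bound := fun x => δ⁻¹ * (‖f x‖ * Real.exp (-(x * (z.im - 2 * δ))) +
      ‖f x‖ * Real.exp (-(x * (z.im + 2 * δ)))))
    (Metric.ball_mem_nhds z hδ)
    (Eventually.of_forall fun w => aestronglyMeasurable_mul_cexp hf w)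
    ((integrable_mul_cexp_iff hf z).2 (h _ ha hb))
    (hf.mul (by fun_prop : Continuous fun x : ℝ =>
      Complex.exp (Complex.I * x * z) * (Complex.I * x)).aestronglyMeasurable) ?_ ?_ ?_
  · exact key.2.differentiableAt
  · refine Eventually.of_forall fun x w hw => ?_
    have hw' : |w.im - z.im| < δ := by
      have := Complex.abs_im_le_norm (w - z)
      rw [Metric.mem_ball, dist_eq_norm] at hw
      simpa using this.trans_lt hw
    rw [abs_lt] at hw'
    rw [norm_mul, norm_mul, norm_cexp_I_mul]
    simp only [norm_mul, Complex.norm_I, one_mul, Complex.norm_real, Real.norm_eq_abs]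
    rw [← mul_add (‖f x‖), mul_left_comm δ⁻¹]
    refine mul_le_mul_of_nonneg_left ?_ (norm_nonneg (f x))
    have hx : |x| ≤ δ⁻¹ * Real.exp (δ * |x|) := by
      rw [← div_eq_inv_mul, le_div_iff₀ hδ]
      linarith [Real.add_one_le_exp (δ * |x|), mul_comm δ |x|]
    calc Real.exp (-(x * w.im)) * |x|
        ≤ Real.exp (-(x * w.im)) * (δ⁻¹ * Real.exp (δ * |x|)) := by gcongr
      _ = δ⁻¹ * Real.exp (-(x * w.im) + δ * |x|) := by rw [Real.exp_add]; ring
      _ ≤ _ := by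
        gcongr
        rcases le_total 0 x with h0 | h0
        · rw [abs_of_nonneg h0]
          refine le_add_of_le_of_nonneg (Real.exp_le_exp.2 ?_) (Real.exp_nonneg _)
          nlinarith
        · rw [abs_of_nonpos h0]
          refine le_add_of_nonneg_of_le (Real.exp_nonneg _) (Real.exp_le_exp.2 ?_)
          nlinarith
  · exact ((h _ h1 (by linarith)).add (h _ (by linarith) h2)).const_mul _
  · refine Eventually.of_forall fun x w _ => ?_
    refine HasDerivAt.const_mul _ ?_
    simpa using ((hasDerivAt_id w).const_mul (Complex.I * (x : ℂ))).cexp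

/-- The transform `𝓕` uses exp(-2πixξ), so the frequency is reflected and rescaled; all factors 2π
below come from here. -/
theorem fourier_eq_fourierIntegral (f : ℝ → ℂ) (u : ℝ) :
    fourier f u = 𝓕 f (-(u / (2 * Real.pi))) := by
  rw [Real.fourier_real_eq_integral_exp_smul]
  refine integral_congr_ae (Eventually.of_forall fun x => ?_)
  simp only [smul_eq_mul]
  rw [mul_comm]
  congr 2
  push_cast
  have : (Real.pi : ℂ) ≠ 0 := by exact_mod_cast Real.pi_ne_zero
  field_simp

/-- The L² transform is only characterised through tempered distributions. Tested against a smooth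
compactly supported function, the transform moves onto the test function, and the exchange formula
for integrable functions moves it back onto f as an honest integral. -/
theorem coeFn_fourier_toLp {f : ℝ → ℂ} (h1 : Integrable f) (h2 : MemLp f 2 volume) :
    ((𝓕 (h2.toLp f) : L2) : ℝ → ℂ) =ᵐ[volume] 𝓕 f := by
  have hcont : Continuous (𝓕 f) := by
    exact VectorFourier.fourierIntegral_continuous Real.continuous_fourierChar
      (by exact continuous_inner) h1
  have hloc : LocallyIntegrable (fun x => (𝓕 (h2.toLp f) : L2) x - 𝓕 f x) volume :=
    ((Lp.memLp _).locallyIntegrable (by norm_num)).sub hcont.locallyIntegrable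
  have := ae_eq_zero_of_integral_contDiff_smul_eq_zero hloc ?_
  · filter_upwards [this] with x hx using sub_eq_zero.1 hx
  intro g hg hgc
  let G : SchwartzMap ℝ ℂ := (HasCompactSupport.toSchwartzMap (f := fun x => (g x : ℂ))
    (hgc.comp_left (g := fun r : ℝ => (r : ℂ)) (by simp)) (Complex.ofRealCLM.contDiff.comp hg))
  have hG : ∀ x, G x = g x := fun x => rfl
  have e1 : ∫ x, G x • (𝓕 (h2.toLp f) : L2) x = ∫ x, G x • 𝓕 f x := by
    rw [← Lp.toTemperedDistribution_apply, ← Lp.fourier_toTemperedDistribution_eq,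
      TemperedDistribution.fourier_apply, Lp.toTemperedDistribution_apply]
    have e2 : ∫ x, (𝓕 G) x • (h2.toLp f) x = ∫ x, 𝓕 (⇑G) x • f x := by
      refine integral_congr_ae ?_
      filter_upwards [h2.coeFn_toLp] with x hx
      rw [hx, SchwartzMap.fourier_coe]
    rw [e2]
    have := VectorFourier.integral_fourierIntegral_smul_eq_flip (L := innerₗ ℝ)
      (μ := (volume : Measure ℝ)) (ν := (volume : Measure ℝ)) Real.continuous_fourierChar
      (by exact continuous_inner) G.integrable h1
    rw [flip_innerₗ] at this
    exact this
  have i1 : Integrable (fun x => g x • (𝓕 (h2.toLp f) : L2) x) :=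
    ((Lp.memLp _).locallyIntegrable (by norm_num)).integrable_smul_left_of_hasCompactSupport
      hg.continuous hgc
  have i2 : Integrable (fun x => g x • 𝓕 f x) :=
    hcont.locallyIntegrable.integrable_smul_left_of_hasCompactSupport hg.continuous hgc
  simp only [smul_sub]
  rw [integral_sub i1 i2, sub_eq_zero]
  simpa [hG] using e1

/-- Parseval's formula for the Fourier integral on the real line. -/
theorem integral_fourier_mul_conj {f g : ℝ → ℂ} (hf : Integrable f) (hf2 : MemLp f 2 volume)
    (hg : Integrable g) (hg2 : MemLp g 2 volume) :
    ∫ u : ℝ, fourier f u * (starRingEnd ℂ) (fourier g u) =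
      2 * Real.pi * ∫ x, f x * (starRingEnd ℂ) (g x) := by
  have h := Lp.inner_fourier_eq (hg2.toLp g) (hf2.toLp f)
  rw [L2.inner_def, L2.inner_def] at h
  have e1 : ∫ a, inner ℂ ((𝓕 (hg2.toLp g) : L2) a) ((𝓕 (hf2.toLp f) : L2) a)
      = ∫ a, 𝓕 f a * (starRingEnd ℂ) (𝓕 g a) := by
    refine integral_congr_ae ?_
    filter_upwards [coeFn_fourier_toLp hf hf2, coeFn_fourier_toLp hg hg2] with x h1 h2
    rw [h1, h2]; simp [inner]
  have e2 : ∫ a, inner ℂ ((hg2.toLp g) a) ((hf2.toLp f) a)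
      = ∫ a, f a * (starRingEnd ℂ) (g a) := by
    refine integral_congr_ae ?_
    filter_upwards [hf2.coeFn_toLp, hg2.coeFn_toLp] with x h1 h2
    rw [h1, h2]; simp [inner]
  rw [e1, e2] at h
  rw [← h]
  -- The substitution a = -u/(2π) supplies the factor 2π.
  have e3 := Measure.integral_comp_mul_left (fun a => 𝓕 f a * (starRingEnd ℂ) (𝓕 g a))
    (-(2 * Real.pi)⁻¹)
  simp only [fourier_eq_fourierIntegral]
  have e4 : ∀ u : ℝ, -(u / (2 * Real.pi)) = -(2 * Real.pi)⁻¹ * u := fun u => by ring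
  simp only [e4, e3]
  rw [← inv_neg, inv_inv, abs_neg, abs_of_pos Real.two_pi_pos]
  simp

/-- Plancherel's formula for the Fourier integral on the real line. -/
theorem lintegral_fourier {f : ℝ → ℂ} (hf : Integrable f) (hf2 : MemLp f 2 volume) :
    ∫⁻ u : ℝ, ‖fourier f u‖ₑ ^ 2 = ENNReal.ofReal (2 * Real.pi) * ∫⁻ x, ‖f x‖ₑ ^ 2 := by
  have h := Lp.norm_fourier_eq (hf2.toLp f)
  have h' : eLpNorm (𝓕 f) 2 volume = eLpNorm f 2 volume := by
    rw [← eLpNorm_congr_ae (coeFn_fourier_toLp hf hf2), ← eLpNorm_congr_ae hf2.coeFn_toLp,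
      ← Lp.enorm_def, ← Lp.enorm_def, ← ofReal_norm, ← ofReal_norm, h]
  have h2 : ∀ g : ℝ → ℂ, ∫⁻ x, ‖g x‖ₑ ^ 2 = eLpNorm g 2 volume ^ 2 := fun g => by
    rw [eLpNorm_eq_lintegral_rpow_enorm_toReal (by norm_num) (by norm_num)]
    simp only [ENNReal.toReal_ofNat, one_div, ENNReal.rpow_ofNat]
    rw [← ENNReal.rpow_natCast, ← ENNReal.rpow_mul]; simp
  rw [h2 f, ← h', ← h2]
  simp only [fourier_eq_fourierIntegral]
  have e4 : ∀ u : ℝ, -(u / (2 * Real.pi)) = -(2 * Real.pi)⁻¹ * u := fun u => by ring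
  simp only [e4]
  have hne : -(2 * Real.pi)⁻¹ ≠ 0 := by
    simp
  have e5 : Measure.map (Homeomorph.mulLeft₀ (-(2 * Real.pi)⁻¹) hne).toMeasurableEquiv volume
      = ENNReal.ofReal (2 * Real.pi) • (volume : Measure ℝ) :=
    (Real.map_volume_mul_left hne).trans
      (by rw [← inv_neg, inv_inv, abs_neg, abs_of_pos Real.two_pi_pos])
  rw [← smul_eq_mul (ENNReal.ofReal _), ← lintegral_smul_measure, ← e5, lintegral_map_equiv]
  rfl

/-! ### Integral operators with bounded kernels supported in a rectangle of finite measure -/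

theorem integrableOn_L2 (f : L2) {B : Set ℝ} (hB : volume B ≠ ∞) :
    IntegrableOn (fun y => f y) B :=
  have : IsFiniteMeasure (volume.restrict B) := ⟨by simpa using hB.lt_top⟩
  ((Lp.memLp f).restrict B).integrable (by norm_num)

theorem setIntegral_norm_L2_le (f : L2) {B : Set ℝ} (hB : volume B ≠ ∞) :
    ∫ y in B, ‖f y‖ ≤ ‖f‖ * Real.sqrt (volume.real B) := by
  have h := eLpNorm_le_eLpNorm_mul_rpow_measure_univ (μ := volume.restrict B) (p := 1) (q := 2)
    (by norm_num) (Lp.memLp f).1.restrict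
  have h0 := h.trans (mul_le_mul_left (eLpNorm_restrict_le (f : ℝ → ℂ) 2 volume B) _)
  rw [Measure.restrict_apply_univ] at h0
  have e : (1 / (1 : ℝ≥0∞).toReal - 1 / (2 : ℝ≥0∞).toReal) = (1 / 2 : ℝ) := by norm_num
  rw [e] at h0
  rw [integral_norm_eq_lintegral_enorm (Lp.memLp f).1.restrict, ← eLpNorm_one_eq_lintegral_enorm]
  refine (ENNReal.toReal_mono (ENNReal.mul_ne_top (Lp.eLpNorm_ne_top f)
    (ENNReal.rpow_ne_top_of_nonneg (by norm_num) hB)) h0).trans ?_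
  rw [ENNReal.toReal_mul, ← Lp.norm_def, ← ENNReal.toReal_rpow, ← Real.sqrt_eq_rpow]
  rfl

theorem inner_L2_eq (f g : L2) :
    inner ℂ f g = ∫ x, g x * (starRingEnd ℂ) (f x) := by
  rw [L2.inner_def]; rfl

/-- `k` is measurable, bounded by `M`, and supported in `A × B`. -/
structure BoxKernel (k : ℝ → ℝ → ℝ) (M : ℝ) (A B : Set ℝ) : Prop where
  meas : Measurable (Function.uncurry k)
  bound : ∀ x y, |k x y| ≤ M
  measA : MeasurableSet A
  measB : MeasurableSet B
  finA : volume A ≠ ∞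
  finB : volume B ≠ ∞
  supp : ∀ x y, k x y ≠ 0 → x ∈ A ∧ y ∈ B

namespace BoxKernel

variable {k : ℝ → ℝ → ℝ} {M : ℝ} {A B : Set ℝ}

theorem nonneg (h : BoxKernel k M A B) : 0 ≤ M := (abs_nonneg _).trans (h.bound 0 0)

theorem norm_mul_le (h : BoxKernel k M A B) (f : ℝ → ℂ) (x y : ℝ) :
    ‖(k x y : ℂ) * f y‖ ≤ A.indicator (fun _ => M) x * B.indicator (fun y => ‖f y‖) y := by
  by_cases h0 : k x y = 0
  · rw [h0]
    simp only [Complex.ofReal_zero, zero_mul, norm_zero]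
    exact mul_nonneg (indicator_nonneg (fun _ _ => h.nonneg) _)
      (indicator_nonneg (fun _ _ => norm_nonneg _) _)
  · obtain ⟨hx, hy⟩ := h.supp x y h0
    rw [indicator_of_mem hx, indicator_of_mem hy, norm_mul, Complex.norm_real]
    exact mul_le_mul_of_nonneg_right (h.bound x y) (norm_nonneg _)

theorem integrable (h : BoxKernel k M A B) (f : L2) (x : ℝ) :
    Integrable (fun y => (k x y : ℂ) * f y) := by
  refine Integrable.mono' ((IntegrableOn.integrable_indicator (integrableOn_L2 f h.finB).norm h.measB).const_mul
    (A.indicator (fun _ => M) x)) ?_ (Eventually.of_forall fun y => h.norm_mul_le f x y)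
  exact (Complex.measurable_ofReal.comp (h.meas.comp
    measurable_prodMk_left)).aestronglyMeasurable.mul (Lp.memLp f).1

theorem aestronglyMeasurable (h : BoxKernel k M A B) (f : L2) :
    AEStronglyMeasurable (fun x => ∫ y, (k x y : ℂ) * f y) := by
  have : AEStronglyMeasurable (fun p : ℝ × ℝ => (k p.1 p.2 : ℂ) * f p.2) (volume.prod volume) :=
    (Complex.measurable_ofReal.comp h.meas).aestronglyMeasurable.mul (Lp.memLp f).1.comp_snd
  exact this.integral_prod_right'

theorem norm_integral_le (h : BoxKernel k M A B) (f : L2) (x : ℝ) :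
    ‖∫ y, (k x y : ℂ) * f y‖ ≤
      A.indicator (fun _ => M * Real.sqrt (volume.real B) * ‖f‖) x := by
  calc ‖∫ y, (k x y : ℂ) * f y‖ ≤
        ∫ y, A.indicator (fun _ => M) x * B.indicator (fun y => ‖f y‖) y :=
        norm_integral_le_of_norm_le ((IntegrableOn.integrable_indicator
          (integrableOn_L2 f h.finB).norm h.measB).const_mul _) (Eventually.of_forall fun y => h.norm_mul_le f x y)
    _ = A.indicator (fun _ => M) x * ∫ y in B, ‖f y‖ := by
        rw [integral_const_mul, integral_indicator h.measB]
    _ ≤ _ := by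
        by_cases hx : x ∈ A
        · simp only [indicator_of_mem hx]
          rw [mul_assoc, mul_comm (Real.sqrt _)]
          exact mul_le_mul_of_nonneg_left (setIntegral_norm_L2_le f h.finB) h.nonneg
        · simp [indicator_of_notMem hx]

theorem memLp (h : BoxKernel k M A B) (f : L2) :
    MemLp (fun x => ∫ y, (k x y : ℂ) * f y) 2 volume := by
  refine MemLp.of_le (memLp_indicator_const 2 h.measA (M * Real.sqrt (volume.real B) * ‖f‖)
    (Or.inr h.finA)) (h.aestronglyMeasurable f) (Eventually.of_forall fun x => ?_)
  exact (h.norm_integral_le f x).trans (le_abs_self _)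

/-- The integral operator with the kernel `k`. -/
noncomputable def op (h : BoxKernel k M A B) : L2 →L[ℂ] L2 :=
  LinearMap.mkContinuous
    { toFun := fun f => (h.memLp f).toLp _
      map_add' := fun f g => by
        ext1
        filter_upwards [(h.memLp (f + g)).coeFn_toLp, (h.memLp f).coeFn_toLp,
          (h.memLp g).coeFn_toLp, Lp.coeFn_add ((h.memLp f).toLp _) ((h.memLp g).toLp _)]
          with x h1 h2 h3 h4
        rw [h1, h4, Pi.add_apply, h2, h3, ← integral_add (h.integrable f x) (h.integrable g x)]
        refine integral_congr_ae ?_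
        filter_upwards [Lp.coeFn_add f g] with y hy
        rw [hy, Pi.add_apply, mul_add]
      map_smul' := fun c f => by
        ext1
        filter_upwards [(h.memLp (c • f)).coeFn_toLp, (h.memLp f).coeFn_toLp,
          Lp.coeFn_smul c ((h.memLp f).toLp _)] with x h1 h2 h4
        rw [h1, RingHom.id_apply, h4, Pi.smul_apply, h2, ← integral_smul]
        refine integral_congr_ae ?_
        filter_upwards [Lp.coeFn_smul c f] with y hy
        rw [hy, Pi.smul_apply, smul_eq_mul, smul_eq_mul]; ring }
    (M * Real.sqrt (volume.real B) * Real.sqrt (volume.real A)) fun f => by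
      have hb : 0 ≤ M * Real.sqrt (volume.real B) * ‖f‖ :=
        mul_nonneg (mul_nonneg h.nonneg (Real.sqrt_nonneg _)) (norm_nonneg _)
      have hm := memLp_indicator_const (μ := volume) 2 h.measA
        (M * Real.sqrt (volume.real B) * ‖f‖) (Or.inr h.finA)
      have : ‖(h.memLp f).toLp _‖ ≤ ‖hm.toLp _‖ := by
        refine Lp.norm_le_norm_of_ae_le ?_
        filter_upwards [(h.memLp f).coeFn_toLp, hm.coeFn_toLp] with x h1 h2
        rw [h1, h2]
        exact (h.norm_integral_le f x).trans (le_abs_self _)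
      refine this.trans (le_of_eq ?_)
      have := norm_indicatorConstLp (p := 2) (hs := h.measA) (hμs := h.finA)
        (c := M * Real.sqrt (volume.real B) * ‖f‖) (by norm_num) (by norm_num)
      rw [indicatorConstLp] at this
      rw [this, Real.norm_of_nonneg hb, Real.sqrt_eq_rpow, Real.sqrt_eq_rpow]
      norm_num
      ring

theorem op_apply (h : BoxKernel k M A B) (f : L2) :
    h.op f =ᵐ[volume] fun x => ∫ y, (k x y : ℂ) * f y :=
  (h.memLp f).coeFn_toLp

theorem norm_op_le (h : BoxKernel k M A B) :
    ‖h.op‖ ≤ M * Real.sqrt (volume.real B) * Real.sqrt (volume.real A) :=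
  LinearMap.mkContinuous_norm_le _ (mul_nonneg (mul_nonneg h.nonneg (Real.sqrt_nonneg _))
    (Real.sqrt_nonneg _)) _

/-- Fubini, legitimate because the kernel is dominated by M times a product of indicators of sets of
finite measure, on which L² functions are integrable. -/
theorem op_isSymmetric (h : BoxKernel k M A B) (hs : ∀ x y, k x y = k y x) :
    h.op.IsSymmetric := by
  intro f g
  have e1 : ∀ f g : L2, inner ℂ (h.op f) g =
      ∫ x, ∫ y, (k x y : ℂ) * ((starRingEnd ℂ) (f y) * g x) := by
    intro f g
    rw [inner_L2_eq]
    refine integral_congr_ae ?_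
    filter_upwards [h.op_apply f] with x hx
    rw [hx, ← integral_conj, ← integral_const_mul]
    congr 1; ext y
    simp only [map_mul, Complex.conj_ofReal]; ring
  have e2 : inner ℂ f (h.op g) = ∫ x, ∫ y, (k x y : ℂ) * ((starRingEnd ℂ) (f x) * g y) := by
    rw [inner_L2_eq]
    refine integral_congr_ae ?_
    filter_upwards [h.op_apply g] with x hx
    rw [hx, ← integral_mul_const]
    congr 1; ext y
    ring
  change inner ℂ (h.op f) g = inner ℂ f (h.op g)
  rw [e1, e2, integral_integral_swap]
  · simp only [hs]
  · have i1 := IntegrableOn.integrable_indicator (integrableOn_L2 f h.finB).norm h.measB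
    have i2 := IntegrableOn.integrable_indicator ((integrableOn_L2 g h.finA).norm.const_mul M) h.measA
    refine Integrable.mono' (i2.mul_prod i1) ?_ (Eventually.of_forall fun p => ?_)
    · exact (Complex.measurable_ofReal.comp h.meas).aestronglyMeasurable.mul
        ((Complex.continuous_conj.comp_aestronglyMeasurable (Lp.memLp f).1.comp_snd).mul
          (Lp.memLp g).1.comp_fst)
    · simp only [Function.uncurry]
      by_cases h0 : k p.1 p.2 = 0
      · rw [h0]
        simp only [Complex.ofReal_zero, zero_mul, norm_zero]
        exact mul_nonneg (indicator_nonneg (fun _ _ => mul_nonneg h.nonneg (norm_nonneg _)) _)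
          (indicator_nonneg (fun _ _ => norm_nonneg _) _)
      · obtain ⟨hx, hy⟩ := h.supp _ _ h0
        rw [indicator_of_mem hx, indicator_of_mem hy, norm_mul, norm_mul, RCLike.norm_conj,
          Complex.norm_real, mul_comm ‖f p.2‖, ← mul_assoc]
        gcongr
        exact h.bound _ _

end BoxKernel

/-! ### The truncated Hankel operators -/

/-- The kernel of `K[t]`. -/
noncomputable def truncKernel (K : ℝ → ℝ) (t x y : ℝ) : ℝ := if x < t ∧ y < t then K (x + y) else 0

theorem truncHankel_eq (K : ℝ → ℝ) (t : ℝ) (f : ℝ → ℂ) (x : ℝ) :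
    truncHankel K t f x = ∫ y, (truncKernel K t x y : ℂ) * f y := by
  rw [truncHankel]
  by_cases hx : x < t
  · rw [indicator_of_mem (mem_Iio.2 hx), ← integral_indicator measurableSet_Iio]
    congr 1; ext y
    by_cases hy : y < t
    · simp [truncKernel, hx, hy]
    · simp [truncKernel, hx, hy]
  · rw [indicator_of_notMem (by simpa using hx)]
    simp [truncKernel, hx]

/-- Causality of K forces x + y ≥ 0, and with x, y < t this bounds both variables below by -t. So
K[t], formally an operator on a half-line, lives on a bounded square. -/
theorem truncKernel_supp {K : ℝ → ℝ} (h3 : CondK3 K) {t x y : ℝ} (h : truncKernel K t x y ≠ 0) :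
    (-t < x ∧ x < t) ∧ (-t < y ∧ y < t) := by
  unfold truncKernel at h
  split_ifs at h with h0
  · have : 0 ≤ x + y := by
      by_contra! hc
      exact h (h3 _ hc)
    refine ⟨⟨?_, h0.1⟩, ?_, h0.2⟩ <;> linarith [h0.1, h0.2]
  · exact absurd rfl h

theorem measurable_truncKernel {K : ℝ → ℝ} (hK : Continuous K) (t : ℝ) :
    Measurable (Function.uncurry (truncKernel K t)) := by
  refine Measurable.ite ?_ (hK.measurable.comp (measurable_fst.add measurable_snd))
    measurable_const
  exact (measurableSet_lt measurable_fst measurable_const).inter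
    (measurableSet_lt measurable_snd measurable_const)

theorem exists_bound_on_Icc {K : ℝ → ℝ} (hK : Continuous K) (R : ℝ) :
    ∃ M, 0 ≤ M ∧ ∀ u, |u| ≤ R → |K u| ≤ M := by
  obtain ⟨M, hM⟩ := (isCompact_Icc (a := -R) (b := R)).exists_bound_of_continuousOn hK.continuousOn
  exact ⟨max M 0, le_max_right _ _, fun u hu => (hM u (abs_le.1 hu)).trans (le_max_left _ _)⟩

theorem exists_boxKernel {K : ℝ → ℝ} (hK : Continuous K) (h3 : CondK3 K) (t : ℝ) :
    ∃ M, BoxKernel (truncKernel K t) M (Ioo (-t) t) (Ioo (-t) t) := by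
  obtain ⟨M, hM0, hM⟩ := exists_bound_on_Icc hK (2 * t)
  refine ⟨M, measurable_truncKernel hK t, fun x y => ?_, measurableSet_Ioo, measurableSet_Ioo,
    by simp, by simp, fun x y h => truncKernel_supp h3 h⟩
  by_cases h : truncKernel K t x y = 0
  · rw [h]; simpa using hM0
  · obtain ⟨⟨h1, h2⟩, h4, h5⟩ := truncKernel_supp h3 h
    rw [truncKernel, if_pos ⟨h2, h5⟩]
    exact hM _ (abs_le.2 ⟨by linarith, by linarith⟩)

theorem coeFn_sum_L2 {ι : Type*} (s : Finset ι) (g : ι → L2) :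
    ⇑(∑ i ∈ s, g i) =ᵐ[volume] fun x => ∑ i ∈ s, g i x := by
  classical
  induction s using Finset.induction_on with
  | empty => simpa only [Finset.sum_empty] using! Lp.coeFn_zero ℂ 2 (volume : Measure ℝ)
  | insert a s ha ih =>
    rw [Finset.sum_insert ha]
    filter_upwards [Lp.coeFn_add (g a) (∑ i ∈ s, g i), ih] with x h1 h2
    rw [h1, Pi.add_apply, h2, Finset.sum_insert ha]

/-- An operator whose kernel is a polynomial in `x + y` on a square is compact. -/
theorem isCompactOperator_of_polynomial {p : Polynomial ℝ} {M t : ℝ} {k : ℝ → ℝ → ℝ}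
    (h : BoxKernel k M (Ioo (-t) t) (Ioo (-t) t))
    (hk : ∀ x ∈ Ioo (-t) t, ∀ y ∈ Ioo (-t) t, k x y = p.eval (x + y)) :
    IsCompactOperator h.op := by
  let A := Ioo (-t) t
  have hA : volume A ≠ ∞ := by simp [A]
  have hcA : ∀ g : ℝ → ℝ, Continuous g → ∃ C, ∀ x ∈ A, |g x| ≤ C := fun g hg => by
    obtain ⟨C, _, hC⟩ := exists_bound_on_Icc hg t
    exact ⟨C, fun x hx => hC x (abs_le.2 ⟨hx.1.le, hx.2.le⟩)⟩
  have hm : ∀ i : ℕ, MemLp (A.indicator fun x : ℝ => (x : ℂ) ^ i) 2 volume := fun i => by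
    obtain ⟨C, hC⟩ := hcA (fun x => x ^ i) (by fun_prop)
    refine MemLp.of_le (memLp_indicator_const 2 measurableSet_Ioo C (Or.inr hA))
      ((by fun_prop : Continuous fun x : ℝ => (x : ℂ) ^ i).aestronglyMeasurable.indicator
        measurableSet_Ioo) (Eventually.of_forall fun x => ?_)
    by_cases hx : x ∈ A
    · rw [indicator_of_mem hx, indicator_of_mem hx, ← Complex.ofReal_pow, Complex.norm_real]
      exact (hC x hx).trans (le_abs_self _)
    · rw [indicator_of_notMem hx, norm_zero]; positivity
  let V : Submodule ℂ L2 :=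
    Submodule.span ℂ (Set.range fun i : Fin (p.natDegree + 1) => (hm i).toLp _)
  have hfd : FiniteDimensional ℂ V := FiniteDimensional.span_of_finite ℂ (Set.finite_range _)
  have hV : ∀ f, h.op f ∈ V := by
    intro f
    -- Expanding p(x+y) in powers of x shows that the range is spanned by the truncated monomials;
    -- these are the coordinates of the image of f.
    let c : Fin (p.natDegree + 1) → ℂ := fun i =>
      ∫ y in A, (((Polynomial.taylor y p).coeff i : ℝ) : ℂ) * f y
    have hi : ∀ i : Fin (p.natDegree + 1),
        IntegrableOn (fun y => (((Polynomial.taylor y p).coeff i : ℝ) : ℂ) * f y) A := fun i => by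
      have hcont : Continuous fun y : ℝ => (Polynomial.taylor y p).coeff i := by
        simp only [Polynomial.taylor_coeff]
        exact Polynomial.continuous _
      obtain ⟨C, hC⟩ := hcA _ hcont
      refine Integrable.bdd_mul (c := C) (integrableOn_L2 f hA)
        (Complex.continuous_ofReal.comp hcont).aestronglyMeasurable ?_
      filter_upwards [ae_restrict_mem measurableSet_Ioo] with y hy
      simpa using hC y hy
    have : h.op f = ∑ i, c i • (hm i).toLp _ := by
      ext1
      have h3 := coeFn_sum_L2 Finset.univ (fun i => c i • (hm i).toLp _)
      have h4 : ∀ᵐ x, ∀ i, (c i • (hm i).toLp _ : L2) x = c i * A.indicator (fun x : ℝ => (x : ℂ) ^ (i : ℕ)) x := by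
        rw [ae_all_iff]
        intro i
        filter_upwards [Lp.coeFn_smul (c i) ((hm i).toLp _), (hm i).coeFn_toLp] with x h5 h6
        rw [h5, Pi.smul_apply, h6, smul_eq_mul]
      filter_upwards [h.op_apply f, h3, h4] with x h1 h3 h4
      rw [h1, h3]
      simp only [h4]
      by_cases hx : x ∈ A
      · simp only [indicator_of_mem hx, c, ← integral_mul_const]
        rw [← integral_finsetSum _ (fun i _ => (hi i).mul_const _),
          ← integral_indicator measurableSet_Ioo]
        congr 1; ext y
        by_cases hy : y ∈ A
        · rw [indicator_of_mem hy, hk x hx y hy, ← Polynomial.taylor_eval, Polynomial.eval_eq_sum_range,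
            Polynomial.natDegree_taylor, Finset.sum_range]
          push_cast
          rw [Finset.sum_mul]
          exact Finset.sum_congr rfl fun i _ => by ring
        · rw [indicator_of_notMem hy]
          have : k x y = 0 := by
            by_contra hc
            exact hy (h.supp _ _ hc).2
          simp [this]
      · have : ∀ y, k x y = 0 := fun y => by
          by_contra hc
          exact hx (h.supp _ _ hc).1
        simp [this, indicator_of_notMem hx]
    rw [this]
    exact Submodule.sum_mem _ fun i _ => Submodule.smul_mem _ _
      (Submodule.subset_span (Set.mem_range_self i))
  have : h.op = V.subtypeL ∘L (h.op.codRestrict V hV) := by ext f; rfl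
  rw [this]
  exact ((isCompactOperator_id (E := V)).comp_clm (h.op.codRestrict V hV)).clm_comp V.subtypeL

theorem truncKernel_comm (K : ℝ → ℝ) (t x y : ℝ) : truncKernel K t x y = truncKernel K t y x := by
  simp only [truncKernel, and_comm, add_comm]

/-- The operator `K[t]` on `L²(ℝ)`. -/
noncomputable def truncOp {K : ℝ → ℝ} (hK : Continuous K) (h3 : CondK3 K) (t : ℝ) : L2 →L[ℂ] L2 :=
  (exists_boxKernel hK h3 t).choose_spec.op

section truncOp

variable {K : ℝ → ℝ} (hK : Continuous K) (h3 : CondK3 K)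

theorem truncOp_apply (t : ℝ) (f : L2) : truncOp hK h3 t f =ᵐ[volume] truncHankel K t f := by
  have := (exists_boxKernel hK h3 t).choose_spec.op_apply f
  filter_upwards [this] with x hx
  rw [truncHankel_eq]
  exact hx

theorem truncOp_isSymmetric (t : ℝ) : (truncOp hK h3 t).IsSymmetric :=
  (exists_boxKernel hK h3 t).choose_spec.op_isSymmetric (truncKernel_comm K t)

/-- By Weierstrass, K is a uniform limit of polynomials on the values of x + y that occur. The
corresponding operators have finite rank and converge in norm, and the compact operators are closed.
-/
theorem isCompactOperator_truncOp (t : ℝ) : IsCompactOperator (truncOp hK h3 t) := by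
  have hcl := isClosed_setOfPred_isCompactOperator (σ₁₂ := RingHom.id ℂ) (M₁ := L2) (M₂ := L2)
  refine hcl.closure_subset (Metric.mem_closure_iff.2 fun ε hε => ?_)
  obtain ⟨M, hM⟩ : ∃ M, BoxKernel (truncKernel K t) M (Ioo (-t) t) (Ioo (-t) t) :=
    exists_boxKernel hK h3 t
  let D := Real.sqrt (volume.real (Ioo (-t) t)) * Real.sqrt (volume.real (Ioo (-t) t))
  have hD : 0 ≤ D := by positivity
  -- The sum x + y stays in [-2t, 2t]. Dividing by D + 1 rather than D keeps the final inequality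
  -- strict and covers D = 0.
  obtain ⟨p, hp⟩ := exists_polynomial_near_of_continuousOn (-(2 * t)) (2 * t) K hK.continuousOn
    (ε / (D + 1)) (by positivity)
  let kp : ℝ → ℝ → ℝ := fun x y =>
    if (-t < x ∧ x < t) ∧ (-t < y ∧ y < t) then p.eval (x + y) else 0
  have hkm : Measurable (Function.uncurry kp) := by
    refine Measurable.ite ?_ (p.continuous.measurable.comp (measurable_fst.add measurable_snd))
      measurable_const
    exact ((measurableSet_lt measurable_const measurable_fst).inter
      (measurableSet_lt measurable_fst measurable_const)).inter
      ((measurableSet_lt measurable_const measurable_snd).inter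
      (measurableSet_lt measurable_snd measurable_const))
  obtain ⟨C, hC0, hC⟩ := exists_bound_on_Icc p.continuous (2 * t)
  have hkp : BoxKernel kp C (Ioo (-t) t) (Ioo (-t) t) := by
    refine ⟨hkm, fun x y => ?_, measurableSet_Ioo, measurableSet_Ioo, by simp, by simp,
      fun x y h => ?_⟩
    · simp only [kp]
      split_ifs with h
      · exact hC _ (abs_le.2 ⟨by linarith [h.1.1, h.2.1], by linarith [h.1.2, h.2.2]⟩)
      · simpa using hC0
    · simp only [kp] at h
      split_ifs at h with h0
      · exact h0
      · exact absurd rfl h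
  have hdiff : BoxKernel (fun x y => truncKernel K t x y - kp x y) (ε / (D + 1))
      (Ioo (-t) t) (Ioo (-t) t) := by
    have hs : ∀ x y, truncKernel K t x y - kp x y ≠ 0 →
        (-t < x ∧ x < t) ∧ (-t < y ∧ y < t) := fun x y h => by
      by_contra hc
      apply h
      have : truncKernel K t x y = 0 := by
        by_contra h0
        exact hc (truncKernel_supp h3 h0)
      simp only [this, kp, if_neg hc, sub_zero]
    refine ⟨(measurable_truncKernel hK t).sub hkm, fun x y => ?_, measurableSet_Ioo,
      measurableSet_Ioo, by simp, by simp, fun x y h => hs x y h⟩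
    by_cases h : truncKernel K t x y - kp x y = 0
    · rw [h, abs_zero]; positivity
    · have h0 := hs x y h
      simp only [kp, if_pos h0, truncKernel, if_pos (And.intro h0.1.2 h0.2.2)]
      rw [abs_sub_comm]
      exact (hp _ ⟨by linarith [h0.1.1, h0.2.1], by linarith [h0.1.2, h0.2.2]⟩).le
  refine ⟨hkp.op, isCompactOperator_of_polynomial hkp (p := p) fun x hx y hy => ?_, ?_⟩
  · simp only [kp]
    rw [if_pos ⟨hx, hy⟩]
  · have e : truncOp hK h3 t - hkp.op = hdiff.op := by
      ext1 f
      ext1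
      rw [sub_apply]
      filter_upwards [Lp.coeFn_sub (truncOp hK h3 t f) (hkp.op f), truncOp_apply hK h3 t f,
        hkp.op_apply f, hdiff.op_apply f] with x h1 h2 h4 h5
      rw [h1, Pi.sub_apply, h2, h4, h5, truncHankel_eq,
        ← integral_sub (hM.integrable f x) (hkp.integrable f x)]
      congr 1; ext y; push_cast; ring
    rw [dist_eq_norm, e]
    refine hdiff.norm_op_le.trans_lt ?_
    rw [mul_assoc]
    change ε / (D + 1) * D < ε
    rw [div_mul_eq_mul_div, div_lt_iff₀ (by positivity)]
    nlinarith

/-- The kernels of K[t] and K[s] differ only where x or y lies in [s,t). Cutting this region into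
two strips of width t - s bounds the difference by the square root of the width. -/
theorem norm_truncOp_sub_le {R M s t : ℝ} (hM0 : 0 ≤ M) (hM : ∀ u, |u| ≤ 2 * R → |K u| ≤ M)
    (hst : s ≤ t) (htR : t ≤ R) :
    ‖truncOp hK h3 t - truncOp hK h3 s‖ ≤
      2 * (M * Real.sqrt (2 * R) * Real.sqrt (t - s)) := by
  have hbd : ∀ x y, |truncKernel K t x y - truncKernel K s x y| ≤ M := fun x y => by
    by_cases h : truncKernel K t x y = 0
    · have : truncKernel K s x y = 0 := by
        unfold truncKernel at h ⊢
        split_ifs with h0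
        · rwa [if_pos ⟨h0.1.trans_le hst, h0.2.trans_le hst⟩] at h
        · rfl
      simpa [h, this] using hM0
    · obtain ⟨⟨h1, h2⟩, h4, h5⟩ := truncKernel_supp h3 h
      have hb : |K (x + y)| ≤ M := hM _ (abs_le.2 ⟨by linarith, by linarith⟩)
      rw [truncKernel, if_pos ⟨h2, h5⟩, truncKernel]
      split_ifs
      · simpa using hM0
      · simpa using hb
  have hsupp : ∀ x y, truncKernel K t x y - truncKernel K s x y ≠ 0 →
      ((-R < x ∧ x < R) ∧ (-R < y ∧ y < R)) ∧ ((s ≤ x ∧ x < t) ∨ (s ≤ y ∧ y < t)) := by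
    intro x y h
    have h0 : truncKernel K t x y ≠ 0 := fun h0 => by
      apply h
      rw [h0]
      unfold truncKernel at h0 ⊢
      split_ifs with h1
      · rw [if_pos ⟨h1.1.trans_le hst, h1.2.trans_le hst⟩] at h0
        rw [h0, sub_zero]
      · simp
    obtain ⟨⟨h1, h2⟩, h4, h5⟩ := truncKernel_supp h3 h0
    refine ⟨⟨⟨by linarith, by linarith⟩, by linarith, by linarith⟩, ?_⟩
    by_contra! hc
    apply h
    have hx : x < s := by
      by_contra! hx; exact absurd (hc.1 hx) (by linarith)
    have hy : y < s := by
      by_contra! hy; exact absurd (hc.2 hy) (by linarith)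
    rw [truncKernel, truncKernel, if_pos ⟨h2, h5⟩, if_pos ⟨hx, hy⟩, sub_self]
  have hm := (measurable_truncKernel hK t).sub (measurable_truncKernel hK s)
  have hset : MeasurableSet {p : ℝ × ℝ | s ≤ p.1 ∧ p.1 < t} :=
    (measurableSet_le measurable_const measurable_fst).inter
      (measurableSet_lt measurable_fst measurable_const)
  have k1 : BoxKernel (fun x y => if s ≤ x ∧ x < t then
      truncKernel K t x y - truncKernel K s x y else 0) M (Ico s t) (Ioo (-R) R) := by
    refine ⟨Measurable.ite hset hm measurable_const, fun x y => ?_, measurableSet_Ico,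
      measurableSet_Ioo, by simp, by simp, fun x y h => ?_⟩
    · split_ifs
      · exact hbd x y
      · simpa using hM0
    · split_ifs at h with h0
      · exact ⟨h0, (hsupp x y h).1.2⟩
      · exact absurd rfl h
  -- The overlap of the two strips belongs to `k1`, so the kernels add up exactly.
  have k2 : BoxKernel (fun x y => if s ≤ x ∧ x < t then 0 else
      truncKernel K t x y - truncKernel K s x y) M (Ioo (-R) R) (Ico s t) := by
    refine ⟨Measurable.ite hset measurable_const hm, fun x y => ?_, measurableSet_Ioo,
      measurableSet_Ico, by simp, by simp, fun x y h => ?_⟩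
    · split_ifs
      · simpa using hM0
      · exact hbd x y
    · split_ifs at h with h0
      · exact absurd rfl h
      · exact ⟨(hsupp x y h).1.1, (hsupp x y h).2.resolve_left h0⟩
  have e : truncOp hK h3 t - truncOp hK h3 s = k1.op + k2.op := by
    ext1 f
    ext1
    rw [sub_apply, add_apply]
    obtain ⟨_, ht⟩ := exists_boxKernel hK h3 t
    obtain ⟨_, hs⟩ := exists_boxKernel hK h3 s
    filter_upwards [Lp.coeFn_sub (truncOp hK h3 t f) (truncOp hK h3 s f), truncOp_apply hK h3 t f,
      truncOp_apply hK h3 s f, k1.op_apply f, k2.op_apply f, Lp.coeFn_add (k1.op f) (k2.op f)]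
      with x h1 h2 h4 h5 h6 h7
    rw [h1, h7, Pi.sub_apply, Pi.add_apply, h2, h4, h5, h6, truncHankel_eq, truncHankel_eq,
      ← integral_sub (ht.integrable f x) (hs.integrable f x),
      ← integral_add (k1.integrable f x) (k2.integrable f x)]
    congr 1; ext y
    split_ifs <;> push_cast <;> ring
  rw [e]
  have hv1 : volume.real (Ico s t) = t - s := by
    simp [Measure.real, hst]
  have hv3 : Real.sqrt (volume.real (Ioo (-R) R)) = Real.sqrt (2 * R) := by
    rcases le_or_gt 0 R with h | h
    · congr 1
      simp only [Measure.real, Real.volume_Ioo]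
      rw [ENNReal.toReal_ofReal] <;> linarith
    · simp only [Measure.real, Real.volume_Ioo]
      rw [ENNReal.ofReal_of_nonpos (by linarith), Real.sqrt_eq_zero_of_nonpos (show 2 * R ≤ 0 by linarith)]
      simp
  refine (norm_add_le _ _).trans ((add_le_add k1.norm_op_le k2.norm_op_le).trans (le_of_eq ?_))
  rw [hv1, hv3]; ring

theorem continuous_truncOp : Continuous (truncOp hK h3) := by
  rw [Metric.continuous_iff']
  intro t ε hε
  obtain ⟨M, hM0, hM⟩ := exists_bound_on_Icc hK (2 * (t + 1))
  have hlim : Tendsto (fun s : ℝ => 2 * (M * Real.sqrt (2 * (t + 1)) * Real.sqrt |s - t|)) (𝓝 t)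
      (𝓝 0) := by
    have : ContinuousAt
        (fun s : ℝ => 2 * (M * Real.sqrt (2 * (t + 1)) * Real.sqrt |s - t|)) t := by fun_prop
    simpa [ContinuousAt] using this
  filter_upwards [hlim.eventually_lt_const hε, Iio_mem_nhds (show t < t + 1 by linarith)]
    with s hs1 hs2
  refine lt_of_le_of_lt ?_ hs1
  rw [dist_eq_norm]
  rcases le_total s t with h | h
  · rw [norm_sub_rev, abs_sub_comm, abs_of_nonneg (by linarith)]
    exact norm_truncOp_sub_le hK h3 hM0 hM h (by linarith)
  · rw [abs_of_nonneg (by linarith)]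
    exact norm_truncOp_sub_le hK h3 hM0 hM h (le_of_lt hs2)

theorem truncOp_of_nonpos {t : ℝ} (ht : t ≤ 0) : truncOp hK h3 t = 0 := by
  ext1 f
  ext1
  filter_upwards [truncOp_apply hK h3 t f, Lp.coeFn_zero ℂ 2 (volume : Measure ℝ)] with x h1 h2
  rw [h1, truncHankel_eq, zero_apply, h2]
  have : ∀ y, truncKernel K t x y = 0 := fun y => by
    by_contra h
    have := truncKernel_supp h3 h
    linarith [this.1.1, this.1.2]
  simp [this]

/-- A selfadjoint compact operator of norm one has `1` or `-1` as an eigenvalue. -/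
theorem exists_eigenvector_of_norm_eq_one {T : L2 →L[ℂ] L2} (hT : IsCompactOperator T)
    (hs : T.IsSymmetric) (h1 : ‖T‖ = 1) : ∃ lam : ℂ, (lam = 1 ∨ lam = -1) ∧
      ∃ f : L2, f ≠ 0 ∧ T f = lam • f := by
  have hsa : IsSelfAdjoint T := hs.isSelfAdjoint
  have hnt : Nontrivial L2 := by
    by_contra hn
    rw [not_nontrivial_iff_subsingleton] at hn
    have : T = 0 := Subsingleton.elim _ _
    rw [this, norm_zero] at h1
    exact zero_ne_one h1
  have hne : (spectrum ℂ T).Nonempty := spectrum.nonempty T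
  -- For a selfadjoint operator the spectral radius is the norm, so the spectrum contains a point of
  -- modulus one. Compactness makes it an eigenvalue and selfadjointness makes it real.
  obtain ⟨lam, hl, hr⟩ := spectrum.exists_nnnorm_eq_spectralRadius_of_nonempty hne
  rw [hsa.spectralRadius_eq_nnnorm] at hr
  have hn : ‖lam‖ = 1 := by
    rw [← h1]; exact congrArg NNReal.toReal (by exact_mod_cast hr)
  have hne0 : lam ≠ 0 := by
    rintro rfl; simp at hn
  have hev := (hT.hasEigenvalue_iff_mem_spectrum hne0).2 hl
  obtain ⟨f, hf⟩ := hev.exists_hasEigenvector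
  refine ⟨lam, ?_, f, hf.2, hf.apply_eq_smul⟩
  have him : lam = lam.re := hsa.mem_spectrum_eq_re hl
  rw [him, Complex.norm_real, Real.norm_eq_abs] at hn
  rcases eq_or_eq_neg_of_abs_eq hn with h | h
  · left; rw [him, h]; simp
  · right; rw [him, h]; simp

/-- The image of K[t] vanishes on [t,∞), so an eigenvector on L²(ℝ) with nonzero eigenvalue does
too; its restriction to (-∞,t) is therefore a nonzero eigenfunction, excluded by `CondK5`. -/
theorem norm_truncOp_ne_one (h5 : CondK5 K) {t : ℝ} (ht : 0 ≤ t) : ‖truncOp hK h3 t‖ ≠ 1 := by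
  intro h1
  obtain ⟨lam, hlam, f, hf, hT⟩ := exists_eigenvector_of_norm_eq_one
    (isCompactOperator_truncOp hK h3 t) (truncOp_isSymmetric hK h3 t) h1
  have hae : truncHankel K t f =ᵐ[volume] fun x => lam * f x := by
    filter_upwards [truncOp_apply hK h3 t f, Lp.coeFn_smul lam f] with x h1 h2
    rw [← h1, hT, h2, Pi.smul_apply, smul_eq_mul]
  have hev : IsTruncEigenvalue K t lam := by
    refine ⟨f, (Lp.memLp f).restrict _, fun h0 => hf ?_, ae_restrict_of_ae hae⟩
    rw [Filter.EventuallyEq, ae_restrict_iff' measurableSet_Iio] at h0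
    ext1
    filter_upwards [h0, hae, Lp.coeFn_zero ℂ 2 (volume : Measure ℝ)] with x h0 h1 h2
    rw [h2]
    by_cases hx : x < t
    · exact h0 hx
    · rw [truncHankel, indicator_of_notMem (by simpa using hx)] at h1
      have : lam ≠ 0 := by rcases hlam with h | h <;> rw [h] <;> norm_num
      simpa [this] using h1.symm
  rcases hlam with h | h
  · exact (h5 t ht).1 (h ▸ hev)
  · exact (h5 t ht).2 (h ▸ hev)

/-- A continuity argument: the norm is zero for t ≤ 0, varies continuously, and can never take the
value one. -/
theorem norm_truncOp_lt_one (h5 : CondK5 K) (t : ℝ) : ‖truncOp hK h3 t‖ < 1 := by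
  rcases le_or_gt t 0 with ht | ht
  · rw [truncOp_of_nonpos hK h3 ht, norm_zero]; exact one_pos
  · by_contra! hc
    have hcont : ContinuousOn (fun s => ‖truncOp hK h3 s‖) (Icc 0 t) :=
      (continuous_truncOp hK h3).norm.continuousOn
    have h0 : ‖truncOp hK h3 0‖ ≤ 1 := by
      rw [truncOp_of_nonpos hK h3 le_rfl, norm_zero]; exact zero_le_one
    obtain ⟨s, hs, hs1⟩ := intermediate_value_Icc ht.le hcont ⟨h0, hc⟩
    exact norm_truncOp_ne_one hK h3 h5 hs.1 hs1

end truncOp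

/-! ### The strong limit of the truncated operators -/

/-- The Hankel integral of `f`. -/
noncomputable def hankel (K : ℝ → ℝ) (f : ℝ → ℂ) (x : ℝ) : ℂ := ∫ y, (K (x + y) : ℂ) * f y

theorem truncHankel_eq_hankel {K : ℝ → ℝ} {f : ℝ → ℂ} {R t : ℝ} (hR : R ≤ t)
    (hf : ∀ᵐ x, R ≤ x → f x = 0) (x : ℝ) :
    truncHankel K t f x = (Iio t).indicator (hankel K f) x := by
  rw [truncHankel]
  congr 1
  ext x
  rw [hankel, ← integral_indicator measurableSet_Iio]
  refine integral_congr_ae ?_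
  filter_upwards [hf] with y hy
  by_cases h : y < t
  · rw [indicator_of_mem (mem_Iio.2 h)]
  · rw [indicator_of_notMem (by simpa using h), hy (by linarith), mul_zero]

theorem exists_compactSupport_near (f : L2) {ε : ℝ} (hε : 0 < ε) :
    ∃ g : L2, (∃ R, 0 ≤ R ∧ ∀ᵐ x, R ≤ |x| → g x = 0) ∧ ‖f - g‖ ≤ ε := by
  obtain ⟨g, hgc, hg, _, hgm⟩ := (Lp.memLp f).exists_hasCompactSupport_eLpNorm_sub_le
    (by norm_num) (ε := ENNReal.ofReal ε) (by simpa using hε)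
  refine ⟨hgm.toLp g, ?_, ?_⟩
  · obtain ⟨R, hR⟩ := hgc.isCompact.isBounded.subset_closedBall (0 : ℝ)
    refine ⟨max (R + 1) 0, le_max_right _ _, ?_⟩
    filter_upwards [hgm.coeFn_toLp] with x hx hxR
    rw [hx]
    by_contra hne
    have := hR (subset_tsupport _ hne)
    rw [Metric.mem_closedBall, dist_zero_right, Real.norm_eq_abs] at this
    linarith [le_max_left (R + 1) 0]
  · rw [Lp.norm_def]
    refine ENNReal.toReal_le_of_le_ofReal hε.le ?_
    refine le_trans (le_of_eq (eLpNorm_congr_ae ?_)) hg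
    filter_upwards [Lp.coeFn_sub f (hgm.toLp g), hgm.coeFn_toLp] with x h1 h2
    rw [h1, Pi.sub_apply, h2, Pi.sub_apply]

section limit

variable {K : ℝ → ℝ} (hK : Continuous K) (h3 : CondK3 K)

/-- Beyond the support of g the functions K[t]g are restrictions of one function to (-∞,t). The
increment lives on [s,t), orthogonal to what came before, and Pythagoras applies. -/
theorem norm_sq_truncOp_sub {g : L2} {R s t : ℝ} (hg : ∀ᵐ x, R ≤ x → g x = 0) (hs : R ≤ s)
    (hst : s ≤ t) : ‖truncOp hK h3 t g - truncOp hK h3 s g‖ ^ 2 =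
      ‖truncOp hK h3 t g‖ ^ 2 - ‖truncOp hK h3 s g‖ ^ 2 := by
  have h0 : inner ℂ (truncOp hK h3 s g) (truncOp hK h3 t g - truncOp hK h3 s g) = 0 := by
    rw [inner_L2_eq]
    rw [integral_eq_zero_of_ae]
    filter_upwards [truncOp_apply hK h3 t g, truncOp_apply hK h3 s g,
      Lp.coeFn_sub (truncOp hK h3 t g) (truncOp hK h3 s g)] with x h1 h2 h4
    rw [h4, Pi.sub_apply, h1, h2, truncHankel_eq_hankel (hs.trans hst) hg,
      truncHankel_eq_hankel hs hg]
    by_cases hx : x < s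
    · rw [indicator_of_mem (mem_Iio.2 (hx.trans_le hst)), indicator_of_mem (mem_Iio.2 hx)]
      simp
    · rw [indicator_of_notMem (s := Iio s) (by simpa using hx)]
      simp
  have := norm_add_sq_eq_norm_sq_add_norm_sq_of_inner_eq_zero _ _ h0
  rw [add_sub_cancel] at this
  linarith [this, sq ‖truncOp hK h3 t g‖, sq ‖truncOp hK h3 s g‖,
    sq ‖truncOp hK h3 t g - truncOp hK h3 s g‖]

variable (h5 : CondK5 K)
include h5

theorem norm_truncOp_apply_le (t : ℝ) (f : L2) : ‖truncOp hK h3 t f‖ ≤ ‖f‖ := by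
  simpa using (truncOp hK h3 t).le_of_opNorm_le (norm_truncOp_lt_one hK h3 h5 t).le f

theorem cauchySeq_truncOp_of_support {g : L2} {R : ℝ} (hg : ∀ᵐ x, R ≤ x → g x = 0) :
    CauchySeq fun t => truncOp hK h3 t g := by
  -- Replacing t by `max t R` makes the squared norm monotone on the whole line. It is bounded,
  -- hence Cauchy, and its increments are the squared distances.
  let a : ℝ → ℝ := fun t => ‖truncOp hK h3 (max t R) g‖ ^ 2
  have hmono : Monotone a := fun s t hst => by
    have := norm_sq_truncOp_sub hK h3 hg (le_max_right s R) (max_le_max_right R hst)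
    have h2 := sq_nonneg ‖truncOp hK h3 (max t R) g - truncOp hK h3 (max s R) g‖
    simp only [a]; linarith
  have hbdd : BddAbove (range a) := ⟨‖g‖ ^ 2, by
    rintro _ ⟨t, rfl⟩
    exact pow_le_pow_left₀ (norm_nonneg _) (norm_truncOp_apply_le hK h3 h5 _ g) 2⟩
  have hc : CauchySeq a := (tendsto_atTop_ciSup hmono hbdd).cauchySeq
  rw [Metric.cauchySeq_iff'] at hc ⊢
  intro ε hε
  obtain ⟨N, hN⟩ := hc (ε ^ 2) (by positivity)
  refine ⟨max N R, fun t ht => ?_⟩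
  have ht1 : N ≤ t := (le_max_left _ _).trans ht
  have ht2 : R ≤ t := (le_max_right _ _).trans ht
  have h := hN t ht1
  simp only [a, max_eq_left ht2, dist_eq_norm, Real.norm_eq_abs] at h
  rw [← norm_sq_truncOp_sub hK h3 hg (le_max_right N R) ht, abs_of_nonneg (sq_nonneg _)] at h
  rw [dist_eq_norm]
  exact lt_of_pow_lt_pow_left₀ 2 hε.le h

/-- The contraction bound allows a reduction to functions of bounded support, which are dense: the
two approximation errors cost ε/4 each, and the Cauchy property of the approximant costs ε/2. -/
theorem exists_strongLimit : ∃ T : L2 →L[ℂ] L2, ∀ f,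
    Tendsto (fun t => truncOp hK h3 t f) atTop (𝓝 (T f)) := by
  have h : ∀ f, ∃ y, Tendsto (fun t => truncOp hK h3 t f) atTop (𝓝 y) := fun f => by
    refine cauchySeq_tendsto_of_complete ?_
    rw [Metric.cauchySeq_iff']
    intro ε hε
    obtain ⟨g, ⟨R, _, hR⟩, hfg⟩ := exists_compactSupport_near f (ε := ε / 4) (by positivity)
    have hg : ∀ᵐ x, R ≤ x → g x = 0 := by
      filter_upwards [hR] with x hx h using hx (h.trans (le_abs_self x))
    obtain ⟨N, hN⟩ := Metric.cauchySeq_iff'.1 (cauchySeq_truncOp_of_support hK h3 h5 hg) (ε / 2)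
      (by positivity)
    refine ⟨N, fun t ht => ?_⟩
    have h1 := hN t ht
    have h2 := norm_truncOp_apply_le hK h3 h5 t (f - g)
    have h4 := norm_truncOp_apply_le hK h3 h5 N (f - g)
    rw [dist_eq_norm] at h1 ⊢
    have e : truncOp hK h3 t f - truncOp hK h3 N f = truncOp hK h3 t (f - g) -
      truncOp hK h3 N (f - g) + (truncOp hK h3 t g - truncOp hK h3 N g) := by
      simp only [map_sub]; abel
    rw [e]
    refine (norm_add_le _ _).trans_lt ?_
    have := norm_sub_le (truncOp hK h3 t (f - g)) (truncOp hK h3 N (f - g))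
    linarith
  choose y hy using h
  exact ⟨continuousLinearMapOfTendsto (truncOp hK h3) (tendsto_pi_nhds.2 hy), hy⟩

omit h5

variable {T : L2 →L[ℂ] L2}
  (hT : ∀ f, Tendsto (fun t => truncOp hK h3 t f) atTop (𝓝 (T f)))
include hT

theorem isHankelLimit : IsHankelLimit K T := by
  intro f
  have h := (tendsto_iff_edist_tendsto_0.1 (hT f))
  refine h.congr fun t => ?_
  rw [Lp.edist_def]
  refine eLpNorm_congr_ae ?_
  filter_upwards [truncOp_apply hK h3 t f] with x hx
  rw [Pi.sub_apply, hx]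

theorem strongLimit_isSymmetric : T.IsSymmetric := by
  intro f g
  refine tendsto_nhds_unique (f := fun t => inner ℂ (truncOp hK h3 t f) g) (l := atTop)
    ((hT f).inner tendsto_const_nhds) ?_
  have := (tendsto_const_nhds (x := f)).inner (𝕜 := ℂ) (hT g)
  exact this.congr fun t => (truncOp_isSymmetric hK h3 t f g).symm

theorem norm_strongLimit_le (h5 : CondK5 K) (f : L2) : ‖T f‖ ≤ ‖f‖ :=
  le_of_tendsto (hT f).norm (Eventually.of_forall fun t => norm_truncOp_apply_le hK h3 h5 t f)

/-- Convergence in L² gives convergence almost everywhere along a subsequence, while absolute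
convergence of the Hankel integral identifies the pointwise limit. -/
theorem strongLimit_apply {f : L2} (hf : ∀ x, Integrable fun y => (K (x + y) : ℂ) * f y) :
    T f =ᵐ[volume] hankel K f := by
  have h1 : Tendsto (fun n : ℕ => truncOp hK h3 n f) atTop (𝓝 (T f)) :=
    (hT f).comp tendsto_natCast_atTop_atTop
  have h2 := tendstoInMeasure_of_tendsto_Lp h1
  obtain ⟨ns, hns, hae⟩ := h2.exists_seq_tendsto_ae
  have h6 : ∀ᵐ x, ∀ n : ℕ, truncOp hK h3 n f x = truncHankel K n f x :=
    ae_all_iff.2 fun n => truncOp_apply hK h3 n f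
  filter_upwards [hae, h6] with x h4 h6
  refine tendsto_nhds_unique h4 ?_
  have h7 : Tendsto (fun n : ℕ => truncHankel K n f x) atTop (𝓝 (hankel K f x)) := by
    have h8 : Tendsto (fun n : ℕ => ∫ y in Iio (n : ℝ), (K (x + y) : ℂ) * f y) atTop
        (𝓝 (∫ y in ⋃ n : ℕ, Iio (n : ℝ), (K (x + y) : ℂ) * f y)) :=
      tendsto_setIntegral_of_monotone (fun n => measurableSet_Iio)
        (fun m n hmn => Iio_subset_Iio (by exact_mod_cast hmn)) (hf x).integrableOn
    have hU : (⋃ n : ℕ, Iio (n : ℝ)) = univ := iUnion_Iio_eq_univ_iff.2 (by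
      intro ⟨b, hb⟩
      obtain ⟨n, hn⟩ := exists_nat_gt b
      exact absurd (hb ⟨n, rfl⟩) (by simpa using hn))
    rw [hU, Measure.restrict_univ] at h8
    refine h8.congr' ?_
    obtain ⟨n, hn⟩ := exists_nat_gt x
    filter_upwards [eventually_ge_atTop n] with m hm
    rw [truncHankel, indicator_of_mem]
    exact mem_Iio.2 (hn.trans_le (by exact_mod_cast hm))
  exact (h7.comp hns.tendsto_atTop).congr fun n => (h6 _).symm

end limit

/-! ### Countable exceptional sets in the plane -/

theorem countable_of_isDiscrete {X : Type*} [TopologicalSpace X] [SecondCountableTopology X]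
    {s : Set X} (hs : IsDiscrete s) : s.Countable := by
  have := isDiscrete_iff_discreteTopology.1 hs
  exact Set.countable_coe_iff.1 (countable_of_Lindelof_of_discrete (X := s))

theorem isPreconnected_compl_of_countable {Z : Set ℂ} (hZ : Z.Countable) : IsPreconnected Zᶜ :=
  (hZ.isConnected_compl_of_one_lt_rank (by simp)).isPreconnected

/-- The map x + iy ↦ x + i exp(y) carries the plane injectively onto the half-plane, which reduces
the claim to the complement of a countable set in the plane. -/
theorem isPreconnected_upperHalf_diff {Z : Set ℂ} (hZ : Z.Countable) :
    IsPreconnected (upperHalf \ Z) := by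
  let g : ℂ → ℂ := fun w => (w.re : ℂ) + (Real.exp w.im : ℂ) * Complex.I
  have hg : Continuous g := by fun_prop
  have hinj : Function.Injective g := fun a b h => by
    have h1 := congrArg Complex.re h
    have h2 := congrArg Complex.im h
    simp only [g, Complex.add_re, Complex.ofReal_re, Complex.mul_re, Complex.I_re, mul_zero,
      Complex.ofReal_im, Complex.I_im, mul_one, sub_zero, add_zero, Complex.add_im,
      Complex.mul_im, zero_add] at h1 h2
    exact Complex.ext h1 (Real.exp_injective (by simpa using h2))
  have himg : g '' (g ⁻¹' Z)ᶜ = upperHalf \ Z := by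
    ext z
    constructor
    · rintro ⟨w, hw, rfl⟩
      refine ⟨?_, hw⟩
      have : (g w).im = Real.exp w.im := by
        simp only [g, Complex.add_im, Complex.ofReal_im, Complex.mul_im, Complex.ofReal_re,
          Complex.I_im, Complex.I_re, mul_one, mul_zero, add_zero, zero_add]
      change 0 < (g w).im
      rw [this]
      exact Real.exp_pos w.im
    · rintro ⟨hz, hzZ⟩
      have hz' : g (z.re + Real.log z.im * Complex.I) = z := by
        apply Complex.ext
        · simp [g]
        · simp only [g]; simp [Real.exp_log hz]
      exact ⟨z.re + Real.log z.im * Complex.I, by simpa [hz'] using hzZ, hz'⟩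
  rw [← himg]
  exact (isPreconnected_compl_of_countable (hZ.preimage_of_injOn hinj.injOn)).image _
    hg.continuousOn

theorem isOpen_upperHalf : IsOpen upperHalf := isOpen_lt continuous_const Complex.continuous_im

theorem isPreconnected_upperHalf : IsPreconnected upperHalf := by
  simpa using isPreconnected_upperHalf_diff countable_empty

/-- Analytic functions on the upper half-plane that agree for large imaginary part are equal. -/
theorem eqOn_upperHalf {F G : ℂ → ℂ} (hF : DifferentiableOn ℂ F upperHalf)
    (hG : DifferentiableOn ℂ G upperHalf) {c : ℝ} (h : ∀ z : ℂ, c < z.im → F z = G z) :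
    EqOn F G upperHalf := by
  have hz0 : (((|c| + 1 : ℝ) : ℂ) * Complex.I) ∈ upperHalf := by
    simp only [upperHalf, mem_ofPred_eq, Complex.mul_im, Complex.ofReal_re, Complex.I_im, mul_one,
      Complex.ofReal_im, Complex.I_re, mul_zero, add_zero]
    positivity
  refine (hF.analyticOnNhd isOpen_upperHalf).eqOn_of_preconnected_of_eventuallyEq
    (hG.analyticOnNhd isOpen_upperHalf) isPreconnected_upperHalf hz0 ?_
  have : IsOpen {z : ℂ | c < z.im} := isOpen_lt continuous_const Complex.continuous_im
  filter_upwards [this.mem_nhds (show c < (((|c| + 1 : ℝ) : ℂ) * Complex.I).im by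
    simp; linarith [le_abs_self c])] with z hz using h z hz

/-! ### Fourier integrals of functions supported in half-lines -/

theorem memLp_indicator_exp {b : ℝ} (hb : 0 < b) (s : ℝ) :
    MemLp ((Ici s).indicator fun x => Real.exp (-(x * b))) 2 volume := by
  have hm : AEStronglyMeasurable ((Ici s).indicator fun x => Real.exp (-(x * b))) volume :=
    (by fun_prop : Continuous fun x : ℝ => Real.exp (-(x * b))).aestronglyMeasurable.indicator
      measurableSet_Ici
  rw [memLp_two_iff_integrable_sq hm]
  have : (fun x => ((Ici s).indicator (fun x => Real.exp (-(x * b))) x) ^ 2) =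
      (Ici s).indicator fun x => Real.exp ((-(2 * b)) * x) := by
    ext x
    by_cases hx : x ∈ Ici s
    · rw [indicator_of_mem hx, indicator_of_mem hx, ← Real.exp_nat_mul]
      congr 1; push_cast; ring
    · rw [indicator_of_notMem hx, indicator_of_notMem hx]; simp
  rw [this, integrable_indicator_iff measurableSet_Ici, integrableOn_Ici_iff_integrableOn_Ioi]
  exact integrableOn_exp_mul_Ioi (by linarith) s

theorem integrable_norm_mul_exp {f : ℝ → ℂ} (hf : MemLp f 2 volume) {s : ℝ}
    (hs : ∀ᵐ x, x < s → f x = 0) {v : ℝ} (hv : 0 < v) :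
    Integrable fun x => ‖f x‖ * Real.exp (-(x * v)) := by
  have := hf.norm.integrable_mul (memLp_indicator_exp hv s)
  refine this.congr ?_
  filter_upwards [hs] with x hx
  by_cases h : x ∈ Ici s
  · rw [Pi.mul_apply, indicator_of_mem h]
  · rw [Pi.mul_apply, hx (by simpa using h)]; simp

theorem integrable_norm_mul_exp_neg {f : ℝ → ℂ} (hf : MemLp f 2 volume) {s : ℝ}
    (hs : ∀ᵐ x, s ≤ x → f x = 0) {v : ℝ} (hv : v < 0) :
    Integrable fun x => ‖f x‖ * Real.exp (-(x * v)) := by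
  have hf' : MemLp (fun x => f (-x)) 2 volume :=
    hf.comp_measurePreserving (Measure.measurePreserving_neg volume)
  have hs' : ∀ᵐ x : ℝ, x < -s → f (-x) = 0 := by
    have := (Measure.measurePreserving_neg (volume : Measure ℝ)).quasiMeasurePreserving.ae hs
    filter_upwards [this] with x hx h using hx (by linarith)
  have := (integrable_norm_mul_exp hf' hs' (neg_pos.2 hv)).comp_neg
  simpa using this

theorem differentiableOn_fourier {f : ℝ → ℂ} (hf : MemLp f 2 volume) {s : ℝ}
    (hs : ∀ᵐ x, x < s → f x = 0) : DifferentiableOn ℂ (fourier f) upperHalf := fun z hz =>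
  (differentiableAt_fourier hf.1 (a := 0) (b := z.im + 1)
    (fun v hv _ => integrable_norm_mul_exp hf hs hv) hz (by linarith)).differentiableWithinAt

theorem differentiableAt_fourier_neg {f : ℝ → ℂ} (hf : MemLp f 2 volume) {s : ℝ}
    (hs : ∀ᵐ x, s ≤ x → f x = 0) {z : ℂ} (hz : z.im < 0) : DifferentiableAt ℂ (fourier f) z :=
  differentiableAt_fourier hf.1 (a := z.im - 1) (b := 0)
    (fun v _ hv => integrable_norm_mul_exp_neg hf hs hv) (by linarith) hz

theorem fourier_congr_ae {f g : ℝ → ℂ} (h : f =ᵐ[volume] g) : fourier f = fourier g := by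
  ext z
  refine integral_congr_ae ?_
  filter_upwards [h] with x hx
  rw [hx]

/-! ### The Fourier integral of the kernel -/

/-- The growth condition leaves out a compact set, where K is bounded; since exp(cx) ≥ 1 for x ≥ 0,
that bound is absorbed in the constant. -/
theorem exists_growth {E : ℂ → ℂ} {c : ℝ} {K : ℝ → ℝ} (h2 : CondK2 E c K) (h3 : CondK3 K)
    (hc : 0 < c) : ∃ C, 0 ≤ C ∧ ∀ x, |K x| ≤ C * (Ici 0).indicator (fun x => Real.exp (c * x)) x := by
  obtain ⟨C, hC⟩ := h2.growth.bound
  obtain ⟨s, hs, hsC⟩ := Filter.mem_cocompact.1 hC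
  obtain ⟨M, hM⟩ := hs.exists_bound_of_continuousOn h2.cont.continuousOn
  refine ⟨max C 0 + max M 0, by positivity, fun x => ?_⟩
  rcases lt_or_ge x 0 with hx | hx
  · rw [h3 x hx, indicator_of_notMem (by simpa using hx)]; simp
  · rw [indicator_of_mem (mem_Ici.2 hx)]
    have h1 : 1 ≤ Real.exp (c * x) := Real.one_le_exp (by positivity)
    by_cases hxs : x ∈ s
    · calc |K x| ≤ M := hM x hxs
        _ ≤ max M 0 * 1 := by simp
        _ ≤ (max C 0 + max M 0) * Real.exp (c * x) := by gcongr; simp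
    · have := hsC hxs
      simp only [mem_ofPred_eq, Real.norm_eq_abs, abs_of_nonneg hx, Real.abs_exp] at this
      calc |K x| ≤ C * Real.exp (c * x) := this
        _ ≤ (max C 0 + max M 0) * Real.exp (c * x) := by
          gcongr
          exact (le_max_left C 0).trans (le_add_of_nonneg_right (le_max_right M 0))

theorem integrable_indicator_exp_mul {a v : ℝ} (hv : a < v) (s : ℝ) :
    Integrable fun x => (Ici s).indicator (fun x => Real.exp (a * x)) x * Real.exp (-(x * v)) := by
  have : (fun x => (Ici s).indicator (fun x => Real.exp (a * x)) x * Real.exp (-(x * v))) =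
      (Ici s).indicator fun x => Real.exp ((a - v) * x) := by
    ext x
    by_cases hx : x ∈ Ici s
    · rw [indicator_of_mem hx, indicator_of_mem hx, ← Real.exp_add]; congr 1; ring
    · rw [indicator_of_notMem hx, indicator_of_notMem hx, zero_mul]
  rw [this, integrable_indicator_iff measurableSet_Ici, integrableOn_Ici_iff_integrableOn_Ioi]
  exact integrableOn_exp_mul_Ioi (by linarith) s

section kernel

variable {c : ℝ} {K : ℝ → ℝ} (hK : Continuous K) {C : ℝ}
  (hC : ∀ x, |K x| ≤ C * (Ici 0).indicator (fun x => Real.exp (c * x)) x)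
include hK hC

theorem integrable_kernel_mul_exp {v : ℝ} (hv : c < v) :
    Integrable fun x => |K x| * Real.exp (-(x * v)) := by
  refine ((integrable_indicator_exp_mul hv 0).const_mul C).mono'
    (hK.abs.mul (by fun_prop)).aestronglyMeasurable (Eventually.of_forall fun x => ?_)
  rw [Real.norm_of_nonneg (by positivity), ← mul_assoc]
  exact mul_le_mul_of_nonneg_right (hC x) (Real.exp_nonneg _)

theorem integrable_kernel_mul_cexp {z : ℂ} (hz : c < z.im) :
    Integrable fun x : ℝ => (K x : ℂ) * Complex.exp (Complex.I * x * z) := by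
  refine (integrable_mul_cexp_iff (f := fun x => (K x : ℂ))
    (Complex.continuous_ofReal.comp hK).aestronglyMeasurable z).2 ?_
  simpa using integrable_kernel_mul_exp hK hC hz

/-- The Hankel integral becomes a product under the Fourier integral. -/
theorem fourier_hankel {h : ℝ → ℂ} {z : ℂ} (hz : c < z.im)
    (hh : Integrable fun y : ℝ => h y * Complex.exp (Complex.I * y * (-z))) :
    (Integrable fun x : ℝ => hankel K h x * Complex.exp (Complex.I * x * z)) ∧
    fourier (hankel K h) z = fourier (fun x => (K x : ℂ)) z * fourier h (-z) := by
  -- After reflecting h, the Hankel integral is a convolution; multiplicativity of the exponential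
  -- lets both factors carry the weight exp(iuz), which makes them integrable.
  let m : ℝ → ℂ := fun u => h (-u) * Complex.exp (Complex.I * u * z)
  let k : ℝ → ℂ := fun u => (K u : ℂ) * Complex.exp (Complex.I * u * z)
  have hm : Integrable m := by
    refine hh.comp_neg.congr (Eventually.of_forall fun u => ?_)
    simp [m]
  have hk : Integrable k := integrable_kernel_mul_cexp hK hC hz
  have e : ∀ x, (m ⋆[ContinuousLinearMap.mul ℂ ℂ, volume] k) x =
      hankel K h x * Complex.exp (Complex.I * x * z) := fun x => by
    rw [convolution_def, hankel, ← integral_mul_const,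
      ← integral_neg_eq_self (fun y => (K (x + y) : ℂ) * h y * Complex.exp (Complex.I * x * z))]
    refine integral_congr_ae (Eventually.of_forall fun y => ?_)
    simp only [m, k, ContinuousLinearMap.mul_apply']
    have : Complex.exp (Complex.I * x * z) =
        Complex.exp (Complex.I * y * z) * Complex.exp (Complex.I * (x - y : ℝ) * z) := by
      rw [← Complex.exp_add]; congr 1; push_cast; ring
    rw [this, sub_eq_add_neg]; ring
  refine ⟨(hm.integrable_convolution (ContinuousLinearMap.mul ℂ ℂ) hk).congr
    (Eventually.of_forall e), ?_⟩
  have h1 := integral_convolution (ContinuousLinearMap.mul ℂ ℂ) hm hk (μ := volume) (ν := volume)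
  rw [integral_congr_ae (Eventually.of_forall e)] at h1
  rw [fourier, h1, ContinuousLinearMap.mul_apply', mul_comm]
  congr 1
  rw [fourier, ← integral_neg_eq_self]
  refine integral_congr_ae (Eventually.of_forall fun y => ?_)
  simp [m]

end kernel

/-! ### The symbol of the Hankel operator -/

/-- `Θ` is the analytic symbol on the upper half-plane of the Hankel operator `T` with kernel `K`,
and `T` is a selfadjoint unitary operator. -/
structure HankelSystem (K : ℝ → ℝ) (c : ℝ) (T : L2 →L[ℂ] L2) (Θ : ℂ → ℂ) : Prop where
  c_pos : 0 < c
  cont : Continuous K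
  causal : CondK3 K
  growth : ∃ C, 0 ≤ C ∧ ∀ x, |K x| ≤ C * (Ici 0).indicator (fun x => Real.exp (c * x)) x
  apply : ∀ f : L2, (∀ x, Integrable fun y => (K (x + y) : ℂ) * f y) → T f =ᵐ[volume] hankel K f
  symm : T.IsSymmetric
  invol : ∀ f, T (T f) = f
  symbol_diff : DifferentiableOn ℂ Θ upperHalf
  symbol_eq : ∀ z : ℂ, c < z.im → Θ z = fourier (fun x => (K x : ℂ)) z
  fourier_apply : ∀ (f : L2) (s : ℝ), (∀ᵐ x, s ≤ x → f x = 0) → ∀ z ∈ upperHalf,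
    fourier (T f) z = Θ z * fourier f (-z)
  symbol_boundary : ∀ᵐ x : ℝ, ∃ w : ℂ, ‖w‖ = 1 ∧
    Tendsto (fun y : ℝ => Θ (x + y * Complex.I)) (𝓝[>] 0) (𝓝 w)

theorem integrable_kernel_mul {K : ℝ → ℝ} (hK : Continuous K) (h3 : CondK3 K) {f : L2} {s : ℝ}
    (hs : ∀ᵐ x, s ≤ x → f x = 0) (x : ℝ) : Integrable fun y => (K (x + y) : ℂ) * f y := by
  obtain ⟨M, hM0, hM⟩ := exists_bound_on_Icc hK (|x + s|)
  have h1 : Integrable ((Icc (-x) s).indicator fun y => f y) :=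
    (integrableOn_L2 f (by simp)).integrable_indicator measurableSet_Icc
  refine (h1.norm.const_mul M).mono' ?_ ?_
  · exact (Complex.continuous_ofReal.comp (hK.comp (by fun_prop :
      Continuous fun y => x + y))).aestronglyMeasurable.mul (Lp.memLp f).1
  · filter_upwards [hs] with y hy
    by_cases h : y ∈ Icc (-x) s
    · rw [indicator_of_mem h, norm_mul, Complex.norm_real]
      refine mul_le_mul_of_nonneg_right (hM _ ?_) (norm_nonneg _)
      have h1 := h.1
      have h2 := h.2
      rw [abs_of_nonneg (by linarith)]
      exact le_trans (by linarith) (le_abs_self _)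
    · rw [indicator_of_notMem h, norm_zero, mul_zero]
      have : (K (x + y) : ℂ) * f y = 0 := by
        rcases le_or_gt s y with h1 | h1
        · rw [hy h1, mul_zero]
        · have : K (x + y) = 0 := h3 _ (by
            by_contra! h2
            exact h ⟨by linarith, h1.le⟩)
          rw [this, Complex.ofReal_zero, zero_mul]
      rw [this, norm_zero]

theorem hankel_eq_zero {K : ℝ → ℝ} (h3 : CondK3 K) {f : ℝ → ℂ} {s : ℝ}
    (hs : ∀ᵐ x, s ≤ x → f x = 0) {x : ℝ} (hx : x < -s) : hankel K f x = 0 := by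
  refine integral_eq_zero_of_ae ?_
  filter_upwards [hs] with y hy
  rcases le_or_gt s y with h | h
  · rw [hy h, mul_zero]; rfl
  · rw [h3 _ (by linarith)]; simp

section symbol

variable {K : ℝ → ℝ} (hK : Continuous K) (h3 : CondK3 K) {c C : ℝ} (hc : 0 < c)
  (hC : ∀ x, |K x| ≤ C * (Ici 0).indicator (fun x => Real.exp (c * x)) x)
  {T : L2 →L[ℂ] L2} (hT : ∀ f, Tendsto (fun t => truncOp hK h3 t f) atTop (𝓝 (T f)))

include hT

theorem strongLimit_support {f : L2} {s : ℝ} (hs : ∀ᵐ x, s ≤ x → f x = 0) :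
    ∀ᵐ x, x < -s → T f x = 0 := by
  filter_upwards [strongLimit_apply hK h3 hT (integrable_kernel_mul hK h3 hs)] with x hx h
  rw [hx, hankel_eq_zero h3 hs h]

include hc hC

theorem fourier_strongLimit_of_lt {f : L2} {s : ℝ} (hs : ∀ᵐ x, s ≤ x → f x = 0) {z : ℂ}
    (hz : c < z.im) :
    fourier (T f) z = fourier (fun x => (K x : ℂ)) z * fourier f (-z) := by
  rw [fourier_congr_ae (strongLimit_apply hK h3 hT (integrable_kernel_mul hK h3 hs))]
  refine (fourier_hankel hK hC hz ?_).2
  rw [integrable_mul_cexp_iff (Lp.memLp f).1]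
  exact integrable_norm_mul_exp_neg (Lp.memLp f) hs (by simp; linarith)

/-- For one f with an explicit transform, F(Tf) is analytic on the whole half-plane because Tf is an
L² function on a right half-line. Dividing by F f(-z) continues the symbol, and the multiplication
formula for other f follows by uniqueness of continuation. -/
theorem exists_symbol : ∃ Θ : ℂ → ℂ, DifferentiableOn ℂ Θ upperHalf ∧
    (∀ z : ℂ, c < z.im → Θ z = fourier (fun x => (K x : ℂ)) z) ∧
    ∀ (f : L2) (s : ℝ), (∀ᵐ x, s ≤ x → f x = 0) → ∀ z ∈ upperHalf,
      fourier (T f) z = Θ z * fourier f (-z) := by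
  -- The test function exp(y) on y < 0 satisfies F g(-z) = 1/(1 - iz), so dividing by it introduces
  -- no poles.
  let g : ℝ → ℂ := fun y => (Iio (0 : ℝ)).indicator (fun y : ℝ => Complex.exp y) y
  have hgm : MemLp g 2 volume := by
    have h := (memLp_indicator_exp one_pos 0).comp_measurePreserving
      (Measure.measurePreserving_neg (volume : Measure ℝ))
    refine h.of_le ((by fun_prop : Continuous fun y : ℝ =>
      Complex.exp y).aestronglyMeasurable.indicator measurableSet_Iio)
      (Eventually.of_forall fun y => ?_)
    by_cases hy : y < 0
    · have : -y ∈ Ici (0 : ℝ) := by simp; linarith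
      simp only [g, Function.comp, indicator_of_mem (mem_Iio.2 hy), indicator_of_mem this]
      rw [Complex.norm_exp]; simp
    · simp only [g]
      rw [indicator_of_notMem (by simpa using hy), norm_zero]; positivity
  let ε : L2 := hgm.toLp g
  have hε : ε =ᵐ[volume] g := hgm.coeFn_toLp
  have hs : ∀ᵐ x, (0 : ℝ) ≤ x → ε x = 0 := by
    filter_upwards [hε] with x hx h
    rw [hx]
    exact indicator_of_notMem (by simpa using h) _
  have hfε : ∀ z ∈ upperHalf, (1 - Complex.I * z) * fourier ε (-z) = 1 := fun z hz => by
    have hz' : 0 < z.im := hz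
    have hre : 0 < (1 - Complex.I * z).re := by simp; linarith
    rw [fourier_congr_ae hε, fourier]
    have e : ∀ y : ℝ, g y * Complex.exp (Complex.I * y * (-z)) =
        (Iio (0 : ℝ)).indicator (fun y : ℝ => Complex.exp ((1 - Complex.I * z) * y)) y := by
      intro y
      by_cases hy : y < 0
      · simp only [g, indicator_of_mem (mem_Iio.2 hy)]
        rw [← Complex.exp_add]; congr 1; ring
      · simp only [g, indicator_of_notMem (s := Iio (0 : ℝ)) (a := y) (by simpa using hy), zero_mul]
    simp only [e]
    rw [integral_indicator measurableSet_Iio, ← integral_Iic_eq_integral_Iio,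
      integral_exp_mul_complex_Iic hre]
    have : (1 - Complex.I * z) ≠ 0 := fun h => by rw [h] at hre; simp at hre
    simp [this]
  have hdT : ∀ f : L2, ∀ s : ℝ, (∀ᵐ x, s ≤ x → f x = 0) →
      DifferentiableOn ℂ (fourier (T f)) upperHalf := fun f s hf =>
    differentiableOn_fourier (Lp.memLp _) (strongLimit_support hK h3 hT hf)
  let Θ : ℂ → ℂ := fun z => (1 - Complex.I * z) * fourier (T ε) z
  have hΘd : DifferentiableOn ℂ Θ upperHalf :=
    DifferentiableOn.mul (by fun_prop) (hdT ε 0 hs)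
  have hΘ : ∀ z : ℂ, c < z.im → Θ z = fourier (fun x => (K x : ℂ)) z := fun z hz => by
    simp only [Θ]
    rw [fourier_strongLimit_of_lt hK h3 hc hC hT hs hz, mul_left_comm, hfε z (hc.trans hz), mul_one]
  refine ⟨Θ, hΘd, hΘ, fun f s hf z hz => ?_⟩
  refine eqOn_upperHalf (G := fun z => Θ z * fourier f (-z)) (hdT f s hf)
    (hΘd.mul ?_) (c := c) (fun z hz => ?_) hz
  · intro w hw
    have hw' : 0 < w.im := hw
    exact (((differentiableAt_fourier_neg (Lp.memLp f) hf (z := -w) (by simpa using hw')).comp w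
      differentiableAt_id.neg)).differentiableWithinAt
  · rw [fourier_strongLimit_of_lt hK h3 hc hC hT hf hz, hΘ z hz]

end symbol

/-! ### The functional equation in the upper half-plane -/

section E

variable {E : ℂ → ℂ} {c : ℝ} {Z : Set ℂ} {K : ℝ → ℝ} {Θ : ℂ → ℂ}
  (hE : ∃ z, z ∉ Z ∧ E z ≠ 0) (h1 : CondK1 E c Z)
include h1

theorem CondK1.countable : Z.Countable := countable_of_isDiscrete h1.discrete

theorem CondK1.conj_notMem {z : ℂ} (hz : z ∉ Z) : (starRingEnd ℂ) z ∉ Z := fun h =>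
  hz (by simpa using h1.conj_mem _ h)

theorem CondK1.analytic_sharp : AnalyticOnNhd ℂ (sharp E) Zᶜ := fun z hz => by
  have hc := (h1.analytic _ (h1.conj_notMem hz))
  rw [Complex.analyticAt_iff_eventually_differentiableAt] at hc ⊢
  have hcont : Tendsto (starRingEnd ℂ) (𝓝 z) (𝓝 ((starRingEnd ℂ) z)) :=
    Complex.continuous_conj.continuousAt
  filter_upwards [hcont.eventually hc] with w hw
  have := hw.conj_conj
  rw [Complex.conj_conj] at this
  exact this

include hE

theorem CondK1.eventually_ne_zero {z : ℂ} (hz : z ∉ Z) : ∀ᶠ w in 𝓝[≠] z, E w ≠ 0 := by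
  by_contra h
  have : ∃ᶠ w in 𝓝[≠] z, E w = 0 := (not_eventually.1 h).mono fun w hw => not_not.1 hw
  have h0 := h1.analytic.eqOn_zero_of_preconnected_of_frequently_eq_zero
    (isPreconnected_compl_of_countable h1.countable) hz this
  obtain ⟨w, hw, hne⟩ := hE
  exact hne (h0 hw)

theorem CondK1.countable_zeros : {z | z ∉ Z ∧ E z = 0}.Countable := by
  refine countable_of_isDiscrete (IsDiscrete.of_nhdsWithin fun z hz => ?_)
  have h := h1.eventually_ne_zero hE hz.1
  rw [eventually_nhdsWithin_iff] at h
  rw [Filter.le_pure_iff, mem_nhdsWithin_iff_eventually]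
  filter_upwards [h] with w hw hw2
  by_contra hne
  exact hw hne hw2.2

variable (h2 : CondK2 E c K) (hΘd : DifferentiableOn ℂ Θ upperHalf)
  (hΘ : ∀ z : ℂ, c < z.im → Θ z = fourier (fun x => (K x : ℂ)) z)
include h2 hΘd hΘ

theorem sharp_eq_symbol_mul {z : ℂ} (hz : z ∈ upperHalf) (hzZ : z ∉ Z) :
    sharp E z = Θ z * E z := by
  have hc := h1.c_pos
  have hA : AnalyticOnNhd ℂ (fun z => sharp E z - Θ z * E z) (upperHalf \ Z) := fun w hw =>
    (h1.analytic_sharp w hw.2).sub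
      ((hΘd.analyticOnNhd isOpen_upperHalf w hw.1).mul (h1.analytic w hw.2))
  -- A base point above the strip that contains Z, where Θ is still given by the Fourier integral;
  -- the identity theorem on the connected set `upperHalf \ Z` does the rest.
  let z0 : ℂ := ((c + 1 : ℝ) : ℂ) * Complex.I
  have hz0 : z0.im = c + 1 := by simp [z0]
  have hz0Z : z0 ∉ Z := fun h => by linarith [(h1.strip _ h).2]
  have hfr : ∃ᶠ w in 𝓝[≠] z0, sharp E w - Θ w * E w = 0 := by
    refine Eventually.frequently ?_
    have ho : ∀ᶠ w in 𝓝[≠] z0, c < w.im := nhdsWithin_le_nhds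
      ((isOpen_lt continuous_const Complex.continuous_im).mem_nhds (by
        change c < z0.im; linarith))
    filter_upwards [h1.eventually_ne_zero hE hz0Z, ho] with w hw hcw
    rw [hΘ w hcw, ← h2.fourier_eq w hcw hw, div_mul_cancel₀ _ hw, sub_self]
  have hz0u : z0 ∈ upperHalf \ Z := ⟨by change 0 < z0.im; linarith, hz0Z⟩
  exact sub_eq_zero.1 (hA.eqOn_zero_of_preconnected_of_frequently_eq_zero
    (isPreconnected_upperHalf_diff h1.countable) hz0u hfr ⟨hz, hzZ⟩)

/-- Outside a countable set a real x is neither in Z nor a zero of E. There E^♯/E is continuous, and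
its value at x is conj(E x)/E x, of modulus one. -/
theorem symbol_boundary : ∀ᵐ x : ℝ, ∃ w : ℂ, ‖w‖ = 1 ∧
    Tendsto (fun y : ℝ => Θ (x + y * Complex.I)) (𝓝[>] 0) (𝓝 w) := by
  have hinj : Function.Injective (fun x : ℝ => (x : ℂ)) := Complex.ofReal_injective
  have hcount : ((fun x : ℝ => (x : ℂ)) ⁻¹' (Z ∪ {z | z ∉ Z ∧ E z = 0})).Countable :=
    (h1.countable.union (h1.countable_zeros hE)).preimage_of_injOn hinj.injOn
  filter_upwards [hcount.ae_notMem volume] with x hx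
  simp only [mem_preimage, mem_union, mem_ofPred_eq, not_or, not_and] at hx
  obtain ⟨hxZ, hx0⟩ := hx
  have hne : E x ≠ 0 := hx0 hxZ
  have hA := (h1.analytic _ hxZ)
  have hS := (h1.analytic_sharp _ hxZ)
  refine ⟨sharp E x / E x, ?_, ?_⟩
  · simp [sharp, hne]
  · have hmap : Tendsto (fun y : ℝ => (x : ℂ) + y * Complex.I) (𝓝[>] 0) (𝓝 (x : ℂ)) := by
      have : ContinuousAt (fun y : ℝ => (x : ℂ) + y * Complex.I) 0 := by fun_prop
      simpa [ContinuousAt] using this.tendsto.mono_left nhdsWithin_le_nhds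
    have hlim : Tendsto (fun z => sharp E z / E z) (𝓝 (x : ℂ)) (𝓝 (sharp E x / E x)) :=
      (hS.continuousAt.div hA.continuousAt hne)
    refine (hlim.comp hmap).congr' ?_
    have hev := (hA.eventually_analyticAt.and hS.eventually_analyticAt).and
      (hA.continuousAt.eventually_ne hne)
    filter_upwards [hmap.eventually hev, self_mem_nhdsWithin] with y hy hy0
    obtain ⟨⟨hy1, hy2⟩, hy3⟩ := hy
    set z : ℂ := x + y * Complex.I with hzdef
    have hzu : z ∈ upperHalf := by
      change 0 < z.im; simp [hzdef]; exact hy0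
    have hd : Dense Zᶜ := h1.countable.dense_compl ℝ
    -- The point z may still belong to Z although E happens to be analytic there; the identity is
    -- reached by continuity from the dense complement of Z.
    have : sharp E z = Θ z * E z := by
      by_contra hne'
      have hcont : ContinuousAt (fun w => sharp E w - Θ w * E w) z :=
        hy2.continuousAt.sub (((hΘd.differentiableAt
          (isOpen_upperHalf.mem_nhds hzu)).continuousAt).mul hy1.continuousAt)
      have h3 := (hcont.eventually_ne (sub_ne_zero.2 hne')).and (isOpen_upperHalf.mem_nhds hzu)
      obtain ⟨w, hwZ, hw1, hw2⟩ := ((mem_closure_iff_frequently.1 (hd z)).and_eventually h3).exists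
      exact hw1 (sub_eq_zero.2 (sharp_eq_symbol_mul hE h1 h2 hΘd hΘ hw2 hwZ))
    simp only [Function.comp]
    rw [this, mul_div_cancel_right₀ _ hy3]

end E

/-! ### The Hankel operator is unitary -/

theorem fourier_mul_exp (f : ℝ → ℂ) (y u : ℝ) :
    fourier (fun x => f x * (Real.exp (-(x * y)) : ℂ)) u = fourier f (u + y * Complex.I) := by
  refine integral_congr_ae (Eventually.of_forall fun x => ?_)
  simp only
  rw [mul_assoc, Complex.ofReal_exp, ← Complex.exp_add]
  congr 2
  push_cast
  linear_combination (-(x : ℂ) * y) * Complex.I_sq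

theorem integrable_norm_mul_exp_of_bounded {f : L2} {R : ℝ}
    (hR : ∀ᵐ x, R ≤ |x| → f x = 0) (v : ℝ) :
    Integrable fun x => ‖f x‖ * Real.exp (-(x * v)) := by
  have h1 : Integrable ((Icc (-R) R).indicator fun y => f y) :=
    (integrableOn_L2 f (by simp)).integrable_indicator measurableSet_Icc
  refine (h1.norm.mul_const (Real.exp (R * |v|))).mono'
    ((Lp.memLp f).1.norm.mul (by fun_prop : Continuous fun x : ℝ =>
      Real.exp (-(x * v))).aestronglyMeasurable) ?_
  filter_upwards [hR] with x hx
  rw [Real.norm_of_nonneg (by positivity)]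
  by_cases h : R ≤ |x|
  · rw [hx h, norm_zero, zero_mul]; positivity
  · push Not at h
    rw [indicator_of_mem (show x ∈ Icc (-R) R from abs_le.1 h.le)]
    gcongr
    calc -(x * v) ≤ |x * v| := neg_le_abs _
      _ = |x| * |v| := abs_mul _ _
      _ ≤ R * |v| := by gcongr

theorem differentiableAt_fourier_of_bounded {f : L2} {R : ℝ}
    (hR : ∀ᵐ x, R ≤ |x| → f x = 0) (z : ℂ) : DifferentiableAt ℂ (fourier f) z :=
  differentiableAt_fourier (Lp.memLp f).1 (a := z.im - 1) (b := z.im + 1)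
    (fun v _ _ => integrable_norm_mul_exp_of_bounded hR v) (by linarith) (by linarith)

theorem lintegral_enorm_sq_eq (f : L2) : ∫⁻ x, ‖f x‖ₑ ^ 2 = ENNReal.ofReal (‖f‖ ^ 2) := by
  have h2 : ∫⁻ x, ‖f x‖ₑ ^ 2 = eLpNorm f 2 volume ^ 2 := by
    rw [eLpNorm_eq_lintegral_rpow_enorm_toReal (by norm_num) (by norm_num)]
    simp only [ENNReal.toReal_ofNat, one_div, ENNReal.rpow_ofNat]
    rw [← ENNReal.rpow_natCast, ← ENNReal.rpow_mul]; simp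
  rw [h2, ENNReal.ofReal_pow (norm_nonneg _), ofReal_norm, Lp.enorm_def]

theorem memLp_mul_exp {f : ℝ → ℂ} (hf : MemLp f 2 volume) {s : ℝ} (hs : ∀ᵐ x, x < s → f x = 0)
    {y : ℝ} (hy : 0 < y) : MemLp (fun x => f x * (Real.exp (-(x * y)) : ℂ)) 2 volume := by
  refine MemLp.of_le (hf.norm.const_mul (Real.exp (-(s * y))))
    (hf.1.mul (by fun_prop : Continuous fun x : ℝ =>
      (Real.exp (-(x * y)) : ℂ)).aestronglyMeasurable) ?_
  filter_upwards [hs] with x hx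
  rw [norm_mul, Complex.norm_real, norm_mul, norm_norm, Real.norm_of_nonneg (Real.exp_nonneg _),
    Real.norm_of_nonneg (Real.exp_nonneg _), mul_comm]
  rcases lt_or_ge x s with h | h
  · rw [hx h]; simp
  · gcongr

theorem integrable_mul_exp {f : ℝ → ℂ} (hf : MemLp f 2 volume) {s : ℝ}
    (hs : ∀ᵐ x, x < s → f x = 0) {y : ℝ} (hy : 0 < y) :
    Integrable fun x => f x * (Real.exp (-(x * y)) : ℂ) := by
  refine (integrable_norm_iff (hf.1.mul (by fun_prop : Continuous fun x : ℝ =>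
      (Real.exp (-(x * y)) : ℂ)).aestronglyMeasurable)).1 ?_
  refine (integrable_norm_mul_exp hf hs hy).congr (Eventually.of_forall fun x => ?_)
  beta_reduce
  rw [Pi.mul_apply, norm_mul, Complex.norm_real, Real.norm_of_nonneg (Real.exp_nonneg _)]

/-- Damping g by exp(-xy) corresponds to moving its transform to height y. As y → 0 the transforms
converge almost everywhere to a unimodular multiple of F f(-u), so Plancherel and Fatou give the
inequality without any a priori bound on Θ. -/
theorem norm_le_of_symbol {f g : L2} {R : ℝ} (hR : ∀ᵐ x, R ≤ |x| → f x = 0)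
    (hg : ∀ᵐ x, x < -R → g x = 0) {Θ : ℂ → ℂ}
    (h : ∀ z ∈ upperHalf, fourier g z = Θ z * fourier f (-z))
    (hΘ : ∀ᵐ x : ℝ, ∃ w : ℂ, ‖w‖ = 1 ∧
      Tendsto (fun y : ℝ => Θ (x + y * Complex.I)) (𝓝[>] 0) (𝓝 w)) : ‖f‖ ≤ ‖g‖ := by
  let y : ℕ → ℝ := fun n => 1 / ((n : ℝ) + 1)
  have hy0 : ∀ n, 0 < y n := fun n => by positivity
  have hylim : Tendsto y atTop (𝓝 0) := tendsto_one_div_add_atTop_nhds_zero_nat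
  have hylim' : Tendsto y atTop (𝓝[>] 0) :=
    tendsto_nhdsWithin_iff.2 ⟨hylim, Eventually.of_forall hy0⟩
  let G : ℕ → ℝ → ℂ := fun n x => g x * (Real.exp (-(x * y n)) : ℂ)
  have hG1 : ∀ n, Integrable (G n) := fun n => integrable_mul_exp (Lp.memLp g) hg (hy0 n)
  have hG2 : ∀ n, MemLp (G n) 2 volume := fun n => memLp_mul_exp (Lp.memLp g) hg (hy0 n)
  have hfi : Integrable f := by
    rw [← integrable_norm_iff (Lp.memLp f).1]
    simpa using integrable_norm_mul_exp_of_bounded hR 0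
  have hpt : ∀ᵐ u : ℝ, Tendsto (fun n => ‖fourier (G n) u‖ₑ ^ 2) atTop
      (𝓝 (‖fourier f ((-u : ℝ) : ℂ)‖ₑ ^ 2)) := by
    filter_upwards [hΘ] with u ⟨w, hw, hlim⟩
    have h1 : Tendsto (fun n => fourier (G n) u) atTop (𝓝 (w * fourier f ((-u : ℝ) : ℂ))) := by
      have hc : ContinuousAt (fun v : ℝ => fourier f (-((u : ℂ) + v * Complex.I))) 0 := by
        refine ContinuousAt.comp (g := fourier f) (f := fun v : ℝ => -((u : ℂ) + v * Complex.I))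
          (differentiableAt_fourier_of_bounded hR _).continuousAt ?_
        fun_prop
      have h2 := (hlim.comp hylim').mul (hc.tendsto.comp hylim)
      have e0 : -((u : ℂ) + ((0 : ℝ) : ℂ) * Complex.I) = ((-u : ℝ) : ℂ) := by push_cast; ring
      rw [e0] at h2
      refine h2.congr fun n => ?_
      simp only [G, Function.comp]
      rw [fourier_mul_exp, h _ (by change 0 < Complex.im _; simpa using hy0 n)]
    have h3 := (ENNReal.continuous_pow 2).continuousAt.tendsto.comp
      ((continuous_enorm.tendsto _).comp h1)
    rw [enorm_mul, ← ofReal_norm w, hw, ENNReal.ofReal_one, one_mul] at h3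
    exact h3
  have hcontG : ∀ n, Continuous fun u : ℝ => fourier (G n) u := fun n => by
    have : (fun u : ℝ => fourier (G n) u) = fun u : ℝ => fourier g (u + y n * Complex.I) :=
      funext fun u => fourier_mul_exp _ _ _
    rw [this, continuous_iff_continuousAt]
    intro u
    refine ContinuousAt.comp (g := fourier g) (f := fun u : ℝ => (u : ℂ) + y n * Complex.I) ?_
      (by fun_prop)
    refine ((differentiableOn_fourier (Lp.memLp g) hg).differentiableAt
      (isOpen_upperHalf.mem_nhds ?_)).continuousAt
    change 0 < Complex.im _
    simpa using hy0 n
  -- Fatou. The support condition on g costs only a factor exp(R y n)², which tends to one.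
  have hF := lintegral_liminf_le' (μ := (volume : Measure ℝ)) (u := atTop)
    (f := fun n (u : ℝ) => ‖fourier (G n) u‖ₑ ^ 2)
    fun n => (((hcontG n).measurable.enorm).pow_const 2).aemeasurable
  have hL : ∫⁻ u : ℝ, liminf (fun n => ‖fourier (G n) u‖ₑ ^ 2) atTop =
      ENNReal.ofReal (2 * Real.pi) * ENNReal.ofReal (‖f‖ ^ 2) := by
    rw [← lintegral_enorm_sq_eq, ← lintegral_fourier hfi (Lp.memLp f),
      ← lintegral_neg_eq_self (fun u : ℝ => ‖fourier f (u : ℂ)‖ₑ ^ 2)]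
    refine lintegral_congr_ae ?_
    filter_upwards [hpt] with u hu
    exact hu.liminf_eq
  have hR1 : ∀ n, ∫⁻ u : ℝ, ‖fourier (G n) u‖ₑ ^ 2 ≤ ENNReal.ofReal (2 * Real.pi) *
      (ENNReal.ofReal (Real.exp (R * y n) ^ 2) * ENNReal.ofReal (‖g‖ ^ 2)) := fun n => by
    rw [lintegral_fourier (hG1 n) (hG2 n), ← lintegral_enorm_sq_eq,
      ← lintegral_const_mul' (ENNReal.ofReal (Real.exp (R * y n) ^ 2)) _ ENNReal.ofReal_ne_top]
    refine mul_le_mul' le_rfl (lintegral_mono_ae ?_)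
    filter_upwards [hg] with x hx
    rcases lt_or_ge x (-R) with h | h
    · simp [G, hx h]
    · simp only [G]
      rw [enorm_mul, mul_pow, mul_comm, ENNReal.ofReal_pow (Real.exp_nonneg _)]
      gcongr
      rw [← ofReal_norm, Complex.norm_real, Real.norm_of_nonneg (Real.exp_nonneg _)]
      refine ENNReal.ofReal_le_ofReal (Real.exp_le_exp.2 ?_)
      nlinarith [hy0 n]
  have hR2 : Tendsto (fun n => ENNReal.ofReal (2 * Real.pi) *
      (ENNReal.ofReal (Real.exp (R * y n) ^ 2) * ENNReal.ofReal (‖g‖ ^ 2))) atTop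
      (𝓝 (ENNReal.ofReal (2 * Real.pi) * ENNReal.ofReal (‖g‖ ^ 2))) := by
    have h1 : Tendsto (fun n => Real.exp (R * y n) ^ 2) atTop (𝓝 1) := by
      have : ContinuousAt (fun v : ℝ => Real.exp (R * v) ^ 2) 0 := by fun_prop
      simpa [Function.comp_def] using this.tendsto.comp hylim
    have h2 := ENNReal.tendsto_ofReal h1
    rw [ENNReal.ofReal_one] at h2
    have h3 := ENNReal.Tendsto.mul_const (b := ENNReal.ofReal (‖g‖ ^ 2)) h2
      (Or.inr ENNReal.ofReal_ne_top)
    rw [one_mul] at h3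
    exact ENNReal.Tendsto.const_mul h3 (Or.inr ENNReal.ofReal_ne_top)
  have hfin : ENNReal.ofReal (2 * Real.pi) * ENNReal.ofReal (‖f‖ ^ 2) ≤
      ENNReal.ofReal (2 * Real.pi) * ENNReal.ofReal (‖g‖ ^ 2) := by
    rw [← hL, ← hR2.liminf_eq]
    exact hF.trans (liminf_le_liminf (Eventually.of_forall hR1))
  rw [ENNReal.mul_le_mul_iff_right (by simp [Real.pi_pos]) ENNReal.ofReal_ne_top,
    ENNReal.ofReal_le_ofReal_iff (by positivity)] at hfin
  exact le_of_sq_le_sq hfin (norm_nonneg _)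

/-- The limit is a contraction, and `norm_le_of_symbol` with density gives the reverse inequality.
An isometry preserves inner products, so symmetry yields ⟨TTf, g⟩ = ⟨Tf, Tg⟩ = ⟨f, g⟩. -/
theorem exists_hankelSystem {E : ℂ → ℂ} {c : ℝ} {Z : Set ℂ} {K : ℝ → ℝ}
    (hE : ∃ z, z ∉ Z ∧ E z ≠ 0) (h1 : CondK1 E c Z) (h2 : CondK2 E c K)
    (h3 : CondK3 K) (h5 : CondK5 K) :
    ∃ (T : L2 →L[ℂ] L2) (Θ : ℂ → ℂ), IsHankelLimit K T ∧ HankelSystem K c T Θ ∧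
      ∀ z ∈ upperHalf, z ∉ Z → sharp E z = Θ z * E z := by
  obtain ⟨C, hC0, hC⟩ := exists_growth h2 h3 h1.c_pos
  obtain ⟨T, hT⟩ := exists_strongLimit h2.cont h3 h5
  obtain ⟨Θ, hΘd, hΘ, hΘT⟩ := exists_symbol h2.cont h3 h1.c_pos hC hT
  have hb := symbol_boundary hE h1 h2 hΘd hΘ
  have hle : ∀ f, ‖T f‖ ≤ ‖f‖ := norm_strongLimit_le h2.cont h3 hT h5
  have hge : ∀ f, ‖f‖ ≤ ‖T f‖ := fun f => by
    refine le_of_forall_pos_le_add fun ε hε => ?_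
    obtain ⟨g, ⟨R, _, hR⟩, hfg⟩ := exists_compactSupport_near f (ε := ε / 2) (by positivity)
    have hg : ∀ᵐ x, R ≤ x → g x = 0 := by
      filter_upwards [hR] with x hx h using hx (h.trans (le_abs_self x))
    have h6 := norm_le_of_symbol hR (strongLimit_support h2.cont h3 hT hg) (hΘT g R hg) hb
    have h7 : ‖T g‖ ≤ ‖T f‖ + ε / 2 := by
      have : T g = T f - T (f - g) := by rw [map_sub]; abel
      rw [this]
      exact (norm_sub_le _ _).trans (add_le_add le_rfl ((hle _).trans hfg))
    have h8 : ‖f‖ ≤ ‖g‖ + ‖f - g‖ := by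
      have := norm_add_le g (f - g)
      rwa [add_sub_cancel] at this
    linarith
  have hsymm := strongLimit_isSymmetric h2.cont h3 hT
  have hiso : ∀ f g, inner ℂ (T f) (T g) = inner ℂ f g :=
    (LinearMap.norm_map_iff_inner_map_map T).1 fun f => le_antisymm (hle f) (hge f)
  refine ⟨T, Θ, isHankelLimit h2.cont h3 hT, ⟨h1.c_pos, h2.cont, h3, ⟨C, hC0, hC⟩,
    fun f hf => strongLimit_apply h2.cont h3 hT hf, hsymm, fun f => ?_, hΘd, hΘ, hΘT, hb⟩,
    fun z hz hzZ => sharp_eq_symbol_mul hE h1 h2 hΘd hΘ hz hzZ⟩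
  refine ext_inner_right ℂ fun g => ?_
  rw [← hiso f g]
  exact hsymm (T f) g

/-! ### The integral equations for `Φ` and `Ψ` -/

/-- `φ` is a continuous solution of `φ(x) + σ ∫_{-∞}^t K(x+y) φ(y) dy = 1`. -/
def IsSol (K : ℝ → ℝ) (t σ : ℝ) (φ : ℝ → ℝ) : Prop :=
  Continuous φ ∧ ∀ x : ℝ, φ x + σ * ∫ y in Iio t, K (x + y) * φ y = 1

theorem isSol_one_iff {K : ℝ → ℝ} {t : ℝ} {φ : ℝ → ℝ} : IsSol K t 1 φ ↔ IsPhi K t φ := by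
  simp [IsSol, IsPhi]

theorem isSol_neg_one_iff {K : ℝ → ℝ} {t : ℝ} {φ : ℝ → ℝ} : IsSol K t (-1) φ ↔ IsPsi K t φ := by
  simp [IsSol, IsPsi, sub_eq_add_neg]

section

variable {K : ℝ → ℝ} (hK : Continuous K) (h3 : CondK3 K) {t : ℝ}
include hK h3

theorem integrableOn_kernel_mul {h : ℝ → ℝ} (hh : ∀ a, IntegrableOn h (Icc a t)) (x : ℝ) :
    IntegrableOn (fun y => K (x + y) * h y) (Iio t) := by
  have h1 : IntegrableOn (fun y => K (x + y) * h y) (Icc (-x) t) := by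
    refine (hh (-x)).continuousOn_mul ?_ isCompact_Icc
    exact (hK.comp (by fun_prop : Continuous fun y => x + y)).continuousOn
  refine (h1.of_forall_sdiff_eq_zero measurableSet_Iio fun y hy => ?_)
  rw [h3, zero_mul]
  by_contra! hc
  exact hy.2 ⟨by linarith, (mem_Iio.1 hy.1).le⟩

theorem continuous_kernel_integral {h : ℝ → ℝ} (hh : ∀ a, IntegrableOn h (Icc a t)) :
    Continuous fun x => ∫ y in Iio t, K (x + y) * h y := by
  rw [continuous_iff_continuousAt]
  intro x0
  obtain ⟨M, hM0, hM⟩ := exists_bound_on_Icc hK (|x0| + 1 + |t|)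
  refine continuousAt_of_dominated
    (bound := (Icc (-x0 - 1) t).indicator fun y => M * |h y|) ?_ ?_ ?_ ?_
  · exact Eventually.of_forall fun x => (integrableOn_kernel_mul hK h3 hh x).1
  · filter_upwards [Metric.ball_mem_nhds x0 one_pos] with x hx
    rw [Metric.mem_ball, Real.dist_eq, abs_lt] at hx
    filter_upwards [ae_restrict_mem measurableSet_Iio] with y hy
    have hy : y < t := hy
    by_cases h1 : y ∈ Icc (-x0 - 1) t
    · rw [indicator_of_mem h1, norm_mul, Real.norm_eq_abs, Real.norm_eq_abs]
      by_cases h0 : x + y < 0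
      · rw [h3 _ h0]; simp; positivity
      · refine mul_le_mul_of_nonneg_right (hM _ ?_) (abs_nonneg _)
        rw [abs_of_nonneg (by linarith)]
        linarith [le_abs_self x0, le_abs_self t]
    · rw [indicator_of_notMem h1, h3, zero_mul, norm_zero]
      by_contra! hc
      exact h1 ⟨by linarith, hy.le⟩
  · have : Integrable ((Icc (-x0 - 1) t).indicator fun y => M * |h y|) :=
      IntegrableOn.integrable_indicator ((hh _).norm.const_mul M) measurableSet_Icc
    exact this.integrableOn
  · refine Eventually.of_forall fun y => ?_
    exact ((hK.comp (by fun_prop : Continuous fun x => x + y)).mul continuous_const).continuousAt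

omit hK in
theorem IsSol.eq_one {σ : ℝ} {φ : ℝ → ℝ} (h : IsSol K t σ φ) {x : ℝ} (hx : x ≤ -t) : φ x = 1 := by
  have h1 := h.2 x
  have : ∫ y in Iio t, K (x + y) * φ y = 0 := by
    refine setIntegral_eq_zero_of_forall_eq_zero fun y hy => ?_
    have hy : y < t := hy
    rw [h3 _ (by linarith), zero_mul]
  rw [this] at h1
  linarith

theorem eq_zero_of_eigenvector (hlt : ‖truncOp hK h3 t‖ < 1) {σ : ℝ} (hσ : |σ| = 1) {f : L2}
    (hf : f + (σ : ℂ) • truncOp hK h3 t f = 0) : f = 0 := by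
  by_contra hne
  have h1 : ‖f‖ = ‖truncOp hK h3 t f‖ := by
    rw [eq_neg_of_add_eq_zero_left hf, norm_neg, norm_smul, Complex.norm_real, Real.norm_eq_abs,
      hσ, one_mul]
    rw [← neg_eq_of_add_eq_zero_right hf]
    simp
  have h2 := (truncOp hK h3 t).le_opNorm f
  have h4 : 0 < ‖f‖ := norm_pos_iff.2 hne
  nlinarith

/-- Solutions equal 1 to the left of -t, so the difference cut off at t is in L² and satisfies the
homogeneous equation. The contraction kills it, and the equation carries the vanishing to all x. -/
theorem isSol_unique (hlt : ‖truncOp hK h3 t‖ < 1) {σ : ℝ} (hσ : |σ| = 1) {φ₁ φ₂ : ℝ → ℝ}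
    (h1 : IsSol K t σ φ₁) (h2 : IsSol K t σ φ₂) : φ₁ = φ₂ := by
  let d : ℝ → ℝ := fun x => φ₁ x - φ₂ x
  have hd : Continuous d := h1.1.sub h2.1
  have hI : ∀ φ : ℝ → ℝ, Continuous φ → ∀ x, IntegrableOn (fun y => K (x + y) * φ y) (Iio t) :=
    fun φ hφ x => integrableOn_kernel_mul hK h3 (fun a => hφ.continuousOn.integrableOn_Icc) x
  have hde : ∀ x, d x = -σ * ∫ y in Iio t, K (x + y) * d y := fun x => by
    have e : ∫ y in Iio t, K (x + y) * d y =
        (∫ y in Iio t, K (x + y) * φ₁ y) - ∫ y in Iio t, K (x + y) * φ₂ y := by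
      rw [← integral_sub (hI _ h1.1 x) (hI _ h2.1 x)]
      congr 1; ext y; simp only [d]; ring
    rw [e]
    linarith [h1.2 x, h2.2 x]
  have hd0 : ∀ x, x ≤ -t → d x = 0 := fun x hx => by
    simp only [d, h1.eq_one h3 hx, h2.eq_one h3 hx, sub_self]
  let g : ℝ → ℂ := (Iio t).indicator fun x => (d x : ℂ)
  obtain ⟨B, hB0, hB⟩ := exists_bound_on_Icc hd t
  have hgm : MemLp g 2 volume := by
    refine MemLp.of_le (memLp_indicator_const 2 (measurableSet_Icc (a := -t) (b := t)) B
      (Or.inr (by simp))) ((Complex.continuous_ofReal.comp hd).aestronglyMeasurable.indicator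
        measurableSet_Iio) (Eventually.of_forall fun x => ?_)
    by_cases hx : x ∈ Icc (-t) t
    · rw [indicator_of_mem hx]
      refine (norm_indicator_le_norm_self _ _).trans ?_
      rw [Complex.norm_real]
      exact (hB x (abs_le.2 hx)).trans (le_abs_self _)
    · rw [indicator_of_notMem hx, norm_zero]
      by_cases hxt : x < t
      · simp only [g, indicator_of_mem (mem_Iio.2 hxt)]
        rw [hd0 x (by by_contra! hc; exact hx ⟨hc.le, hxt.le⟩)]; simp
      · simp only [g, indicator_of_notMem (s := Iio t) (a := x) (by simpa using hxt), norm_zero,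
          le_refl]
  have hz : hgm.toLp g = 0 := by
    refine eq_zero_of_eigenvector hK h3 hlt hσ ?_
    ext1
    filter_upwards [Lp.coeFn_add (hgm.toLp g) ((σ : ℂ) • truncOp hK h3 t (hgm.toLp g)),
      Lp.coeFn_smul (σ : ℂ) (truncOp hK h3 t (hgm.toLp g)), truncOp_apply hK h3 t (hgm.toLp g),
      hgm.coeFn_toLp, Lp.coeFn_zero ℂ 2 (volume : Measure ℝ)] with x e1 e2 e3 e4 e5
    rw [e1, e5, Pi.add_apply, e2, Pi.smul_apply, e3, e4, Pi.zero_apply, truncHankel]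
    by_cases hx : x < t
    · simp only [g, indicator_of_mem (mem_Iio.2 hx)]
      have : ∫ y in Iio t, (K (x + y) : ℂ) * hgm.toLp g y =
          ((∫ y in Iio t, K (x + y) * d y : ℝ) : ℂ) := by
        rw [← integral_complex_ofReal]
        refine setIntegral_congr_ae measurableSet_Iio ?_
        filter_upwards [hgm.coeFn_toLp] with y hy hyt
        rw [hy]; simp only [g, indicator_of_mem hyt]; push_cast; rfl
      rw [this, hde x]
      push_cast
      simp only [smul_eq_mul]; ring
    · simp only [g, indicator_of_notMem (s := Iio t) (a := x) (by simpa using hx)]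
      simp
  have hae : ∀ᵐ y, y ∈ Iio t → d y = 0 := by
    have h6 := hgm.coeFn_toLp
    rw [hz] at h6
    filter_upwards [h6, Lp.coeFn_zero ℂ 2 (volume : Measure ℝ)] with y h7 h8 hy
    rw [h8] at h7
    simpa [g, indicator_of_mem hy] using h7.symm
  ext x
  have := hde x
  rw [setIntegral_congr_ae (g := fun _ => (0 : ℝ)) measurableSet_Iio (by
    filter_upwards [hae] with y hy hyt
    rw [hy hyt, mul_zero])] at this
  simp only [integral_zero, mul_zero, d] at this
  linarith

/-- The constant 1 is not square integrable, so the unknown is f = φ - 1 on (-∞,t), with right-hand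
side -σK[t]1; this is supported in (-t,t). The Neumann series inverts 1 + σK[t], and the equation
itself then defines a continuous φ on the whole line. -/
theorem exists_isSol (hlt : ‖truncOp hK h3 t‖ < 1) {σ : ℝ} (hσ : |σ| = 1) :
    ∃ φ, IsSol K t σ φ := by
  let k1 : ℝ → ℝ := fun x => ∫ y in Iio t, K (x + y) * 1
  have hk1 : Continuous k1 := continuous_kernel_integral hK h3 (h := fun _ => (1 : ℝ))
    fun a => continuous_const.continuousOn.integrableOn_Icc
  let g : ℝ → ℂ := (Ioo (-t) t).indicator fun x => -((σ * k1 x : ℝ) : ℂ)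
  obtain ⟨B, hB0, hB⟩ := exists_bound_on_Icc (continuous_const.mul hk1 : Continuous fun x => σ * k1 x) t
  have hgm : MemLp g 2 volume := by
    refine MemLp.of_le (memLp_indicator_const 2 (measurableSet_Ioo (a := -t) (b := t)) B
      (Or.inr (by simp))) ((Complex.continuous_ofReal.comp
        (continuous_const.mul hk1)).neg.aestronglyMeasurable.indicator
        measurableSet_Ioo) (Eventually.of_forall fun x => ?_)
    by_cases hx : x ∈ Ioo (-t) t
    · simp only [g, indicator_of_mem hx]
      rw [norm_neg, Complex.norm_real]
      exact (hB x (abs_le.2 ⟨hx.1.le, hx.2.le⟩)).trans (le_abs_self _)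
    · simp only [g, indicator_of_notMem hx, norm_zero, le_refl]
  have hlt' : ‖-((σ : ℂ) • truncOp hK h3 t)‖ < 1 := by
    rw [norm_neg, norm_smul, Complex.norm_real, Real.norm_eq_abs, hσ, one_mul]
    exact hlt
  let U := Units.oneSub (-((σ : ℂ) • truncOp hK h3 t)) hlt'
  let f : L2 := (U⁻¹ : (L2 →L[ℂ] L2)ˣ).val (hgm.toLp g)
  have hf : f + (σ : ℂ) • truncOp hK h3 t f = hgm.toLp g := by
    have h := DFunLike.congr_fun (U.mul_inv) (hgm.toLp g)
    rw [mul_apply_eq_comp, Units.val_oneSub] at h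
    simpa only [f, sub_neg_eq_add] using! h
  -- Since K and σ are real, the real part of f solves the same equation, which yields a real
  -- solution.
  have hre : ∀ a, IntegrableOn (fun y => 1 + (f y).re) (Icc a t) := fun a =>
    (integrableOn_const (by simp)).add (integrableOn_L2 f (by simp)).re
  have hfe : ∀ᵐ x, x ∈ Iio t →
      1 - σ * (∫ y in Iio t, K (x + y) * (1 + (f y).re)) = 1 + (f x).re := by
    have h0 : hgm.toLp g =ᵐ[volume] f + (σ : ℂ) • truncHankel K t f := by
      rw [← hf]
      filter_upwards [Lp.coeFn_add f ((σ : ℂ) • truncOp hK h3 t f),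
        Lp.coeFn_smul (σ : ℂ) (truncOp hK h3 t f), truncOp_apply hK h3 t f] with x e1 e2 e3
      rw [e1, Pi.add_apply, e2, Pi.smul_apply, e3, Pi.add_apply, Pi.smul_apply]
    obtain ⟨_, hbox⟩ := exists_boxKernel hK h3 t
    filter_upwards [h0, hgm.coeFn_toLp] with x e1 e2 hx
    rw [e2, Pi.add_apply, Pi.smul_apply, truncHankel, indicator_of_mem hx] at e1
    have hIc : IntegrableOn (fun y => (K (x + y) : ℂ) * f y) (Iio t) := by
      have := (hbox.integrable f x).integrableOn (s := Iio t)
      refine this.congr_fun (fun y hy => ?_) measurableSet_Iio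
      simp only [truncKernel, if_pos (And.intro (mem_Iio.1 hx) (mem_Iio.1 hy))]
    have e3 : (g x).re = -(σ * k1 x) := by
      by_cases hxt : x ∈ Ioo (-t) t
      · simp only [g, indicator_of_mem hxt, Complex.neg_re, Complex.ofReal_re]
      · simp only [g, indicator_of_notMem hxt, Complex.zero_re]
        have : k1 x = 0 := by
          refine setIntegral_eq_zero_of_forall_eq_zero fun y hy => ?_
          have hy : y < t := hy
          have hx' : x < t := hx
          rw [h3, zero_mul]
          by_contra! hc
          exact hxt ⟨by linarith, hx'⟩
        rw [this]; simp
    have e4 := congrArg Complex.re e1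
    rw [e3, Complex.add_re, smul_eq_mul, Complex.re_ofReal_mul] at e4
    have e5 : (∫ y in Iio t, (K (x + y) : ℂ) * f y).re = ∫ y in Iio t, K (x + y) * (f y).re := by
      have := integral_re hIc
      simp only [RCLike.re_to_complex, Complex.re_ofReal_mul] at this
      exact this.symm
    have e6 : ∫ y in Iio t, K (x + y) * (1 + (f y).re) =
        k1 x + ∫ y in Iio t, K (x + y) * (f y).re := by
      rw [← integral_add]
      · congr 1; ext y; ring
      · exact integrableOn_kernel_mul hK h3 (fun a => continuous_const.continuousOn.integrableOn_Icc) x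
      · exact integrableOn_kernel_mul hK h3 (fun a => (integrableOn_L2 f (by simp)).re) x
    rw [e5] at e4
    rw [e6]
    linarith
  refine ⟨fun x => 1 - σ * ∫ y in Iio t, K (x + y) * (1 + (f y).re),
    continuous_const.sub (continuous_const.mul (continuous_kernel_integral hK h3 hre)),
    fun x => ?_⟩
  -- On (-∞,t) the function just defined agrees almost everywhere with 1 + Re f, so it may replace
  -- it under the integral.
  have : ∫ y in Iio t, K (x + y) * (1 - σ * ∫ z in Iio t, K (y + z) * (1 + (f z).re)) =
      ∫ y in Iio t, K (x + y) * (1 + (f y).re) := by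
    refine setIntegral_congr_ae measurableSet_Iio ?_
    filter_upwards [hfe] with y hy hyt
    rw [hy hyt]
  rw [this]; ring

omit hK in
/-- Solutions of the integral equation are bounded on the left and grow at most exponentially. -/
theorem IsSol.exists_bound {σ : ℝ} {φ : ℝ → ℝ} (h : IsSol K t σ φ) (hσ : |σ| = 1)
    {c C : ℝ} (hc : 0 < c) (hC0 : 0 ≤ C)
    (hC : ∀ x, |K x| ≤ C * (Ici 0).indicator (fun x => Real.exp (c * x)) x) :
    ∃ B, 0 ≤ B ∧ (∀ x ≤ t, |φ x| ≤ B) ∧ ∀ x, |φ x| ≤ 1 + B * Real.exp (c * x) := by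
  obtain ⟨B0, hB00, hB0⟩ := exists_bound_on_Icc h.1 t
  have hB1 : ∀ x ≤ t, |φ x| ≤ max B0 1 := fun x hx => by
    rcases le_or_gt x (-t) with h1 | h1
    · rw [h.eq_one h3 h1]; simp
    · exact (hB0 x (abs_le.2 ⟨h1.le, hx⟩)).trans (le_max_left _ _)
  set B1 := max B0 1
  have hB1p : 0 ≤ B1 := hB00.trans (le_max_left _ _)
  refine ⟨max B1 (C * B1 * (Real.exp (c * t) / c)), hB1p.trans (le_max_left _ _),
    fun x hx => (hB1 x hx).trans (le_max_left _ _), fun x => ?_⟩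
  have h1 : |∫ y in Iio t, K (x + y) * φ y| ≤
      ∫ y in Iio t, (C * B1 * Real.exp (c * x)) * Real.exp (c * y) := by
    refine norm_integral_le_of_norm_le (f := fun y => K (x + y) * φ y)
      (g := fun y => (C * B1 * Real.exp (c * x)) * Real.exp (c * y)) ?_ ?_
    · exact ((integrableOn_exp_mul_Iic hc t).mono_set Iio_subset_Iic_self).const_mul _
    · filter_upwards [ae_restrict_mem measurableSet_Iio] with y hy
      rw [norm_mul, Real.norm_eq_abs, Real.norm_eq_abs]
      have h2 : |K (x + y)| ≤ C * Real.exp (c * (x + y)) := (hC _).trans (by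
        gcongr
        exact indicator_le_self' (fun _ _ => (Real.exp_nonneg _)) _)
      calc |K (x + y)| * |φ y| ≤ C * Real.exp (c * (x + y)) * B1 := by
            gcongr
            exact hB1 y (le_of_lt hy)
        _ = _ := by rw [mul_add, Real.exp_add]; ring
  have hexp : ∫ y in Iio t, Real.exp (c * y) = Real.exp (c * t) / c := by
    rw [← integral_Iic_eq_integral_Iio, integral_exp_mul_Iic hc]
  rw [integral_const_mul, hexp] at h1
  have h2 := h.2 x
  have h4 : φ x = 1 - σ * ∫ y in Iio t, K (x + y) * φ y := by linarith
  rw [h4]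
  refine (abs_sub _ _).trans ?_
  rw [abs_one, abs_mul, hσ, one_mul]
  gcongr
  refine h1.trans ?_
  calc C * B1 * Real.exp (c * x) * (Real.exp (c * t) / c)
      = C * B1 * (Real.exp (c * t) / c) * Real.exp (c * x) := by ring
    _ ≤ _ := by gcongr; exact le_max_right _ _

end

/-! ### Laplace transforms of the solutions -/

theorem integrable_indicator_Ici_cexp {z : ℂ} (hz : 0 < z.im) (s : ℝ) :
    Integrable fun x : ℝ => (Ici s).indicator (fun _ => (1 : ℂ)) x * Complex.exp (Complex.I * x * z) := by
  have : (fun x : ℝ => (Ici s).indicator (fun _ => (1 : ℂ)) x * Complex.exp (Complex.I * x * z)) =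
      (Ici s).indicator fun x : ℝ => Complex.exp (Complex.I * z * x) := by
    ext x
    by_cases hx : x ∈ Ici s
    · simp only [indicator_of_mem hx, one_mul]; congr 1; ring
    · simp only [indicator_of_notMem hx, zero_mul]
  rw [this, integrable_indicator_iff measurableSet_Ici, integrableOn_Ici_iff_integrableOn_Ioi]
  exact integrableOn_exp_mul_complex_Ioi (by simpa using hz) s

theorem fourier_indicator_Ici {z : ℂ} (hz : 0 < z.im) (s : ℝ) :
    -Complex.I * z * fourier ((Ici s).indicator fun _ => (1 : ℂ)) z = Complex.exp (Complex.I * s * z) := by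
  have h0 : z ≠ 0 := by rintro rfl; simp at hz
  have : (fun x : ℝ => (Ici s).indicator (fun _ => (1 : ℂ)) x * Complex.exp (Complex.I * x * z)) =
      (Ici s).indicator fun x : ℝ => Complex.exp (Complex.I * z * x) := by
    ext x
    by_cases hx : x ∈ Ici s
    · simp only [indicator_of_mem hx, one_mul]; congr 1; ring
    · simp only [indicator_of_notMem hx, zero_mul]
  rw [fourier, this, integral_indicator measurableSet_Ici, integral_Ici_eq_integral_Ioi,
    integral_exp_mul_complex_Ioi (by simpa using hz)]
  field_simp

theorem integrable_indicator_Iio_cexp {z : ℂ} (hz : z.im < 0) (s : ℝ) :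
    Integrable fun x : ℝ => (Iio s).indicator (fun _ => (1 : ℂ)) x * Complex.exp (Complex.I * x * z) := by
  have : (fun x : ℝ => (Iio s).indicator (fun _ => (1 : ℂ)) x * Complex.exp (Complex.I * x * z)) =
      (Iio s).indicator fun x : ℝ => Complex.exp (Complex.I * z * x) := by
    ext x
    by_cases hx : x ∈ Iio s
    · simp only [indicator_of_mem hx, one_mul]; congr 1; ring
    · simp only [indicator_of_notMem hx, zero_mul]
  rw [this, integrable_indicator_iff measurableSet_Iio, ← integrableOn_Iic_iff_integrableOn_Iio]
  exact integrableOn_exp_mul_complex_Iic (by simpa using hz) s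

theorem fourier_indicator_Iio {z : ℂ} (hz : z.im < 0) (s : ℝ) :
    Complex.I * z * fourier ((Iio s).indicator fun _ => (1 : ℂ)) z = Complex.exp (Complex.I * s * z) := by
  have h0 : z ≠ 0 := by rintro rfl; simp at hz
  have : (fun x : ℝ => (Iio s).indicator (fun _ => (1 : ℂ)) x * Complex.exp (Complex.I * x * z)) =
      (Iio s).indicator fun x : ℝ => Complex.exp (Complex.I * z * x) := by
    ext x
    by_cases hx : x ∈ Iio s
    · simp only [indicator_of_mem hx, one_mul]; congr 1; ring
    · simp only [indicator_of_notMem hx, zero_mul]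
  rw [fourier, this, integral_indicator measurableSet_Iio, ← integral_Iic_eq_integral_Iio,
    integral_exp_mul_complex_Iic (by simpa using hz)]
  field_simp

/-- The restriction of a real function to `(-∞, t)`, as a complex function. -/
noncomputable def lowerPart (t : ℝ) (φ : ℝ → ℝ) : ℝ → ℂ := (Iio t).indicator fun x => (φ x : ℂ)

/-- The restriction of a real function to `[t, ∞)`, as a complex function. -/
noncomputable def upperPart (t : ℝ) (φ : ℝ → ℝ) : ℝ → ℂ := (Ici t).indicator fun x => (φ x : ℂ)

/-- The restriction of a real function to `[-t, t)`, as a complex function. -/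
noncomputable def middlePart (t : ℝ) (φ : ℝ → ℝ) : ℝ → ℂ :=
  (Ico (-t) t).indicator fun x => (φ x : ℂ)

/-- The entire function `exp (-itz) + iz ∫_{-t}^t φ(x) exp (izx) dx`. -/
noncomputable def entirePart (t : ℝ) (φ : ℝ → ℝ) (z : ℂ) : ℂ :=
  Complex.exp (-Complex.I * t * z) + Complex.I * z * fourier (middlePart t φ) z

section entire

variable {t : ℝ} {φ : ℝ → ℝ}

theorem integrable_middlePart (hφ : Continuous φ) : Integrable (middlePart t φ) :=
  ((Complex.continuous_ofReal.comp hφ).continuousOn.integrableOn_Icc.mono_set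
    Ico_subset_Icc_self).integrable_indicator measurableSet_Ico

theorem norm_middlePart_mul_exp_le (x v : ℝ) :
    ‖middlePart t φ x‖ * Real.exp (-(x * v)) ≤ ‖middlePart t φ x‖ * Real.exp (t * |v|) := by
  by_cases hx : x ∈ Ico (-t) t
  · refine mul_le_mul_of_nonneg_left (Real.exp_le_exp.2 ?_) (norm_nonneg _)
    have h1 : |x| ≤ t := abs_le.2 ⟨hx.1, hx.2.le⟩
    calc -(x * v) ≤ |x * v| := neg_le_abs _
      _ = |x| * |v| := abs_mul _ _
      _ ≤ _ := by gcongr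
  · rw [middlePart, indicator_of_notMem hx]; simp

theorem integrable_norm_middlePart_mul_exp (hφ : Continuous φ) (v : ℝ) :
    Integrable fun x => ‖middlePart t φ x‖ * Real.exp (-(x * v)) := by
  have hi := integrable_middlePart (t := t) hφ
  refine (hi.norm.mul_const (Real.exp (t * |v|))).mono' (hi.1.norm.mul (by fun_prop : Continuous
    fun x : ℝ => Real.exp (-(x * v))).aestronglyMeasurable) (Eventually.of_forall fun x => ?_)
  rw [Real.norm_of_nonneg (by positivity)]
  exact norm_middlePart_mul_exp_le x v

theorem integrable_middlePart_mul_cexp (hφ : Continuous φ) (z : ℂ) :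
    Integrable fun x : ℝ => middlePart t φ x * Complex.exp (Complex.I * x * z) :=
  (integrable_mul_cexp_iff (integrable_middlePart hφ).1 z).2
    (integrable_norm_middlePart_mul_exp hφ z.im)

theorem differentiable_entirePart (hφ : Continuous φ) : Differentiable ℂ (entirePart t φ) := by
  intro z
  have h1 : DifferentiableAt ℂ (fourier (middlePart t φ)) z :=
    differentiableAt_fourier (integrable_middlePart hφ).1 (a := z.im - 1) (b := z.im + 1)
      (fun v _ _ => integrable_norm_middlePart_mul_exp hφ v) (by linarith) (by linarith)
  have h2 : DifferentiableAt ℂ (fun z => Complex.exp (-Complex.I * t * z)) z := by fun_prop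
  exact h2.add ((differentiableAt_id.const_mul Complex.I).mul h1)

theorem entirePart_zero : entirePart t φ 0 = 1 := by simp [entirePart]

theorem conj_fourier (f : ℝ → ℂ) (z : ℂ) : (starRingEnd ℂ) (fourier f z) =
    fourier (fun x => (starRingEnd ℂ) (f x)) (-(starRingEnd ℂ) z) := by
  rw [fourier, ← integral_conj]
  congr 1; ext x
  rw [map_mul, ← Complex.exp_conj]
  congr 2
  simp

/-- Reality of φ; equivalently, `sharp` acts on `entirePart` as z ↦ -z. -/
theorem conj_entirePart (z : ℂ) : (starRingEnd ℂ) (entirePart t φ z) =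
    entirePart t φ (-(starRingEnd ℂ) z) := by
  have h : (fun x => (starRingEnd ℂ) (middlePart t φ x)) = middlePart t φ := by
    ext x
    by_cases hx : x ∈ Ico (-t) t
    · simp [middlePart, indicator_of_mem hx]
    · simp [middlePart, indicator_of_notMem hx]
  rw [entirePart, entirePart, map_add, map_mul, map_mul, conj_fourier, h, ← Complex.exp_conj]
  simp

theorem norm_entirePart_le (ht : 0 ≤ t) (hφ : Continuous φ) : ∃ D, 0 ≤ D ∧ ∀ z,
    ‖entirePart t φ z‖ ≤ (1 + ‖z‖ * D) * Real.exp (t * |z.im|) := by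
  refine ⟨∫ x, ‖middlePart t φ x‖, integral_nonneg fun _ => norm_nonneg _, fun z => ?_⟩
  have h1 : ‖fourier (middlePart t φ) z‖ ≤ (∫ x, ‖middlePart t φ x‖) * Real.exp (t * |z.im|) := by
    rw [← integral_mul_const]
    refine norm_integral_le_of_norm_le
      ((integrable_middlePart hφ).norm.mul_const _) (Eventually.of_forall fun x => ?_)
    rw [norm_mul, norm_cexp_I_mul]
    exact norm_middlePart_mul_exp_le x z.im
  have h2 : ‖Complex.exp (-Complex.I * t * z)‖ ≤ Real.exp (t * |z.im|) := by
    rw [Complex.norm_exp]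
    refine Real.exp_le_exp.2 ?_
    have : (-Complex.I * t * z).re = t * z.im := by simp
    rw [this]
    gcongr
    exact le_abs_self _
  calc ‖entirePart t φ z‖ ≤ ‖Complex.exp (-Complex.I * t * z)‖ +
        ‖Complex.I * z * fourier (middlePart t φ) z‖ := norm_add_le _ _
    _ ≤ Real.exp (t * |z.im|) + ‖z‖ * ((∫ x, ‖middlePart t φ x‖) * Real.exp (t * |z.im|)) := by
      rw [norm_mul, norm_mul, Complex.norm_I, one_mul]
      gcongr
    _ = _ := by ring

end entire

section laplace

variable {K : ℝ → ℝ} {c : ℝ} {T : L2 →L[ℂ] L2} {Θ : ℂ → ℂ} (H : HankelSystem K c T Θ)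
  {t : ℝ} (ht : 0 ≤ t) {σ : ℝ} {φ : ℝ → ℝ} (hφ : IsSol K t σ φ)
include H ht hφ

theorem lowerPart_eq : lowerPart t φ =
    fun x => (Iio (-t)).indicator (fun _ => (1 : ℂ)) x + middlePart t φ x := by
  ext x
  rcases lt_or_ge x (-t) with h | h
  · rw [lowerPart, middlePart, indicator_of_mem (mem_Iio.2 h), indicator_of_mem
      (mem_Iio.2 (by linarith)), indicator_of_notMem (s := Ico (-t) t) (fun hx => by linarith [hx.1]),
      hφ.eq_one H.causal h.le]; simp
  · rw [indicator_of_notMem (s := Iio (-t)) (by simpa using h), zero_add]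
    by_cases hx : x < t
    · rw [lowerPart, middlePart, indicator_of_mem (mem_Iio.2 hx), indicator_of_mem (show x ∈ Ico (-t) t from ⟨h, hx⟩)]
    · rw [lowerPart, middlePart, indicator_of_notMem (s := Iio t) (by simpa using hx),
        indicator_of_notMem (s := Ico (-t) t) (fun h => hx h.2)]

theorem integrable_lowerPart_mul_cexp {z : ℂ} (hz : z.im < 0) :
    Integrable fun x : ℝ => lowerPart t φ x * Complex.exp (Complex.I * x * z) := by
  rw [lowerPart_eq H ht hφ]
  simp only [add_mul]
  exact (integrable_indicator_Iio_cexp hz _).add (integrable_middlePart_mul_cexp hφ.1 z)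

/-- The solution equals 1 on (-∞,-t), where the integral is an explicit exponential, and the
remainder has compact support. So iz times the transform continues from the lower half-plane to an
entire function. -/
theorem fourier_lowerPart {z : ℂ} (hz : z.im < 0) :
    Complex.I * z * fourier (lowerPart t φ) z = entirePart t φ z := by
  have : fourier (lowerPart t φ) z =
      fourier ((Iio (-t)).indicator fun _ => (1 : ℂ)) z + fourier (middlePart t φ) z := by
    rw [fourier, fourier, fourier, ← integral_add (integrable_indicator_Iio_cexp hz _)
      (integrable_middlePart_mul_cexp hφ.1 z), lowerPart_eq H ht hφ]
    simp only [add_mul]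
  rw [this, mul_add, fourier_indicator_Iio hz, entirePart]
  congr 2
  push_cast; ring

omit H ht hφ in
theorem hankel_lowerPart (x : ℝ) : hankel K (lowerPart t φ) x =
    ((∫ y in Iio t, K (x + y) * φ y : ℝ) : ℂ) := by
  rw [← integral_complex_ofReal, ← integral_indicator measurableSet_Iio, hankel]
  congr 1; ext y
  by_cases h : y ∈ Iio t
  · simp only [lowerPart, indicator_of_mem h]; push_cast; rfl
  · simp only [lowerPart, indicator_of_notMem h, mul_zero]

omit H ht in
theorem isSol_complex (x : ℝ) : (φ x : ℂ) + σ * hankel K (lowerPart t φ) x = 1 := by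
  rw [hankel_lowerPart]
  exact_mod_cast hφ.2 x

/-- The integral equation regrouped so that each term has a convergent transform for Im z > c: the
constant 1 is combined with the tail of the lower part into the indicator of [-t,∞). -/
theorem upperPart_eq : upperPart t φ = fun x => ((Ici (-t)).indicator (fun _ => (1 : ℂ)) x -
    middlePart t φ x) - σ * hankel K (lowerPart t φ) x := by
  ext x
  have h0 := isSol_complex hφ x
  rcases lt_or_ge x (-t) with h | h
  · have h1 : (φ x : ℂ) = 1 := by rw [hφ.eq_one H.causal h.le]; simp
    rw [upperPart, middlePart, indicator_of_notMem (s := Ici t) (by simp; linarith),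
      indicator_of_notMem (s := Ici (-t)) (by simpa using h),
      indicator_of_notMem (s := Ico (-t) t) (fun hx => by linarith [hx.1])]
    rw [h1] at h0
    linear_combination h0
  · rw [indicator_of_mem (mem_Ici.2 h)]
    by_cases hx : x < t
    · rw [upperPart, middlePart, indicator_of_notMem (s := Ici t) (by simpa using hx),
        indicator_of_mem (show x ∈ Ico (-t) t from ⟨h, hx⟩)]
      linear_combination h0
    · rw [upperPart, middlePart, indicator_of_mem (by simpa using hx),
        indicator_of_notMem (s := Ico (-t) t) (fun h => hx h.2)]
      linear_combination h0

theorem integrable_hankel_lowerPart {z : ℂ} (hz : c < z.im) :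
    Integrable fun x : ℝ => hankel K (lowerPart t φ) x * Complex.exp (Complex.I * x * z) := by
  obtain ⟨C, hC0, hC⟩ := H.growth
  have hc := H.c_pos
  exact (fourier_hankel H.cont hC hz
    (integrable_lowerPart_mul_cexp H ht hφ (z := -z) (by simp; linarith))).1

theorem integrable_upperPart_mul_cexp {z : ℂ} (hz : c < z.im) :
    Integrable fun x : ℝ => upperPart t φ x * Complex.exp (Complex.I * x * z) := by
  have hc := H.c_pos
  refine (((integrable_indicator_Ici_cexp (hc.trans hz) (-t)).sub
    (integrable_middlePart_mul_cexp (t := t) hφ.1 z)).sub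
    ((integrable_hankel_lowerPart H ht hφ hz).const_mul (σ : ℂ))).congr
    (Eventually.of_forall fun x => ?_)
  rw [upperPart_eq H ht hφ]
  simp only [Pi.sub_apply]
  ring

/-- The Laplace form of the integral equation: the Hankel term contributes Θ(z) times the lower
transform at -z. This is the source of the formulas for A and B. -/
theorem fourier_upperPart {z : ℂ} (hz : c < z.im) : -Complex.I * z * fourier (upperPart t φ) z =
    entirePart t φ z - σ * Θ z * entirePart t φ (-z) := by
  obtain ⟨C, hC0, hC⟩ := H.growth
  have hc := H.c_pos
  have hz' : (-z).im < 0 := by simp; linarith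
  have h1 := (fourier_hankel H.cont hC hz (integrable_lowerPart_mul_cexp H ht hφ hz')).2
  have h2 : fourier (upperPart t φ) z = (fourier ((Ici (-t)).indicator fun _ => (1 : ℂ)) z -
      fourier (middlePart t φ) z) - σ * fourier (hankel K (lowerPart t φ)) z := by
    have i1 := integrable_indicator_Ici_cexp (hc.trans hz) (-t)
    have i2 := integrable_middlePart_mul_cexp (t := t) hφ.1 z
    have i3 := integrable_hankel_lowerPart H ht hφ hz
    rw [fourier, fourier, fourier, fourier, ← integral_sub i1 i2, ← integral_const_mul]
    refine Eq.trans ?_ (integral_sub (i1.sub i2) (i3.const_mul (σ : ℂ)))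
    refine integral_congr_ae (Eventually.of_forall fun x => ?_)
    rw [upperPart_eq H ht hφ]
    ring
  have h3 := fourier_indicator_Ici (hc.trans hz) (-t)
  have h4 := fourier_lowerPart H ht hφ hz'
  rw [h2, h1, ← H.symbol_eq z hz, ← h4, entirePart]
  have h5 : Complex.exp (-Complex.I * t * z) = Complex.exp (Complex.I * (-t : ℝ) * z) := by
    congr 1; push_cast; ring
  rw [h5, ← h3]
  ring

/-- Integration starts at t, which gives the decay exp(-t Im z). It compensates exactly the
exponential type t of `entirePart` in the proof of `wronskian`. -/
theorem norm_fourier_upperPart_le (hσ : |σ| = 1) : ∃ D, 0 ≤ D ∧ ∀ z : ℂ, c < z.im →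
    ‖-Complex.I * z * fourier (upperPart t φ) z‖ ≤ ‖z‖ * D * Real.exp (-(t * z.im)) / (z.im - c) := by
  obtain ⟨C, hC0, hC⟩ := H.growth
  have hc := H.c_pos
  obtain ⟨B, hB0, -, hB⟩ := hφ.exists_bound H.causal hσ hc hC0 hC
  refine ⟨(1 + B) * Real.exp (c * t), by positivity, fun z hz => ?_⟩
  have hneg : c - z.im < 0 := by linarith
  have h1 : ‖fourier (upperPart t φ) z‖ ≤ (1 + B) * (Real.exp ((c - z.im) * t) / (z.im - c)) := by
    have e : ∫ x, (Ici t).indicator (fun x => (1 + B) * Real.exp ((c - z.im) * x)) x =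
        (1 + B) * (Real.exp ((c - z.im) * t) / (z.im - c)) := by
      rw [integral_indicator measurableSet_Ici, integral_const_mul, integral_Ici_eq_integral_Ioi,
        integral_exp_mul_Ioi hneg, ← neg_sub z.im c, neg_div_neg_eq]
    rw [← e]
    refine norm_integral_le_of_norm_le ?_ (Eventually.of_forall fun x => ?_)
    · refine IntegrableOn.integrable_indicator ?_ measurableSet_Ici
      rw [integrableOn_Ici_iff_integrableOn_Ioi]
      exact (integrableOn_exp_mul_Ioi hneg t).const_mul _
    · rw [norm_mul, norm_cexp_I_mul, upperPart]
      by_cases hx : x ∈ Ici t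
      · rw [indicator_of_mem hx, indicator_of_mem hx, Complex.norm_real, Real.norm_eq_abs]
        have hx0 : 0 ≤ x := ht.trans hx
        have : 1 ≤ Real.exp (c * x) := Real.one_le_exp (by positivity)
        calc |φ x| * Real.exp (-(x * z.im))
            ≤ (1 + B) * Real.exp (c * x) * Real.exp (-(x * z.im)) := by
              gcongr
              exact (hB x).trans (by rw [add_mul, one_mul]; gcongr)
          _ = _ := by rw [mul_assoc, ← Real.exp_add]; congr 2; ring
      · rw [indicator_of_notMem hx, indicator_of_notMem hx]; simp
  rw [norm_mul, norm_mul, norm_neg, Complex.norm_I, one_mul]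
  calc ‖z‖ * ‖fourier (upperPart t φ) z‖
      ≤ ‖z‖ * ((1 + B) * (Real.exp ((c - z.im) * t) / (z.im - c))) := by gcongr
    _ = _ := by
      have : Real.exp ((c - z.im) * t) = Real.exp (c * t) * Real.exp (-(t * z.im)) := by
        rw [← Real.exp_add]; congr 1; ring
      rw [this]; ring

end laplace

/-! ### The Wronskian identity -/

/-- A variant of Liouville's theorem for even entire functions of quadratic growth. -/
theorem eq_const_of_even_of_norm_le {W : ℂ → ℂ} (hW : Differentiable ℂ W) (he : ∀ z, W (-z) = W z)
    {C : ℝ} (hC : ∀ z, ‖W z‖ ≤ C * (1 + ‖z‖) ^ 2)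
    (hlim : Tendsto (fun y : ℝ => W (y * Complex.I) / (y : ℂ) ^ 2) atTop (𝓝 0)) (z : ℂ) :
    W z = W 0 := by
  -- This is (W(z) - W(0))/z², entire because evenness forces W'(0) = 0. Quadratic growth makes it
  -- bounded, hence constant, and the limit along the imaginary axis makes the constant zero.
  let g := dslope (dslope W 0) 0
  have hd1 : Differentiable ℂ (dslope W 0) := differentiableOn_univ.1
    ((Complex.differentiableOn_dslope univ_mem).2 hW.differentiableOn)
  have hd2 : Differentiable ℂ g := differentiableOn_univ.1
    ((Complex.differentiableOn_dslope univ_mem).2 hd1.differentiableOn)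
  have hderiv : deriv W 0 = 0 := by
    have := deriv_comp_neg W 0
    simp only [he, neg_zero] at this
    linear_combination this / 2
  have hg : ∀ z ≠ 0, g z = (W z - W 0) / z ^ 2 := fun z hz => by
    simp only [g]
    rw [dslope_of_ne _ hz, slope_def_field, dslope_of_ne _ hz, slope_def_field, dslope_same, hderiv]
    field_simp
    ring
  have hbdd : Bornology.IsBounded (range g) := by
    obtain ⟨M, hM⟩ := (isCompact_closedBall (0 : ℂ) 1).exists_bound_of_continuousOn
      hd2.continuous.continuousOn
    rw [isBounded_iff_forall_norm_le]
    refine ⟨max M (C * 4 + ‖W 0‖), ?_⟩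
    rintro _ ⟨z, rfl⟩
    rcases le_or_gt ‖z‖ 1 with h | h
    · exact (hM z (by simpa using h)).trans (le_max_left _ _)
    · refine le_trans ?_ (le_max_right _ _)
      have hz : z ≠ 0 := by rintro rfl; simp at h; linarith
      have hC0 : 0 ≤ C := by
        have := (norm_nonneg _).trans (hC 0)
        simpa using this
      rw [hg z hz, norm_div, norm_pow, div_le_iff₀ (by positivity)]
      calc ‖W z - W 0‖ ≤ C * (1 + ‖z‖) ^ 2 + ‖W 0‖ :=
            (norm_sub_le _ _).trans (by gcongr; exact hC z)
        _ ≤ C * (‖z‖ + ‖z‖) ^ 2 + ‖W 0‖ * ‖z‖ ^ 2 := by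
            gcongr
            exact le_mul_of_one_le_right (norm_nonneg _) (one_le_pow₀ h.le)
        _ = _ := by ring
  have hconst : ∀ z, g z = g 0 := fun z => hd2.apply_eq_apply_of_bounded hbdd _ _
  have hlim2 : Tendsto (fun y : ℝ => g (y * Complex.I)) atTop (𝓝 0) := by
    have h1 : Tendsto (fun y : ℝ => W 0 / (y : ℂ) ^ 2) atTop (𝓝 0) := by
      rw [tendsto_zero_iff_norm_tendsto_zero]
      simp only [norm_div, norm_pow, Complex.norm_real]
      exact tendsto_const_nhds.div_atTop ((tendsto_pow_atTop two_ne_zero).comp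
        (tendsto_norm_atTop_atTop))
    have h2 := (h1.sub hlim)
    rw [sub_zero] at h2
    refine h2.congr' ?_
    filter_upwards [eventually_gt_atTop 0] with y hy
    have hy' : (y : ℂ) ≠ 0 := by exact_mod_cast hy.ne'
    rw [hg _ (mul_ne_zero hy' Complex.I_ne_zero), mul_pow, Complex.I_sq]
    field_simp
    ring
  have hg0 : g 0 = 0 := by
    simp only [hconst] at hlim2
    exact tendsto_nhds_unique tendsto_const_nhds hlim2
  by_cases hz : z = 0
  · rw [hz]
  · have h1 := hg z hz
    rw [hconst z, hg0, eq_comm, div_eq_zero_iff] at h1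
    rcases h1 with h1 | h1
    · exact sub_eq_zero.1 h1
    · exact absurd (pow_eq_zero_iff two_ne_zero |>.1 h1) hz

section wronskian

variable {K : ℝ → ℝ} {c : ℝ} {T : L2 →L[ℂ] L2} {Θ : ℂ → ℂ} (H : HankelSystem K c T Θ)
  {t : ℝ} (ht : 0 ≤ t) {φ ψ : ℝ → ℝ} (hφ : IsSol K t 1 φ) (hψ : IsSol K t (-1) ψ)
include H ht hφ hψ

/-- The left side W is even and entire, with W(0) = 2. Trading one factor of each product for the
transform of an upper part cancels all exponential growth and gains 1/(Im z - c), so the Liouville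
variant applies. -/
theorem wronskian (z : ℂ) : entirePart t ψ z * entirePart t φ (-z) +
    entirePart t φ z * entirePart t ψ (-z) = 2 := by
  let p := entirePart t ψ
  let q := entirePart t φ
  let W : ℂ → ℂ := fun z => p z * q (-z) + q z * p (-z)
  change W z = 2
  have hp : Differentiable ℂ p := differentiable_entirePart hψ.1
  have hq : Differentiable ℂ q := differentiable_entirePart hφ.1
  have hW : Differentiable ℂ W := (hp.mul (hq.comp differentiable_neg)).add
    (hq.mul (hp.comp differentiable_neg))
  have he : ∀ z, W (-z) = W z := fun z => by simp only [W, neg_neg]; ring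
  have hW0 : W 0 = 2 := by
    simp only [W, p, q, neg_zero, entirePart_zero]; norm_num
  obtain ⟨Dp, hDp0, hDp⟩ := norm_entirePart_le ht hψ.1
  obtain ⟨Dq, hDq0, hDq⟩ := norm_entirePart_le ht hφ.1
  obtain ⟨Da, hDa0, hDa⟩ := norm_fourier_upperPart_le H ht hψ (by simp)
  obtain ⟨Db, hDb0, hDb⟩ := norm_fourier_upperPart_le H ht hφ (by simp)
  have hc := H.c_pos
  -- the bound far from the real axis
  have hfar : ∀ z : ℂ, c < z.im → ‖W z‖ ≤
      (Da * (1 + Dq) + Db * (1 + Dp)) * (1 + ‖z‖) ^ 2 / (z.im - c) := fun z hz => by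
    -- The two terms containing Θ cancel because Φ and Ψ have opposite signs σ.
    have e : W z = (-Complex.I * z * fourier (upperPart t ψ) z) * q (-z) +
        (-Complex.I * z * fourier (upperPart t φ) z) * p (-z) := by
      rw [fourier_upperPart H ht hψ hz, fourier_upperPart H ht hφ hz]
      simp only [W, p, q]; push_cast; ring
    have hv : 0 < z.im := hc.trans hz
    have hvc : 0 < z.im - c := by linarith
    have key : ∀ (a b D1 D2 : ℝ), 0 ≤ D1 → 0 ≤ D2 → 0 ≤ b →
        a ≤ ‖z‖ * D1 * Real.exp (-(t * z.im)) / (z.im - c) →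
        b ≤ (1 + ‖-z‖ * D2) * Real.exp (t * |(-z).im|) →
        a * b ≤ D1 * (1 + D2) * (1 + ‖z‖) ^ 2 / (z.im - c) := by
      intro a b D1 D2 h1 h2 hb0 ha hb
      rw [norm_neg, Complex.neg_im, abs_neg, abs_of_pos hv] at hb
      calc a * b ≤ (‖z‖ * D1 * Real.exp (-(t * z.im)) / (z.im - c)) *
            ((1 + ‖z‖ * D2) * Real.exp (t * z.im)) := by gcongr
        _ = D1 * (‖z‖ * (1 + ‖z‖ * D2)) / (z.im - c) := by
            have : Real.exp (-(t * z.im)) * Real.exp (t * z.im) = 1 := by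
              rw [← Real.exp_add]; simp
            linear_combination (‖z‖ * D1 * (1 + ‖z‖ * D2) / (z.im - c)) * this
        _ ≤ _ := by
            have h3 : ‖z‖ * (1 + ‖z‖ * D2) ≤ (1 + D2) * (1 + ‖z‖) ^ 2 := by
              have := norm_nonneg z
              nlinarith [mul_nonneg this h2, mul_nonneg (mul_nonneg this this) h2]
            rw [mul_assoc D1]
            exact div_le_div_of_nonneg_right (mul_le_mul_of_nonneg_left h3 h1) hvc.le
    rw [e]
    refine (norm_add_le _ _).trans ?_
    rw [norm_mul _ (q (-z)), norm_mul _ (p (-z)), add_mul, add_div]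
    exact add_le_add (key _ _ _ _ hDa0 hDq0 (norm_nonneg _) (hDa z hz) (hDq (-z)))
      (key _ _ _ _ hDb0 hDp0 (norm_nonneg _) (hDb z hz) (hDp (-z)))
  have hbound : ∃ C, ∀ z, ‖W z‖ ≤ C * (1 + ‖z‖) ^ 2 := by
    let M := Da * (1 + Dq) + Db * (1 + Dp)
    have hM : 0 ≤ M := by positivity
    let N := 2 * ((1 + Dp) * (1 + Dq)) * Real.exp (t * (c + 1)) ^ 2
    have hN : 0 ≤ N := by positivity
    refine ⟨M + N, fun z => ?_⟩
    -- Three regions: Im z ≥ c + 1 by `hfar`, Im z ≤ -(c + 1) by evenness, and the strip between,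
    -- where exponential type amounts to a bounded factor.
    have hfar' : ∀ z : ℂ, c + 1 ≤ z.im → ‖W z‖ ≤ (M + N) * (1 + ‖z‖) ^ 2 := fun z hz => by
      refine (hfar z (by linarith)).trans ?_
      refine (div_le_self (by positivity) (by linarith)).trans ?_
      exact mul_le_mul_of_nonneg_right (le_add_of_nonneg_right hN) (by positivity)
    rcases le_or_gt (c + 1) z.im with h1 | h1
    · exact hfar' z h1
    rcases le_or_gt (c + 1) (-z.im) with h2 | h2
    · have := hfar' (-z) (by simpa using h2)
      rwa [he, norm_neg] at this
    · have h3 : |z.im| ≤ c + 1 := abs_le.2 ⟨by linarith, h1.le⟩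
      have key : ∀ w : ℂ, ‖w‖ = ‖z‖ → |w.im| = |z.im| → ∀ (f : ℂ → ℂ) (D : ℝ), 0 ≤ D →
          (∀ z, ‖f z‖ ≤ (1 + ‖z‖ * D) * Real.exp (t * |z.im|)) →
          ‖f w‖ ≤ (1 + D) * (1 + ‖z‖) * Real.exp (t * (c + 1)) := by
        intro w h4 h5 f D hD hf
        refine (hf w).trans ?_
        rw [h4, h5]
        gcongr
        nlinarith [norm_nonneg z]
      have k1 := key z rfl rfl p Dp hDp0 hDp
      have k2 := key (-z) (norm_neg z) (by simp) p Dp hDp0 hDp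
      have k3 := key z rfl rfl q Dq hDq0 hDq
      have k4 := key (-z) (norm_neg z) (by simp) q Dq hDq0 hDq
      calc ‖W z‖ ≤ ‖p z‖ * ‖q (-z)‖ + ‖q z‖ * ‖p (-z)‖ := by
            refine (norm_add_le _ _).trans ?_
            rw [norm_mul, norm_mul]
        _ ≤ ((1 + Dp) * (1 + ‖z‖) * Real.exp (t * (c + 1))) *
              ((1 + Dq) * (1 + ‖z‖) * Real.exp (t * (c + 1))) +
            ((1 + Dq) * (1 + ‖z‖) * Real.exp (t * (c + 1))) *
              ((1 + Dp) * (1 + ‖z‖) * Real.exp (t * (c + 1))) := by gcongr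
        _ = N * (1 + ‖z‖) ^ 2 := by simp only [N]; ring
        _ ≤ _ := mul_le_mul_of_nonneg_right (le_add_of_nonneg_left hM) (by positivity)
  obtain ⟨C, hC⟩ := hbound
  rw [← hW0]
  refine eq_const_of_even_of_norm_le hW he hC ?_ z
  have h1 : Tendsto (fun y : ℝ => (Da * (1 + Dq) + Db * (1 + Dp)) * 4 / (y - c)) atTop (𝓝 0) :=
    tendsto_const_nhds.div_atTop (tendsto_atTop_add_const_right _ _ tendsto_id)
  refine squeeze_zero_norm' ?_ h1
  filter_upwards [eventually_gt_atTop (c + 1)] with y hy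
  have hy0 : 0 < y := by linarith
  have hn : ‖(y : ℂ) * Complex.I‖ = y := by simp [abs_of_pos hy0]
  have hi : ((y : ℂ) * Complex.I).im = y := by simp
  have h2 := hfar (y * Complex.I) (by rw [hi]; linarith)
  rw [hn, hi] at h2
  rw [norm_div, norm_pow, Complex.norm_real, Real.norm_of_nonneg hy0.le, div_le_iff₀ (by positivity)]
  refine h2.trans ?_
  rw [div_mul_eq_mul_div]
  have : 0 < y - c := by linarith
  rw [mul_assoc]
  gcongr
  nlinarith

end wronskian

/-! ### The analytic continuation -/

/-- Multiplying `fourier_upperPart` by E/2 turns ΘE into E^♯, and only entire functions and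
functions analytic off Z remain. -/
theorem isContinuation {E : ℂ → ℂ} {Z : Set ℂ} {K : ℝ → ℝ} {c : ℝ} {T : L2 →L[ℂ] L2} {Θ : ℂ → ℂ}
    (h1 : CondK1 E c Z) (H : HankelSystem K c T Θ)
    (hΘ : ∀ z ∈ upperHalf, z ∉ Z → sharp E z = Θ z * E z)
    {t : ℝ} (ht : 0 ≤ t) {σ : ℝ} {φ : ℝ → ℝ} (hφ : IsSol K t σ φ) :
    IsContinuation E c Z t φ fun z =>
      (E z * entirePart t φ z - σ * sharp E z * entirePart t φ (-z)) / 2 := by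
  have hc := H.c_pos
  refine ⟨fun z hz => ?_, fun z hz => ?_⟩
  · have hq : Differentiable ℂ (entirePart t φ) := differentiable_entirePart hφ.1
    have hq' : Differentiable ℂ fun z => entirePart t φ (-z) := hq.comp differentiable_neg
    exact (((h1.analytic z hz).mul (hq.analyticAt z)).sub
      ((analyticAt_const.mul (h1.analytic_sharp z hz)).mul (hq'.analyticAt z))).div_const
  · have e : (fun x : ℝ => upperPart t φ x * Complex.exp (Complex.I * x * z)) =
        (Ici t).indicator fun x : ℝ => (φ x : ℂ) * Complex.exp (Complex.I * z * x) := by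
      ext x
      by_cases hx : x ∈ Ici t
      · rw [upperPart, indicator_of_mem hx, indicator_of_mem hx]; congr 2; ring
      · rw [upperPart, indicator_of_notMem hx, indicator_of_notMem hx, zero_mul]
    have hi := integrable_upperPart_mul_cexp H ht hφ hz
    have hf := fourier_upperPart H ht hφ hz
    rw [fourier] at hf
    rw [e] at hi hf
    rw [integrable_indicator_iff measurableSet_Ici, integrableOn_Ici_iff_integrableOn_Ioi] at hi
    rw [integral_indicator measurableSet_Ici, integral_Ici_eq_integral_Ioi] at hf
    refine ⟨hi, ?_⟩
    beta_reduce
    rw [hΘ z (hc.trans hz) fun h => by linarith [(h1.strip z h).2]]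
    linear_combination (-E z / 2) * hf

/-! ### Exponential averages -/

/-- The average `∫_0^∞ exp (iξs) h(x - s) ds`. -/
noncomputable def expAvg (ξ : ℂ) (h : ℝ → ℂ) (x : ℝ) : ℂ :=
  ∫ s in Ioi (0 : ℝ), Complex.exp (Complex.I * s * ξ) * h (x - s)

/-- The operator `i - ξ expAvg ξ`, which annihilates the constants. -/
noncomputable def expDiff (ξ : ℂ) (h : ℝ → ℂ) (x : ℝ) : ℂ :=
  Complex.I * h x - ξ * expAvg ξ h x

/-- Bounded measurable functions equal to `1` to the left of `-t` and to `0` to the right of `t`. -/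
structure IsCutoff (t : ℝ) (h : ℝ → ℂ) : Prop where
  measurable : Measurable h
  bounded : ∃ B, 0 ≤ B ∧ ∀ x, ‖h x‖ ≤ B
  left : ∀ x < -t, h x = 1
  right : ∀ x, t < x → h x = 0

/-- A reflected cutoff equals 1 on the wrong side; subtracting it from 1 repairs this, and `expDiff`
ignores the constant up to sign. -/
theorem IsCutoff.reflect {t : ℝ} {h : ℝ → ℂ} (hh : IsCutoff t h) :
    IsCutoff t fun x => 1 - h (-x) := by
  obtain ⟨B, hB0, hB⟩ := hh.bounded
  refine ⟨measurable_const.sub (hh.measurable.comp measurable_neg), ⟨1 + B, by positivity,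
    fun x => (norm_sub_le _ _).trans (by simpa using hB (-x))⟩, fun x hx => ?_, fun x hx => ?_⟩
  · simp [hh.right (-x) (by linarith)]
  · simp [hh.left (-x) (by linarith)]

theorem integrableOn_cexp_Ioi {ξ : ℂ} (hξ : 0 < ξ.im) (a : ℝ) :
    IntegrableOn (fun s : ℝ => Complex.exp (Complex.I * s * ξ)) (Ioi a) := by
  refine (integrableOn_exp_mul_complex_Ioi (a := Complex.I * ξ) (by simpa using hξ) a).congr_fun
    (fun s _ => ?_) measurableSet_Ioi
  beta_reduce; congr 1; ring

theorem integrableOn_cexp_mul {ξ : ℂ} (hξ : 0 < ξ.im) {h : ℝ → ℂ} (hm : Measurable h) {B : ℝ}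
    (hB : ∀ x, ‖h x‖ ≤ B) (x : ℝ) :
    IntegrableOn (fun s : ℝ => Complex.exp (Complex.I * s * ξ) * h (x - s)) (Ioi 0) :=
  (integrableOn_cexp_Ioi hξ 0).mul_bdd
    (hm.comp (measurable_const.sub measurable_id)).aestronglyMeasurable
    (Eventually.of_forall fun _ => hB _)

theorem expDiff_one {ξ : ℂ} (hξ : 0 < ξ.im) (x : ℝ) : expDiff ξ (fun _ => 1) x = 0 := by
  have h0 : ξ ≠ 0 := by rintro rfl; simp at hξ
  have : expAvg ξ (fun _ => 1) x = ∫ s in Ioi (0 : ℝ), Complex.exp (Complex.I * ξ * s) := by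
    refine integral_congr_ae (Eventually.of_forall fun s => ?_)
    beta_reduce
    rw [mul_one]; congr 1; ring
  rw [expDiff, this, integral_exp_mul_complex_Ioi (by simpa using hξ)]
  simp only [Complex.ofReal_zero, mul_zero, Complex.exp_zero, mul_one]
  field_simp
  linear_combination Complex.I_sq

theorem expDiff_congr {ξ : ℂ} {h g : ℝ → ℂ} {x : ℝ} (e : ∀ y ≤ x, h y = g y) :
    expDiff ξ h x = expDiff ξ g x := by
  rw [expDiff, expDiff, e x le_rfl, expAvg, expAvg]
  congr 2
  refine setIntegral_congr_fun measurableSet_Ioi fun s hs => ?_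
  have hs : 0 < s := hs
  rw [e (x - s) (by linarith)]

theorem expDiff_sub {ξ : ℂ} {h g : ℝ → ℂ} {x : ℝ}
    (hh : IntegrableOn (fun s : ℝ => Complex.exp (Complex.I * s * ξ) * h (x - s)) (Ioi 0))
    (hg : IntegrableOn (fun s : ℝ => Complex.exp (Complex.I * s * ξ) * g (x - s)) (Ioi 0)) :
    expDiff ξ (fun y => h y - g y) x = expDiff ξ h x - expDiff ξ g x := by
  have : expAvg ξ (fun y => h y - g y) x = expAvg ξ h x - expAvg ξ g x := by
    rw [expAvg, expAvg, expAvg, ← integral_sub hh hg]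
    congr 1; ext s; ring
  rw [expDiff, expDiff, expDiff, this]; ring

theorem expDiff_const_mul {ξ : ℂ} (a : ℂ) (h : ℝ → ℂ) (x : ℝ) :
    expDiff ξ (fun y => a * h y) x = a * expDiff ξ h x := by
  have : expAvg ξ (fun y => a * h y) x = a * expAvg ξ h x := by
    rw [expAvg, expAvg, ← integral_const_mul]
    congr 1; ext s; ring
  rw [expDiff, expDiff, this]; ring

section cutoff

variable {ξ : ℂ} (hξ : 0 < ξ.im) {t : ℝ} {h : ℝ → ℂ} (hh : IsCutoff t h)
include hξ hh

theorem IsCutoff.expDiff_eq_zero {x : ℝ} (hx : x < -t) : expDiff ξ h x = 0 := by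
  rw [expDiff_congr (g := fun _ => 1) fun y hy => hh.left y (by linarith), expDiff_one hξ]

-- To the right of t the average already integrates over the whole region where h is nonzero, so x
-- enters only through exp(ixξ). Pairing with this tail evaluates the transform of an element of
-- L²(t,∞) at a point.
omit hξ in
theorem IsCutoff.expDiff_eq_exp {x : ℝ} (hx : t < x) :
    expDiff ξ h x = -ξ * fourier h (-ξ) * Complex.exp (Complex.I * x * ξ) := by
  have h1 : expAvg ξ h x = ∫ s : ℝ, Complex.exp (Complex.I * s * ξ) * h (x - s) := by
    refine setIntegral_eq_integral_of_forall_compl_eq_zero fun s hs => ?_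
    have hs : s ≤ 0 := by simpa using hs
    rw [hh.right _ (by linarith), mul_zero]
  have h2 : ∫ s : ℝ, Complex.exp (Complex.I * s * ξ) * h (x - s) =
      Complex.exp (Complex.I * x * ξ) * fourier h (-ξ) := by
    rw [← integral_sub_left_eq_self (fun s : ℝ => Complex.exp (Complex.I * s * ξ) * h (x - s))
      volume x, fourier, ← integral_const_mul]
    refine integral_congr_ae (Eventually.of_forall fun s => ?_)
    beta_reduce
    have : Complex.exp (Complex.I * ((x - s : ℝ) : ℂ) * ξ) =
        Complex.exp (Complex.I * x * ξ) * Complex.exp (Complex.I * s * -ξ) := by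
      rw [← Complex.exp_add]; congr 1; push_cast; ring
    rw [this, sub_sub_cancel]; ring
  rw [expDiff, h1, h2, hh.right x hx]; ring

theorem IsCutoff.exists_norm_expDiff_le : ∃ M, 0 ≤ M ∧ ∀ x,
    ‖expDiff ξ h x‖ ≤ M * (Ici (-t)).indicator (fun x => Real.exp (-(x * ξ.im))) x := by
  obtain ⟨B, hB0, hB⟩ := hh.bounded
  refine ⟨B * Real.exp (t * ξ.im) + ‖ξ‖ * (B * (Real.exp (t * ξ.im) / ξ.im)), by positivity,
    fun x => ?_⟩
  rcases lt_or_ge x (-t) with hx | hx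
  · rw [hh.expDiff_eq_zero hξ hx, indicator_of_notMem (by simpa using hx)]; simp
  rw [indicator_of_mem (mem_Ici.2 hx)]
  have h1 : ‖h x‖ ≤ B * Real.exp (t * ξ.im) * Real.exp (-(x * ξ.im)) := by
    rcases le_or_gt x t with hxt | hxt
    · refine (hB x).trans ?_
      rw [mul_assoc, ← Real.exp_add]
      refine le_mul_of_one_le_right hB0 (Real.one_le_exp ?_)
      nlinarith
    · rw [hh.right x hxt, norm_zero]; positivity
  have h2 : ‖expAvg ξ h x‖ ≤ B * (Real.exp (t * ξ.im) / ξ.im) * Real.exp (-(x * ξ.im)) := by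
    have e : ∫ s, (Ici (x - t)).indicator (fun s => B * Real.exp (-ξ.im * s)) s =
        B * (Real.exp (t * ξ.im) / ξ.im) * Real.exp (-(x * ξ.im)) := by
      rw [integral_indicator measurableSet_Ici, integral_const_mul, integral_Ici_eq_integral_Ioi,
        integral_exp_mul_Ioi (by linarith), neg_div_neg_eq]
      have : Real.exp (-ξ.im * (x - t)) = Real.exp (t * ξ.im) * Real.exp (-(x * ξ.im)) := by
        rw [← Real.exp_add]; congr 1; ring
      rw [this]; ring
    rw [← e, expAvg, ← integral_indicator measurableSet_Ioi]
    refine norm_integral_le_of_norm_le ?_ (Eventually.of_forall fun s => ?_)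
    · refine IntegrableOn.integrable_indicator ?_ measurableSet_Ici
      rw [integrableOn_Ici_iff_integrableOn_Ioi]
      exact (integrableOn_exp_mul_Ioi (by linarith) _).const_mul _
    · by_cases hs : s ∈ Ici (x - t)
      · rw [indicator_of_mem hs]
        refine (norm_indicator_le_norm_self _ _).trans ?_
        rw [norm_mul, norm_cexp_I_mul, mul_comm B]
        gcongr
        · linarith
        · exact hB _
      · rw [indicator_of_notMem hs]
        have hs : s < x - t := not_le.1 hs
        have : h (x - s) = 0 := hh.right _ (by linarith)
        refine (norm_indicator_le_norm_self _ _).trans ?_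
        rw [this]; simp
  calc ‖expDiff ξ h x‖ ≤ ‖h x‖ + ‖ξ‖ * ‖expAvg ξ h x‖ := by
        refine (norm_sub_le _ _).trans ?_
        rw [norm_mul, norm_mul, Complex.norm_I, one_mul]
    _ ≤ B * Real.exp (t * ξ.im) * Real.exp (-(x * ξ.im)) +
        ‖ξ‖ * (B * (Real.exp (t * ξ.im) / ξ.im) * Real.exp (-(x * ξ.im))) := by gcongr
    _ = _ := by ring

omit hξ in
theorem IsCutoff.stronglyMeasurable_expDiff : StronglyMeasurable (expDiff ξ h) := by
  have h1 : StronglyMeasurable fun p : ℝ × ℝ =>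
      Complex.exp (Complex.I * p.2 * ξ) * h (p.1 - p.2) := by
    refine Measurable.stronglyMeasurable ?_
    exact (by fun_prop : Continuous fun p : ℝ × ℝ => Complex.exp (Complex.I * p.2 * ξ)).measurable.mul
      (hh.measurable.comp (measurable_fst.sub measurable_snd))
  have h2 : StronglyMeasurable (expAvg ξ h) :=
    h1.integral_prod_right (ν := volume.restrict (Ioi 0))
  exact (hh.measurable.stronglyMeasurable.const_mul _).sub (h2.const_mul _)

theorem IsCutoff.memLp_expDiff : MemLp (expDiff ξ h) 2 volume := by
  obtain ⟨M, hM0, hM⟩ := hh.exists_norm_expDiff_le hξ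
  exact ((memLp_indicator_exp hξ (-t)).const_mul M).of_le
    (hh.stronglyMeasurable_expDiff).aestronglyMeasurable
    (Eventually.of_forall fun x => (hM x).trans (le_abs_self _))

end cutoff

/-- The Fourier integral of an exponential average. -/
theorem fourier_expAvg {ξ z : ℂ} {h : ℝ → ℂ} (hz : 0 < z.im + ξ.im)
    (hh : Integrable fun y : ℝ => h y * Complex.exp (Complex.I * y * z)) :
    (Integrable fun x : ℝ => expAvg ξ h x * Complex.exp (Complex.I * x * z)) ∧
    fourier (expAvg ξ h) z = Complex.I / (z + ξ) * fourier h z := by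
  have hne : z + ξ ≠ 0 := fun h0 => by
    have := congrArg Complex.im h0
    simp at this; linarith
  -- The average is the convolution of h with an exponential on the half-line, whose transform is
  -- i/(z+ξ).
  let m : ℝ → ℂ := (Ioi (0 : ℝ)).indicator fun s : ℝ => Complex.exp (Complex.I * s * (z + ξ))
  let k : ℝ → ℂ := fun u => h u * Complex.exp (Complex.I * u * z)
  have hm : Integrable m :=
    IntegrableOn.integrable_indicator (integrableOn_cexp_Ioi (by rwa [Complex.add_im]) 0) measurableSet_Ioi
  have hmi : ∫ s, m s = Complex.I / (z + ξ) := by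
    simp only [m]
    rw [integral_indicator measurableSet_Ioi, setIntegral_congr_fun (g := fun s : ℝ =>
      Complex.exp (Complex.I * (z + ξ) * s)) measurableSet_Ioi (fun s _ => by
        beta_reduce; congr 1; ring), integral_exp_mul_complex_Ioi (by simp; linarith)]
    simp only [Complex.ofReal_zero, mul_zero, Complex.exp_zero]
    field_simp
    linear_combination -Complex.I_sq
  have e : ∀ x, (m ⋆[ContinuousLinearMap.mul ℂ ℂ, volume] k) x =
      expAvg ξ h x * Complex.exp (Complex.I * x * z) := fun x => by
    rw [convolution_def, expAvg, ← integral_mul_const, ← integral_indicator measurableSet_Ioi]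
    refine integral_congr_ae (Eventually.of_forall fun s => ?_)
    simp only [m, k, ContinuousLinearMap.mul_apply']
    by_cases hs : s ∈ Ioi (0 : ℝ)
    · rw [indicator_of_mem hs, indicator_of_mem hs]
      have : Complex.exp (Complex.I * s * (z + ξ)) * Complex.exp (Complex.I * ((x - s : ℝ) : ℂ) * z) =
          Complex.exp (Complex.I * s * ξ) * Complex.exp (Complex.I * x * z) := by
        rw [← Complex.exp_add, ← Complex.exp_add]; congr 1; push_cast; ring
      linear_combination h (x - s) * this
    · rw [indicator_of_notMem hs, indicator_of_notMem hs, zero_mul]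
  refine ⟨(hm.integrable_convolution (ContinuousLinearMap.mul ℂ ℂ) hh).congr
    (Eventually.of_forall e), ?_⟩
  have h1 := integral_convolution (ContinuousLinearMap.mul ℂ ℂ) hm hh (μ := volume) (ν := volume)
  rw [integral_congr_ae (Eventually.of_forall e)] at h1
  rw [fourier, h1, ContinuousLinearMap.mul_apply', hmi]
  rfl

theorem fourier_expDiff {ξ z : ℂ} {h : ℝ → ℂ} (hz : 0 < z.im + ξ.im)
    (hh : Integrable fun y : ℝ => h y * Complex.exp (Complex.I * y * z)) :
    (Integrable fun x : ℝ => expDiff ξ h x * Complex.exp (Complex.I * x * z)) ∧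
    fourier (expDiff ξ h) z = Complex.I * z * fourier h z / (z + ξ) := by
  have hne : z + ξ ≠ 0 := fun h0 => by
    have := congrArg Complex.im h0
    simp at this; linarith
  obtain ⟨h1, h2⟩ := fourier_expAvg hz hh
  have e : (fun x : ℝ => expDiff ξ h x * Complex.exp (Complex.I * x * z)) = fun x : ℝ =>
      Complex.I * (h x * Complex.exp (Complex.I * x * z)) -
      ξ * (expAvg ξ h x * Complex.exp (Complex.I * x * z)) := by
    ext x; rw [expDiff]; ring
  refine ⟨by rw [e]; exact (hh.const_mul _).sub (h1.const_mul _), ?_⟩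
  have h3 : fourier (expDiff ξ h) z = Complex.I * fourier h z - ξ * fourier (expAvg ξ h) z := by
    rw [fourier, e, integral_sub (hh.const_mul _) (h1.const_mul _), integral_const_mul,
      integral_const_mul]
    rfl
  rw [h3, h2]
  field_simp
  ring

/-- Moving an exponential average to the other factor of a pairing. -/
theorem integral_mul_expDiff {ξ : ℂ} {k h : ℝ → ℂ}
    (hkh : Integrable fun y => k y * h y)
    (hi : Integrable (fun p : ℝ × ℝ => k p.1 * (Complex.exp (Complex.I * p.2 * ξ) * h (p.1 - p.2)))
      (volume.prod (volume.restrict (Ioi 0)))) :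
    (IntegrableOn (fun s : ℝ => Complex.exp (Complex.I * s * ξ) * ∫ y, k (y + s) * h y) (Ioi 0)) ∧
    ∫ y, k y * expDiff ξ h y = Complex.I * (∫ y, k y * h y) -
      ξ * ∫ s in Ioi (0 : ℝ), Complex.exp (Complex.I * s * ξ) * ∫ y, k (y + s) * h y := by
  -- The translation y ↦ y + s moves the shift from h to k; Fubini is then the whole argument.
  have e : ∀ s : ℝ, ∫ y, k y * (Complex.exp (Complex.I * s * ξ) * h (y - s)) =
      Complex.exp (Complex.I * s * ξ) * ∫ y, k (y + s) * h y := fun s => by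
    rw [← integral_const_mul, ← integral_add_right_eq_self _ s]
    congr 1; ext y
    rw [add_sub_cancel_right]; ring
  have e2 : ∀ y : ℝ, ∫ s in Ioi (0 : ℝ), k y * (Complex.exp (Complex.I * s * ξ) * h (y - s)) =
      k y * expAvg ξ h y := fun y => by rw [integral_const_mul]; rfl
  have h1 := integral_integral_swap (f := fun (y s : ℝ) =>
    k y * (Complex.exp (Complex.I * s * ξ) * h (y - s))) hi
  have h2 : IntegrableOn (fun s : ℝ => ∫ y, k y * (Complex.exp (Complex.I * s * ξ) * h (y - s)))
    (Ioi 0) := hi.integral_prod_right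
  have h3 : Integrable fun y : ℝ => ∫ s in Ioi (0 : ℝ),
    k y * (Complex.exp (Complex.I * s * ξ) * h (y - s)) := hi.integral_prod_left
  simp only [e, e2] at h1 h2 h3
  refine ⟨h2, ?_⟩
  have e3 : (fun y => k y * expDiff ξ h y) = fun y =>
      Complex.I * (k y * h y) - ξ * (k y * expAvg ξ h y) := by
    ext y; rw [expDiff]; ring
  rw [e3, integral_sub (hkh.const_mul _) (h3.const_mul _), integral_const_mul, integral_const_mul, h1]

/-! ### Resolvent elements of `L²(t, ∞)` -/

section resolvent

variable {K : ℝ → ℝ} {c : ℝ} {T : L2 →L[ℂ] L2} {Θ : ℂ → ℂ} (H : HankelSystem K c T Θ)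
  {t : ℝ} (ht : 0 ≤ t) {σ : ℝ} (hσ : |σ| = 1) {φ : ℝ → ℝ} (hφ : IsSol K t σ φ)
  {ξ : ℂ} (hξ : c < ξ.im)
include H hφ

theorem isCutoff_lowerPart (ht : 0 ≤ t) (hσ : |σ| = 1) : IsCutoff t (lowerPart t φ) := by
  obtain ⟨C, hC0, hC⟩ := H.growth
  obtain ⟨B, hB0, hB, -⟩ := hφ.exists_bound H.causal hσ H.c_pos hC0 hC
  refine ⟨(Complex.continuous_ofReal.comp hφ.1).measurable.indicator measurableSet_Iio,
    ⟨B, hB0, fun x => ?_⟩, fun x hx => ?_, fun x hx => ?_⟩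
  · by_cases hx : x ∈ Iio t
    · rw [lowerPart, indicator_of_mem hx, Complex.norm_real]
      exact hB x (le_of_lt hx)
    · rw [lowerPart, indicator_of_notMem hx, norm_zero]; exact hB0
  · rw [lowerPart, indicator_of_mem (mem_Iio.2 (by linarith)), hφ.eq_one H.causal hx.le]; simp
  · rw [lowerPart, indicator_of_notMem (by simpa using hx.le)]

theorem integrable_kernel_mul_lowerPart (x : ℝ) :
    Integrable fun y => (K (x + y) : ℂ) * lowerPart t φ y := by
  have h1 := integrableOn_kernel_mul H.cont H.causal
    (fun a => hφ.1.continuousOn.integrableOn_Icc (a := a) (b := t)) x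
  rw [← integrable_indicator_iff measurableSet_Iio] at h1
  refine h1.ofReal.congr (Eventually.of_forall fun y => ?_)
  by_cases hy : y ∈ Iio t
  · simp [lowerPart, indicator_of_mem hy]
  · simp [lowerPart, indicator_of_notMem hy]

omit H in
theorem upperPart_eq_sub (x : ℝ) : upperPart t φ x =
    1 - lowerPart t φ x - σ * hankel K (lowerPart t φ) x := by
  have h0 := isSol_complex hφ x
  have : (φ x : ℂ) = lowerPart t φ x + upperPart t φ x := by
    rcases lt_or_ge x t with h | h
    · rw [lowerPart, upperPart, indicator_of_mem (mem_Iio.2 h),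
        indicator_of_notMem (s := Ici t) (by simpa using h), add_zero]
    · rw [lowerPart, upperPart, indicator_of_notMem (s := Iio t) (by simpa using h),
        indicator_of_mem (mem_Ici.2 h), zero_add]
  linear_combination h0 - this

include ht hσ hξ

/-- For fixed x, causality and the cutoff confine y to the bounded interval [-t, x]. -/
theorem integrable_prod_left (x : ℝ) : Integrable (fun p : ℝ × ℝ => (K (x - p.1) : ℂ) *
    (Complex.exp (Complex.I * p.2 * ξ) * lowerPart t φ (-(p.1 - p.2))))
    (volume.prod (volume.restrict (Ioi 0))) := by
  obtain ⟨C, hC0, hC⟩ := H.growth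
  have hη : 0 < ξ.im := H.c_pos.trans hξ
  have hcut := isCutoff_lowerPart H hφ ht hσ
  obtain ⟨B, hB0, hB⟩ := hcut.bounded
  have i1 : Integrable ((Icc (-t) x).indicator fun y => C * B * Real.exp (c * (x - y))) :=
    (by fun_prop : Continuous fun y => C * B * Real.exp (c * (x - y))).continuousOn.integrableOn_Icc
      |>.integrable_indicator measurableSet_Icc
  have i2 : IntegrableOn (fun s : ℝ => Real.exp (-ξ.im * s)) (Ioi 0) :=
    integrableOn_exp_mul_Ioi (by linarith) 0
  refine (i1.mul_prod i2).mono' ?_ ?_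
  · refine Measurable.aestronglyMeasurable ?_
    exact ((by have := H.cont; fun_prop : Continuous fun p : ℝ × ℝ => (K (x - p.1) : ℂ)).measurable).mul
      ((by fun_prop : Continuous fun p : ℝ × ℝ => Complex.exp (Complex.I * p.2 * ξ)).measurable.mul
      (hcut.measurable.comp (measurable_fst.sub measurable_snd).neg))
  · have : ∀ᵐ p : ℝ × ℝ ∂(volume.prod (volume.restrict (Ioi 0))), p.2 ∈ Ioi (0 : ℝ) :=
      Measure.quasiMeasurePreserving_snd.ae (ae_restrict_mem measurableSet_Ioi)
    filter_upwards [this] with p hp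
    have hp : 0 < p.2 := hp
    by_cases hy : p.1 ∈ Icc (-t) x
    · rw [indicator_of_mem hy, norm_mul, norm_mul, norm_cexp_I_mul, Complex.norm_real]
      have h1 : |K (x - p.1)| ≤ C * Real.exp (c * (x - p.1)) := (hC _).trans (by
        gcongr; exact indicator_le_self' (fun _ _ => Real.exp_nonneg _) _)
      calc |K (x - p.1)| * (Real.exp (-(p.2 * ξ.im)) * ‖lowerPart t φ (-(p.1 - p.2))‖)
          ≤ (C * Real.exp (c * (x - p.1))) * (Real.exp (-(p.2 * ξ.im)) * B) := by
            gcongr; exact hB _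
        _ = _ := by rw [show -ξ.im * p.2 = -(p.2 * ξ.im) by ring]; ring
    · rw [indicator_of_notMem hy, zero_mul]
      rcases lt_or_ge x p.1 with h | h
      · rw [H.causal (x - p.1) (by linarith)]; simp
      · rw [hcut.right (-(p.1 - p.2)) (by
          by_contra! hcon
          exact hy ⟨by linarith, h⟩)]; simp

theorem integrable_prod_right (x : ℝ) : Integrable (fun p : ℝ × ℝ => (K (x + p.1) : ℂ) *
    (Complex.exp (Complex.I * p.2 * ξ) * lowerPart t φ (p.1 - p.2)))
    (volume.prod (volume.restrict (Ioi 0))) := by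
  obtain ⟨C, hC0, hC⟩ := H.growth
  have hc := H.c_pos
  have hη : 0 < ξ.im := hc.trans hξ
  have hcut := isCutoff_lowerPart H hφ ht hσ
  obtain ⟨B, hB0, hB⟩ := hcut.bounded
  -- Here y is unbounded above. On the support y - s ≤ t, so half of the surplus of Im ξ over c can
  -- be spent on decay in y and the other half on decay in s.
  let δ := (ξ.im - c) / 2
  have hδ : 0 < δ := by simp only [δ]; linarith
  have hηδ : ξ.im = c + δ + δ := by simp only [δ]; ring
  have i1 : IntegrableOn (fun y : ℝ => Real.exp (-δ * y)) (Ici (-x)) := by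
    rw [integrableOn_Ici_iff_integrableOn_Ioi]; exact integrableOn_exp_mul_Ioi (by linarith) _
  have i1' := IntegrableOn.integrable_indicator
    (i1.const_mul (C * B * Real.exp (c * x + (c + δ) * t))) measurableSet_Ici
  have i2 : IntegrableOn (fun s : ℝ => Real.exp (-δ * s)) (Ioi 0) :=
    integrableOn_exp_mul_Ioi (by linarith) 0
  refine (i1'.mul_prod i2).mono' ?_ ?_
  · refine Measurable.aestronglyMeasurable ?_
    exact ((by have := H.cont; fun_prop : Continuous fun p : ℝ × ℝ => (K (x + p.1) : ℂ)).measurable).mul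
      ((by fun_prop : Continuous fun p : ℝ × ℝ => Complex.exp (Complex.I * p.2 * ξ)).measurable.mul
      (hcut.measurable.comp (measurable_fst.sub measurable_snd)))
  · have : ∀ᵐ p : ℝ × ℝ ∂(volume.prod (volume.restrict (Ioi 0))), p.2 ∈ Ioi (0 : ℝ) :=
      Measure.quasiMeasurePreserving_snd.ae (ae_restrict_mem measurableSet_Ioi)
    filter_upwards [this] with p hp
    have hp : 0 < p.2 := hp
    by_cases hy : p.1 ∈ Ici (-x)
    · rw [indicator_of_mem hy, norm_mul, norm_mul, norm_cexp_I_mul, Complex.norm_real]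
      rcases lt_or_ge t (p.1 - p.2) with h | h
      · rw [hcut.right _ h, norm_zero, mul_zero, mul_zero]; positivity
      have h1 : |K (x + p.1)| ≤ C * Real.exp (c * (x + p.1)) := (hC _).trans (by
        gcongr; exact indicator_le_self' (fun _ _ => Real.exp_nonneg _) _)
      calc |K (x + p.1)| * (Real.exp (-(p.2 * ξ.im)) * ‖lowerPart t φ (p.1 - p.2)‖)
          ≤ (C * Real.exp (c * (x + p.1))) * (Real.exp (-(p.2 * ξ.im)) * B) := by
            gcongr; exact hB _
        _ = C * B * Real.exp (c * (x + p.1) + -(p.2 * ξ.im)) := by rw [Real.exp_add]; ring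
        _ ≤ C * B * Real.exp ((c * x + (c + δ) * t) + -δ * p.1 + -δ * p.2) := by
            refine mul_le_mul_of_nonneg_left (Real.exp_le_exp.2 ?_) (by positivity)
            rw [hηδ]
            nlinarith
        _ = _ := by rw [Real.exp_add, Real.exp_add]; ring
    · rw [indicator_of_notMem hy, zero_mul]
      have hy : p.1 < -x := not_le.1 hy
      rw [H.causal (x + p.1) (by linarith)]; simp

/-- The kernel depends on x + y only, so a Hankel operator turns a translation of its argument into
the opposite translation of its value: averaging commutes with it up to reflection. The next lemma
is the mirror image. -/
theorem hankel_expDiff_reflect (x : ℝ) :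
    IntegrableOn (fun s : ℝ => Complex.exp (Complex.I * s * ξ) *
      hankel K (lowerPart t φ) (x - s)) (Ioi 0) ∧
    hankel K (fun y => expDiff ξ (fun y => lowerPart t φ (-y)) (-y)) x =
      expDiff ξ (hankel K (lowerPart t φ)) x := by
  have hneg : ∀ x : ℝ, ∫ y, (K (x - y) : ℂ) * lowerPart t φ (-y) = hankel K (lowerPart t φ) x :=
    fun x => by
      rw [hankel, ← integral_neg_eq_self]
      refine integral_congr_ae (Eventually.of_forall fun y => ?_)
      beta_reduce
      rw [sub_neg_eq_add, neg_neg]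
  have hi : Integrable fun y => (K (x - y) : ℂ) * lowerPart t φ (-y) := by
    have := (integrable_kernel_mul_lowerPart H hφ x).comp_neg
    simpa only [sub_eq_add_neg] using this
  obtain ⟨h1, h2⟩ := integral_mul_expDiff (k := fun y => (K (x - y) : ℂ))
    (h := fun y => lowerPart t φ (-y)) hi (integrable_prod_left H ht hσ hφ hξ x)
  have e : ∀ s : ℝ, ∫ y, (K (x - (y + s)) : ℂ) * lowerPart t φ (-y) =
      hankel K (lowerPart t φ) (x - s) := fun s => by
    rw [← hneg]
    refine integral_congr_ae (Eventually.of_forall fun y => ?_)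
    beta_reduce
    rw [show x - (y + s) = x - s - y by ring]
  simp only [e, hneg] at h1 h2
  refine ⟨h1, ?_⟩
  rw [hankel, ← integral_neg_eq_self]
  simp only [neg_neg, ← sub_eq_add_neg]
  exact h2

theorem hankel_expDiff (x : ℝ) :
    IntegrableOn (fun s : ℝ => Complex.exp (Complex.I * s * ξ) *
      hankel K (lowerPart t φ) (-(-x - s))) (Ioi 0) ∧
    hankel K (expDiff ξ (lowerPart t φ)) x =
      expDiff ξ (fun y => hankel K (lowerPart t φ) (-y)) (-x) := by
  obtain ⟨h1, h2⟩ := integral_mul_expDiff (k := fun y => (K (x + y) : ℂ))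
    (h := lowerPart t φ) (integrable_kernel_mul_lowerPart H hφ x)
    (integrable_prod_right H ht hσ hφ hξ x)
  have e : ∀ s : ℝ, ∫ y, (K (x + (y + s)) : ℂ) * lowerPart t φ y =
      hankel K (lowerPart t φ) (-(-x - s)) := fun s => by
    rw [hankel]
    refine integral_congr_ae (Eventually.of_forall fun y => ?_)
    beta_reduce
    rw [show x + (y + s) = -(-x - s) + y by ring]
  simp only [e] at h1 h2
  refine ⟨h1, ?_⟩
  rw [hankel, h2, expDiff, expAvg, neg_neg]
  rfl

/-- `expDiff χ + σ K (reflected expDiff χ)` vanishes to the left of `t`. -/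
theorem expDiff_add_eq_zero {x : ℝ} (hx : x < t) : expDiff ξ (lowerPart t φ) x +
    σ * hankel K (fun y => expDiff ξ (fun y => lowerPart t φ (-y)) (-y)) x = 0 := by
  have hη : 0 < ξ.im := H.c_pos.trans hξ
  have hcut := isCutoff_lowerPart H hφ ht hσ
  obtain ⟨B, hB0, hB⟩ := hcut.bounded
  obtain ⟨h1, h2⟩ := hankel_expDiff_reflect H ht hσ hφ hξ x
  have i1 := integrableOn_cexp_mul (h := fun _ => (1 : ℂ)) hη measurable_const (B := 1)
    (by simp) x
  have i2 := integrableOn_cexp_mul hη hcut.measurable hB x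
  have i3 : IntegrableOn (fun s : ℝ => Complex.exp (Complex.I * s * ξ) *
      (σ * hankel K (lowerPart t φ) (x - s))) (Ioi 0) := by
    refine (h1.const_mul (σ : ℂ)).congr (Eventually.of_forall fun s => ?_)
    beta_reduce; ring
  -- `expDiff` looks only to the left, and the upper part vanishes there. Writing the upper part
  -- through the integral equation turns this into the claim.
  have e : expDiff ξ (upperPart t φ) x = 0 := by
    have e0 : expDiff ξ (upperPart t φ) x = expDiff ξ (fun _ => 0) x :=
      expDiff_congr fun y hy => indicator_of_notMem (not_le.2 (hy.trans_lt hx)) _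
    rw [e0]
    simp [expDiff, expAvg]
  have e2 : upperPart t φ = fun x => 1 - lowerPart t φ x - σ * hankel K (lowerPart t φ) x :=
    funext fun x => upperPart_eq_sub hφ x
  have i12 : IntegrableOn (fun s : ℝ => Complex.exp (Complex.I * s * ξ) *
      (1 - lowerPart t φ (x - s))) (Ioi 0) := by
    refine (i1.sub i2).congr (Eventually.of_forall fun s => ?_)
    simp only [Pi.sub_apply]; ring
  have e3 := expDiff_sub (ξ := ξ) (h := fun y => 1 - lowerPart t φ y)
    (g := fun y => σ * hankel K (lowerPart t φ) y) (x := x) i12 i3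
  have e4 := expDiff_sub (ξ := ξ) (h := fun _ => 1) (g := lowerPart t φ) (x := x) i1 i2
  have e5 := expDiff_const_mul (ξ := ξ) (σ : ℂ) (hankel K (lowerPart t φ)) x
  rw [e4, e5, expDiff_one hη] at e3
  rw [e2, e3] at e
  rw [h2]
  linear_combination -e

/-- Unlike in `expDiff_add_eq_zero`, the reflected average runs over all of [t,∞). Instead of zero
it produces the transform of the upper part at ξ, which `fourier_upperPart` evaluates. -/
theorem hankel_add_expDiff {x : ℝ} (hx : x < t) : hankel K (expDiff ξ (lowerPart t φ)) x +
    σ * expDiff ξ (fun y => lowerPart t φ (-y)) (-x) =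
    σ * Complex.I * (entirePart t φ ξ - σ * Θ ξ * entirePart t φ (-ξ)) *
      Complex.exp (-Complex.I * x * ξ) := by
  have hη : 0 < ξ.im := H.c_pos.trans hξ
  have hcut := isCutoff_lowerPart H hφ ht hσ
  obtain ⟨B, hB0, hB⟩ := hcut.bounded
  obtain ⟨h1, h2⟩ := hankel_expDiff H ht hσ hφ hξ x
  have hσ2 : (σ : ℂ) * σ = 1 := by
    have : σ * σ = 1 := by rw [← abs_mul_abs_self, hσ, one_mul]
    exact_mod_cast this
  have i1 := integrableOn_cexp_mul (h := fun _ => (1 : ℂ)) hη measurable_const (B := 1)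
    (by simp) (-x)
  have i2 := integrableOn_cexp_mul (h := fun y => lowerPart t φ (-y)) hη
    (hcut.measurable.comp measurable_neg) (fun y => hB (-y)) (-x)
  have i3 : IntegrableOn (fun s : ℝ => Complex.exp (Complex.I * s * ξ) *
      (σ * hankel K (lowerPart t φ) (-(-x - s)))) (Ioi 0) := by
    refine (h1.const_mul (σ : ℂ)).congr (Eventually.of_forall fun s => ?_)
    beta_reduce; ring
  have i12 : IntegrableOn (fun s : ℝ => Complex.exp (Complex.I * s * ξ) *
      (1 - lowerPart t φ (-(-x - s)))) (Ioi 0) := by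
    refine (i1.sub i2).congr (Eventually.of_forall fun s => ?_)
    simp only [Pi.sub_apply]; ring
  have e : expDiff ξ (fun y => upperPart t φ (-y)) (-x) =
      -(Complex.I * (entirePart t φ ξ - σ * Θ ξ * entirePart t φ (-ξ)) *
        Complex.exp (-Complex.I * x * ξ)) := by
    have a1 : expAvg ξ (fun y => upperPart t φ (-y)) (-x) =
        ∫ s : ℝ, Complex.exp (Complex.I * s * ξ) * upperPart t φ (x + s) := by
      rw [expAvg]
      simp only [neg_sub, sub_neg_eq_add, add_comm _ x]
      refine setIntegral_eq_integral_of_forall_compl_eq_zero fun s hs => ?_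
      have hs : s ≤ 0 := by simpa using hs
      rw [upperPart, indicator_of_notMem (s := Ici t)
        (show ¬ t ≤ x + s from not_le.2 (by linarith)), mul_zero]
    have a2 : ∫ s : ℝ, Complex.exp (Complex.I * s * ξ) * upperPart t φ (x + s) =
        Complex.exp (-Complex.I * x * ξ) * fourier (upperPart t φ) ξ := by
      rw [fourier, ← integral_const_mul, ← integral_add_left_eq_self (fun y : ℝ =>
        Complex.exp (-Complex.I * x * ξ) * (upperPart t φ y * Complex.exp (Complex.I * y * ξ))) x]
      refine integral_congr_ae (Eventually.of_forall fun s => ?_)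
      beta_reduce
      have : Complex.exp (Complex.I * s * ξ) = Complex.exp (-Complex.I * x * ξ) *
          Complex.exp (Complex.I * ((x + s : ℝ) : ℂ) * ξ) := by
        rw [← Complex.exp_add]; congr 1; push_cast; ring
      rw [this]; ring
    have a3 : upperPart t φ x = 0 := indicator_of_notMem (not_le.2 hx) _
    rw [expDiff, a1, a2, neg_neg, a3, mul_zero, zero_sub, ← fourier_upperPart H ht hφ hξ]
    linear_combination (-ξ * fourier (upperPart t φ) ξ * Complex.exp (-Complex.I * x * ξ)) *
      Complex.I_sq
  have e2 : (fun y => upperPart t φ (-y)) = fun y => 1 - lowerPart t φ (-y) -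
      σ * hankel K (lowerPart t φ) (-y) := funext fun x => upperPart_eq_sub hφ (-x)
  have e3 := expDiff_sub (ξ := ξ) (h := fun y => 1 - lowerPart t φ (-y))
    (g := fun y => σ * hankel K (lowerPart t φ) (-y)) (x := -x) i12 i3
  have e4 := expDiff_sub (ξ := ξ) (h := fun _ => 1) (g := fun y => lowerPart t φ (-y)) (x := -x) i1 i2
  have e5 := expDiff_const_mul (ξ := ξ) (σ : ℂ) (fun y => hankel K (lowerPart t φ) (-y)) (-x)
  rw [e4, e5, expDiff_one hη] at e3
  rw [e2, e3] at e
  rw [h2]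
  linear_combination (-(σ : ℂ)) * e -
    (expDiff ξ (fun y => hankel K (lowerPart t φ) (-y)) (-x)) * hσ2

-- The lower part has a transform only in the lower half-plane. Since `expDiff` kills constants it
-- may be replaced by 1 minus itself, whose transform exists in the upper half-plane.
omit ht hσ hξ in
theorem fourier_one_sub_lowerPart (ht : 0 ≤ t) {z : ℂ} (hz : z ∈ upperHalf) :
    (Integrable fun x : ℝ => (1 - lowerPart t φ x) * Complex.exp (Complex.I * x * z)) ∧
    -Complex.I * z * fourier (fun x => 1 - lowerPart t φ x) z = entirePart t φ z := by
  have i1 := integrable_indicator_Ici_cexp hz (-t)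
  have i2 := integrable_middlePart_mul_cexp (t := t) hφ.1 z
  have e : ∀ x : ℝ, (1 - lowerPart t φ x) * Complex.exp (Complex.I * x * z) =
      (Ici (-t)).indicator (fun _ => (1 : ℂ)) x * Complex.exp (Complex.I * x * z) -
      middlePart t φ x * Complex.exp (Complex.I * x * z) := fun x => by
    have h1 : (Iio (-t)).indicator (fun _ => (1 : ℂ)) x + (Ici (-t)).indicator (fun _ => (1 : ℂ)) x
        = 1 := by
      rcases lt_or_ge x (-t) with h | h
      · rw [indicator_of_mem (mem_Iio.2 h), indicator_of_notMem (s := Ici (-t)) (not_le.2 h),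
          add_zero]
      · rw [indicator_of_mem (mem_Ici.2 h), indicator_of_notMem (s := Iio (-t)) (not_lt.2 h),
          zero_add]
    rw [lowerPart_eq H ht hφ]
    linear_combination -Complex.exp (Complex.I * x * z) * h1
  refine ⟨(i1.sub i2).congr (Eventually.of_forall fun x => (e x).symm), ?_⟩
  have h1 := fourier_indicator_Ici hz (-t)
  have h2 : fourier (fun x => 1 - lowerPart t φ x) z =
      fourier ((Ici (-t)).indicator fun _ => (1 : ℂ)) z - fourier (middlePart t φ) z := by
    rw [fourier, fourier, fourier, ← integral_sub i1 i2]
    exact integral_congr_ae (Eventually.of_forall e)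
  have h5 : Complex.exp (-Complex.I * t * z) = Complex.exp (Complex.I * (-t : ℝ) * z) := by
    congr 1; push_cast; ring
  rw [h2, entirePart, h5, ← h1]; ring

/-- An element of `L²(t, ∞)` whose Fourier integral has a simple pole at `-ξ`. -/
theorem exists_resolvent : ∃ r : L2, (∀ᵐ x, x < t → r x = 0) ∧
    (∀ᵐ x : ℝ, x < t → T r x = σ * Complex.I *
      (entirePart t φ ξ - σ * Θ ξ * entirePart t φ (-ξ)) * Complex.exp (-Complex.I * x * ξ)) ∧
    (∀ z ∈ upperHalf, fourier r z =
      (entirePart t φ z - σ * Θ z * entirePart t φ (-z)) / (z + ξ)) ∧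
    ∀ g ∈ spaceV T t, inner ℂ r g = (starRingEnd ℂ) (-Complex.I * entirePart t φ (-ξ)) *
      fourier g (-(starRingEnd ℂ) ξ) := by
  obtain ⟨C, hC0, hC⟩ := H.growth
  have hc := H.c_pos
  have hη : 0 < ξ.im := hc.trans hξ
  have hcut := isCutoff_lowerPart H hφ ht hσ
  have hcut' := hcut.reflect
  obtain ⟨B, hB0, hB⟩ := hcut.bounded
  -- Both are images of the truncated solution: u averages to the left, while v averages the
  -- reflected solution and is reflected back, so that v lives on (-∞,t].
  let u := expDiff ξ (lowerPart t φ)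
  let v : ℝ → ℂ := fun y => expDiff ξ (fun y => lowerPart t φ (-y)) (-y)
  have i1 := integrableOn_cexp_mul (h := fun _ => (1 : ℂ)) hη measurable_const (B := 1)
    (by simp)
  have i2 := integrableOn_cexp_mul hη hcut.measurable hB
  have i3 := integrableOn_cexp_mul (h := fun y => lowerPart t φ (-y)) hη
    (hcut.measurable.comp measurable_neg) (fun y => hB (-y))
  have hv : ∀ x, v x = -expDiff ξ (fun x => 1 - lowerPart t φ (-x)) (-x) := fun x => by
    have := expDiff_sub (ξ := ξ) (h := fun _ => 1) (g := fun y => lowerPart t φ (-y)) (x := -x)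
      (i1 0) (i3 _)
    rw [this, expDiff_one hη, zero_sub, neg_neg]
  have hu : ∀ x, u x = -expDiff ξ (fun x => 1 - lowerPart t φ x) x := fun x => by
    have := expDiff_sub (ξ := ξ) (h := fun _ => 1) (g := lowerPart t φ) (x := x) (i1 0) (i2 _)
    rw [this, expDiff_one hη, zero_sub, neg_neg]
  have hum : MemLp u 2 volume := hcut.memLp_expDiff hη
  have hvm : MemLp v 2 volume := by
    have := ((hcut'.memLp_expDiff hη).comp_measurePreserving
      (Measure.measurePreserving_neg (volume : Measure ℝ))).neg
    refine this.congr_norm ?_ (Eventually.of_forall fun x => ?_)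
    · exact this.1.congr (Eventually.of_forall fun x => (hv x).symm)
    · rw [hv]; rfl
  have hv0 : ∀ x, t < x → v x = 0 := fun x hx => by
    rw [hv, hcut'.expDiff_eq_zero hη (by linarith), neg_zero]
  let U : L2 := hum.toLp u
  let V : L2 := hvm.toLp v
  have hU : U =ᵐ[volume] u := hum.coeFn_toLp
  have hV : V =ᵐ[volume] v := hvm.coeFn_toLp
  have hV0 : ∀ᵐ x, t ≤ x → V x = 0 := by
    filter_upwards [hV, (finite_singleton t).countable.ae_notMem volume] with x h1 h2 h3
    rw [h1, hv0 x (lt_of_le_of_ne h3 (Ne.symm h2))]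
  have hhank : ∀ {f : L2} {g : ℝ → ℂ}, f =ᵐ[volume] g → hankel K f = hankel K g := fun h => by
    ext x
    refine integral_congr_ae ?_
    filter_upwards [h] with y hy
    rw [hy]
  have hTV : T V =ᵐ[volume] hankel K v := by
    rw [← hhank hV]
    exact H.apply V (integrable_kernel_mul H.cont H.causal hV0)
  -- U has no bounded support on the right, but it decays like exp(-y Im ξ); since Im ξ > c, the
  -- Hankel integral still converges.
  have hTU : T U =ᵐ[volume] hankel K u := by
    rw [← hhank hU]
    refine H.apply U fun x => ?_
    obtain ⟨M, hM0, hM⟩ := hcut.exists_norm_expDiff_le hη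
    have j1 := (integrable_indicator_exp_mul hξ (-t)).const_mul (C * Real.exp (c * x) * M)
    refine j1.mono' ((Complex.continuous_ofReal.comp (H.cont.comp (by fun_prop :
      Continuous fun y => x + y))).aestronglyMeasurable.mul (Lp.memLp U).1) ?_
    filter_upwards [hU] with y hy
    rw [hy, norm_mul, Complex.norm_real]
    have h1 : |K (x + y)| ≤ C * Real.exp (c * (x + y)) := (hC _).trans (by
        gcongr; exact indicator_le_self' (fun _ _ => Real.exp_nonneg _) _)
    calc |K (x + y)| * ‖u y‖ ≤ (C * Real.exp (c * (x + y))) *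
          (M * (Ici (-t)).indicator (fun x => Real.exp (-(x * ξ.im))) y) := by
            gcongr; exact hM y
      _ = _ := by
        rw [mul_add, Real.exp_add]
        by_cases hy : y ∈ Ici (-t)
        · rw [indicator_of_mem hy, indicator_of_mem hy]; ring
        · rw [indicator_of_notMem hy, indicator_of_notMem hy]; ring
  -- The combination u + σTv is the averaged form of the integral equation, hence zero to the left
  -- of t; the involution makes its image under T equal to Tu + σv.
  refine ⟨U + (σ : ℂ) • T V, ?_, ?_, fun z hz => ?_, fun g hg => ?_⟩
  · filter_upwards [Lp.coeFn_add U ((σ : ℂ) • T V), Lp.coeFn_smul (σ : ℂ) (T V), hTV, hU] with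
      x e1 e2 e3 e4 hx
    rw [e1, Pi.add_apply, e2, Pi.smul_apply, e3, e4, smul_eq_mul]
    exact expDiff_add_eq_zero H ht hσ hφ hξ hx
  · have e0 : T (U + (σ : ℂ) • T V) = T U + (σ : ℂ) • V := by
      rw [map_add, map_smul, H.invol]
    rw [e0]
    filter_upwards [Lp.coeFn_add (T U) ((σ : ℂ) • V), Lp.coeFn_smul (σ : ℂ) V, hTU, hV] with
      x e1 e2 e3 e4 hx
    rw [e1, Pi.add_apply, e2, Pi.smul_apply, e3, e4, smul_eq_mul]
    exact hankel_add_expDiff H ht hσ hφ hξ hx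
  · have hz0 : 0 < z.im := hz
    obtain ⟨a1, a2⟩ := fourier_one_sub_lowerPart H hφ ht hz
    obtain ⟨a3, a4⟩ := fourier_expDiff (ξ := ξ) (by linarith) a1
    have b1 : Integrable fun x : ℝ => lowerPart t φ (-x) * Complex.exp (Complex.I * x * z) := by
      have := (integrable_lowerPart_mul_cexp H ht hφ (z := -z) (by simpa using hz0)).comp_neg
      simpa using this
    obtain ⟨-, b3⟩ := fourier_expDiff (ξ := ξ) (by linarith) b1
    have b4 : fourier (fun x => lowerPart t φ (-x)) z = fourier (lowerPart t φ) (-z) := by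
      rw [fourier, fourier, ← integral_neg_eq_self]
      simp
    have b5 : fourier V (-z) = fourier (expDiff ξ fun x => lowerPart t φ (-x)) z := by
      rw [fourier_congr_ae hV, fourier, fourier, ← integral_neg_eq_self]
      simp [v]
    have b6 := fourier_lowerPart H ht hφ (z := -z) (by simpa using hz0)
    have f1 : fourier U z = entirePart t φ z / (z + ξ) := by
      rw [fourier_congr_ae hU]
      have : fourier u z = -fourier (expDiff ξ fun x => 1 - lowerPart t φ x) z := by
        rw [fourier, fourier, ← integral_neg]
        refine integral_congr_ae (Eventually.of_forall fun x => ?_)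
        beta_reduce
        rw [hu, neg_mul]
      rw [this, a4, ← a2]; ring
    have f2 : fourier (T V) z = Θ z * (-entirePart t φ (-z) / (z + ξ)) := by
      rw [H.fourier_apply V t hV0 z hz, b5, b3, b4, ← b6]; ring
    have s1 : Integrable fun x : ℝ => U x * Complex.exp (Complex.I * x * z) := by
      refine a3.neg.congr ?_
      filter_upwards [hU] with x hx
      rw [hx, hu, neg_mul]; rfl
    have s2 : Integrable fun x : ℝ => T V x * Complex.exp (Complex.I * x * z) := by
      refine (integrable_mul_cexp_iff (Lp.memLp (T V)).1 z).2
        (integrable_norm_mul_exp (Lp.memLp (T V)) (s := -t) ?_ hz0)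
      filter_upwards [hTV] with x hx h
      rw [hx, ← hhank hV, hankel_eq_zero H.causal hV0 h]
    have f3 : fourier ((U + (σ : ℂ) • T V : L2) : ℝ → ℂ) z =
        fourier U z + σ * fourier (T V) z := by
      rw [fourier, fourier, fourier, ← integral_const_mul, ← integral_add s1 (s2.const_mul _)]
      refine integral_congr_ae ?_
      filter_upwards [Lp.coeFn_add U ((σ : ℂ) • T V), Lp.coeFn_smul (σ : ℂ) (T V)] with x e1 e2
      rw [e1, Pi.add_apply, e2, Pi.smul_apply, smul_eq_mul]; ring
    rw [f3, f1, f2]; ring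
  -- Moving T across the inner product pairs V, which lives on (-∞,t], with g' in L²(t,∞), giving
  -- zero. Only the exponential tail of U contributes.
  · obtain ⟨hg1, g', hg', rfl⟩ := hg
    have hz1 : (-ξ).im < 0 := by simpa using hη
    rw [inner_add_left, inner_smul_left,
      show inner ℂ (T V) (T g') = inner ℂ V (T (T g')) from H.symm V (T g'), H.invol]
    have e1 : inner ℂ V g' = 0 := by
      rw [inner_L2_eq]
      refine integral_eq_zero_of_ae ?_
      filter_upwards [hg', hV0] with x h1 h2
      rcases lt_or_ge x t with h | h
      · rw [h1 h]; simp
      · rw [h2 h]; simp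
    rw [e1, mul_zero, add_zero, inner_L2_eq, fourier, ← integral_const_mul]
    refine integral_congr_ae ?_
    filter_upwards [hg1, hU, (finite_singleton t).countable.ae_notMem volume] with x h1 h2 h3
    rcases lt_or_ge x t with h | h
    · rw [h1 h]; simp
    · have h' : t < x := lt_of_le_of_ne h (Ne.symm h3)
      have e3 := fourier_lowerPart H ht hφ hz1
      have e4 : -Complex.I * entirePart t φ (-ξ) = -ξ * fourier (lowerPart t φ) (-ξ) := by
        rw [← e3]; linear_combination (ξ * fourier (lowerPart t φ) (-ξ)) * Complex.I_sq
      rw [h2]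
      simp only [u]
      rw [hcut.expDiff_eq_exp h', e4, map_mul (starRingEnd ℂ) (_ * _), ← Complex.exp_conj]
      have : (starRingEnd ℂ) (Complex.I * x * ξ) = Complex.I * x * (-(starRingEnd ℂ) ξ) := by
        simp
      rw [this]; ring

end resolvent

/-! ### The spaces `V_t` as closed submodules -/

/-- `L²(t, ∞)` as a submodule. -/
noncomputable def aboveSubmodule (t : ℝ) : Submodule ℂ L2 :=
  (LpToLpRestrictCLM ℝ ℂ ℂ volume 2 (Iio t)).ker

theorem mem_aboveSubmodule {t : ℝ} {f : L2} : f ∈ aboveSubmodule t ↔ f ∈ L2Above t := by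
  have h := LpToLpRestrictCLM_coeFn ℂ (Iio t) f
  have hiff : (∀ᵐ x : ℝ, x < t → f x = 0) ↔ ∀ᵐ x ∂volume.restrict (Iio t), f x = 0 :=
    (ae_restrict_iff' measurableSet_Iio).symm
  rw [aboveSubmodule, LinearMap.mem_ker, L2Above, mem_ofPred_eq, hiff]
  constructor
  · intro h0
    have h1 : LpToLpRestrictCLM ℝ ℂ ℂ volume 2 (Iio t) f =ᵐ[volume.restrict (Iio t)] 0 := by
      rw [show LpToLpRestrictCLM ℝ ℂ ℂ volume 2 (Iio t) f = 0 from h0]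
      exact Lp.coeFn_zero ℂ 2 _
    filter_upwards [h, h1] with x h2 h3
    rw [← h2, h3]; rfl
  · intro h0
    refine (Lp.eq_zero_iff_ae_eq_zero).2 ?_
    filter_upwards [h, h0] with x h2 h3
    exact h2.trans h3

theorem isClosed_aboveSubmodule (t : ℝ) : IsClosed (aboveSubmodule t : Set L2) :=
  ContinuousLinearMap.isClosed_ker _

/-- `V_t` as a submodule. -/
noncomputable def spaceVSubmodule (T : L2 →L[ℂ] L2) (t : ℝ) : Submodule ℂ L2 :=
  aboveSubmodule t ⊓ (aboveSubmodule t).comap T.toLinearMap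

theorem isClosed_spaceVSubmodule (T : L2 →L[ℂ] L2) (t : ℝ) :
    IsClosed (spaceVSubmodule T t : Set L2) :=
  (isClosed_aboveSubmodule t).inter ((isClosed_aboveSubmodule t).preimage T.continuous)

instance (T : L2 →L[ℂ] L2) (t : ℝ) : CompleteSpace (spaceVSubmodule T t) :=
  (isClosed_spaceVSubmodule T t).completeSpace_coe

/-- As T is an involution, lying in the image of L²(t,∞) means that Tf itself lies in L²(t,∞); this
condition is visibly closed and linear. -/
theorem mem_spaceVSubmodule {T : L2 →L[ℂ] L2} (hT : ∀ f, T (T f) = f) {t : ℝ} {f : L2} :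
    f ∈ spaceVSubmodule T t ↔ f ∈ spaceV T t := by
  rw [spaceVSubmodule, Submodule.mem_inf, Submodule.mem_comap, mem_aboveSubmodule,
    mem_aboveSubmodule, spaceV, mem_inter_iff]
  refine and_congr_right fun _ => ⟨fun h => ⟨T f, h, hT f⟩, ?_⟩
  rintro ⟨g, hg, rfl⟩
  simpa [hT] using hg

/-! ### The structure functions -/

/-- The quotient of `E(t, ·)` by `E`. -/
noncomputable def quotE (t : ℝ) (φ ψ : ℝ → ℝ) (Θ : ℂ → ℂ) (z : ℂ) : ℂ :=
  ((entirePart t ψ z + Θ z * entirePart t ψ (-z)) +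
    (entirePart t φ z - Θ z * entirePart t φ (-z))) / 2

/-- The quotient of `sharp E(t, ·)` by `E`. -/
noncomputable def quotF (t : ℝ) (φ ψ : ℝ → ℝ) (Θ : ℂ → ℂ) (z : ℂ) : ℂ :=
  ((entirePart t ψ z + Θ z * entirePart t ψ (-z)) -
    (entirePart t φ z - Θ z * entirePart t φ (-z))) / 2

theorem fourier_add_of_mem {f g : L2} {s : ℝ} (hf : f ∈ L2Above s) (hg : g ∈ L2Above s) (a b : ℂ)
    {z : ℂ} (hz : z ∈ upperHalf) :
    fourier ((a • f + b • g : L2) : ℝ → ℂ) z = a * fourier f z + b * fourier g z := by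
  have i : ∀ f ∈ L2Above s, Integrable fun x : ℝ => f x * Complex.exp (Complex.I * x * z) :=
    fun f hf => (integrable_mul_cexp_iff (Lp.memLp f).1 z).2
      (integrable_norm_mul_exp (Lp.memLp f) hf hz)
  rw [fourier, fourier, fourier, ← integral_const_mul, ← integral_const_mul,
    ← integral_add ((i f hf).const_mul _) ((i g hg).const_mul _)]
  refine integral_congr_ae ?_
  filter_upwards [Lp.coeFn_add (a • f) (b • g), Lp.coeFn_smul a f, Lp.coeFn_smul b g] with x e1 e2 e3
  rw [e1, Pi.add_apply, e2, e3, Pi.smul_apply, Pi.smul_apply, smul_eq_mul, smul_eq_mul]; ring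

section kernel

variable {K : ℝ → ℝ} {c : ℝ} {T : L2 →L[ℂ] L2} {Θ : ℂ → ℂ} (H : HankelSystem K c T Θ)
  {t : ℝ} (ht : 0 ≤ t) {φ ψ : ℝ → ℝ} (hφ : IsSol K t 1 φ) (hψ : IsSol K t (-1) ψ)
include H

theorem conj_symbol {w : ℂ} (hw : c < w.im) :
    Θ (-(starRingEnd ℂ) w) = (starRingEnd ℂ) (Θ w) := by
  rw [H.symbol_eq w hw, H.symbol_eq _ (by simpa using hw), conj_fourier]
  simp

include hφ hψ

theorem differentiableOn_quotE : DifferentiableOn ℂ (quotE t φ ψ Θ) upperHalf := by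
  have hp : Differentiable ℂ (entirePart t ψ) := differentiable_entirePart hψ.1
  have hq : Differentiable ℂ (entirePart t φ) := differentiable_entirePart hφ.1
  have hp' : Differentiable ℂ fun z => entirePart t ψ (-z) := hp.comp differentiable_neg
  have hq' : Differentiable ℂ fun z => entirePart t φ (-z) := hq.comp differentiable_neg
  have hd := H.symbol_diff
  exact (((hp.differentiableOn.add (hd.mul hp'.differentiableOn)).add
    (hq.differentiableOn.sub (hd.mul hq'.differentiableOn)))).div_const _

theorem differentiableOn_quotF : DifferentiableOn ℂ (quotF t φ ψ Θ) upperHalf := by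
  have hp : Differentiable ℂ (entirePart t ψ) := differentiable_entirePart hψ.1
  have hq : Differentiable ℂ (entirePart t φ) := differentiable_entirePart hφ.1
  have hp' : Differentiable ℂ fun z => entirePart t ψ (-z) := hp.comp differentiable_neg
  have hq' : Differentiable ℂ fun z => entirePart t φ (-z) := hq.comp differentiable_neg
  have hd := H.symbol_diff
  exact (((hp.differentiableOn.add (hd.mul hp'.differentiableOn)).sub
    (hq.differentiableOn.sub (hd.mul hq'.differentiableOn)))).div_const _

include ht

/-- The resolvent elements for Φ and Ψ lie in L²(t,∞) but their images under T do not; to the left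
of t both images are multiples of the same exponential. One linear combination cancels it and
therefore lies in V_t. -/
theorem exists_kernel_of_lt {w : ℂ} (hw : c < w.im) : ∃ j ∈ spaceVSubmodule T t,
    (∀ g ∈ spaceVSubmodule T t, inner ℂ j g = fourier g w) ∧
    ∀ z ∈ upperHalf, fourier j z = Complex.I * (quotE t φ ψ Θ z * (starRingEnd ℂ) (quotE t φ ψ Θ w) -
      quotF t φ ψ Θ z * (starRingEnd ℂ) (quotF t φ ψ Θ w)) / (z - (starRingEnd ℂ) w) := by
  have hc := H.c_pos
  -- This choice gives z + ξ = z - conj w and makes the pairing with V_t evaluate transforms at w.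
  let ξ := -(starRingEnd ℂ) w
  have hξ : c < ξ.im := by simpa [ξ] using hw
  have hξc : -(starRingEnd ℂ) ξ = w := by simp [ξ]
  obtain ⟨r, hr, hTr, hrF, hrV⟩ := exists_resolvent H ht (by simp) hφ hξ
  obtain ⟨s, hs, hTs, hsF, hsV⟩ := exists_resolvent H ht (by simp) hψ hξ
  rw [hξc] at hrV hsV
  have hW := wronskian H ht hφ hψ ξ
  let α := entirePart t ψ ξ + Θ ξ * entirePart t ψ (-ξ)
  let b := entirePart t φ ξ - Θ ξ * entirePart t φ (-ξ)
  -- The terms with Θ cancel and leave the Wronskian; this normalises the reproducing property.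
  have hαb : α * entirePart t φ (-ξ) + b * entirePart t ψ (-ξ) = 2 := by
    rw [← hW]; simp only [α, b]; ring
  have hα : α = (starRingEnd ℂ) (quotE t φ ψ Θ w + quotF t φ ψ Θ w) := by
    have : quotE t φ ψ Θ w + quotF t φ ψ Θ w =
      entirePart t ψ w + Θ w * entirePart t ψ (-w) := by rw [quotE, quotF]; ring
    rw [this, map_add, map_mul, conj_entirePart, conj_entirePart, ← conj_symbol H hw]
    simp only [α, ξ, map_neg]
  have hb : b = (starRingEnd ℂ) (quotE t φ ψ Θ w - quotF t φ ψ Θ w) := by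
    have : quotE t φ ψ Θ w - quotF t φ ψ Θ w =
      entirePart t φ w - Θ w * entirePart t φ (-w) := by rw [quotE, quotF]; ring
    rw [this, map_sub, map_mul, conj_entirePart, conj_entirePart, ← conj_symbol H hw]
    simp only [b, ξ, map_neg]
  -- To the left of t, Tr and Ts are i·b and -i·α times the same exponential, so these coefficients
  -- cancel it.
  let j : L2 := (Complex.I / 2 * α) • r + (Complex.I / 2 * b) • s
  refine ⟨j, ?_, fun g hg => ?_, fun z hz => ?_⟩
  · refine Submodule.mem_inf.2 ⟨add_mem (Submodule.smul_mem _ _ (mem_aboveSubmodule.2 hr))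
      (Submodule.smul_mem _ _ (mem_aboveSubmodule.2 hs)), ?_⟩
    rw [Submodule.mem_comap, mem_aboveSubmodule]
    have e0 : T.toLinearMap j = (Complex.I / 2 * α) • T r + (Complex.I / 2 * b) • T s := by
      simp only [j]
      rw [ContinuousLinearMap.coe_coe, map_add, map_smul, map_smul]
    rw [e0]
    filter_upwards [Lp.coeFn_add ((Complex.I / 2 * α) • T r) ((Complex.I / 2 * b) • T s),
      Lp.coeFn_smul (Complex.I / 2 * α) (T r), Lp.coeFn_smul (Complex.I / 2 * b) (T s), hTr, hTs]
      with x e1 e2 e3 e4 e5 hx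
    rw [e1, Pi.add_apply, e2, e3, Pi.smul_apply, Pi.smul_apply, e4 hx, e5 hx, smul_eq_mul,
      smul_eq_mul]
    simp only [α, b]
    push_cast
    ring
  · rw [mem_spaceVSubmodule H.invol] at hg
    rw [inner_add_left, inner_smul_left, inner_smul_left, hrV g hg, hsV g hg]
    have h2 : (starRingEnd ℂ) (Complex.I / 2 * α) * (starRingEnd ℂ) (-Complex.I * entirePart t φ (-ξ))
        + (starRingEnd ℂ) (Complex.I / 2 * b) * (starRingEnd ℂ) (-Complex.I * entirePart t ψ (-ξ))
        = 1 := by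
      rw [← map_mul, ← map_mul, ← map_add]
      have : Complex.I / 2 * α * (-Complex.I * entirePart t φ (-ξ)) +
          Complex.I / 2 * b * (-Complex.I * entirePart t ψ (-ξ)) = 1 := by
        linear_combination hαb / 2 - (α * entirePart t φ (-ξ) + b * entirePart t ψ (-ξ)) / 2 *
          Complex.I_sq
      rw [this, map_one]
    linear_combination fourier g w * h2
  · have hne : z - (starRingEnd ℂ) w ≠ 0 := fun h0 => by
      have := congrArg Complex.im h0
      have hz : 0 < z.im := hz
      simp at this; linarith
    rw [fourier_add_of_mem hr hs _ _ hz, hrF z hz, hsF z hz, hα, hb,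
      show z + ξ = z - (starRingEnd ℂ) w by simp only [ξ]; ring, map_add, map_sub,
      show entirePart t φ z - ((1 : ℝ) : ℂ) * Θ z * entirePart t φ (-z) =
        quotE t φ ψ Θ z - quotF t φ ψ Θ z by rw [quotE, quotF]; push_cast; ring,
      show entirePart t ψ z - ((-1 : ℝ) : ℂ) * Θ z * entirePart t ψ (-z) =
        quotE t φ ψ Θ z + quotF t φ ψ Θ z by rw [quotE, quotF]; push_cast; ring]
    field_simp
    ring

/-- The reproducing kernels of `V_t`. -/
theorem exists_kernel : ∃ k : ℂ → L2, ∀ w ∈ upperHalf, k w ∈ spaceVSubmodule T t ∧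
    (∀ g ∈ spaceVSubmodule T t, inner ℂ (k w) g = fourier g w) ∧
    ∀ z ∈ upperHalf, fourier (k w) z =
      Complex.I * (quotE t φ ψ Θ z * (starRingEnd ℂ) (quotE t φ ψ Θ w) -
      quotF t φ ψ Θ z * (starRingEnd ℂ) (quotF t φ ψ Θ w)) / (z - (starRingEnd ℂ) w) := by
  have hex : ∀ w ∈ upperHalf, ∃ k ∈ spaceVSubmodule T t,
      ∀ g ∈ spaceVSubmodule T t, inner ℂ k g = fourier g w := fun w hw => by
    have hm : MemLp ((Ici t).indicator fun x : ℝ =>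
        Complex.exp (-Complex.I * x * (starRingEnd ℂ) w)) 2 volume := by
      refine (memLp_indicator_exp hw t).of_le ((by fun_prop : Continuous fun x : ℝ =>
        Complex.exp (-Complex.I * x * (starRingEnd ℂ) w)).aestronglyMeasurable.indicator
        measurableSet_Ici) (Eventually.of_forall fun x => ?_)
      by_cases hx : x ∈ Ici t
      · rw [indicator_of_mem hx, indicator_of_mem hx, Complex.norm_exp, Real.norm_eq_abs, Real.abs_exp]
        simp
      · rw [indicator_of_notMem hx, indicator_of_notMem hx]; simp
    -- For arbitrary w the kernel is the projection of the exponential on [t,∞); only its formula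
    -- still needs proof.
    refine ⟨(spaceVSubmodule T t).starProjection (hm.toLp _), Submodule.starProjection_apply_mem _ _,
      fun g hg => ?_⟩
    rw [Submodule.inner_starProjection_left_eq_right, Submodule.starProjection_eq_self_iff.2 hg,
      inner_L2_eq]
    refine integral_congr_ae ?_
    filter_upwards [hm.coeFn_toLp, mem_aboveSubmodule.1 hg.1] with x h1 h2
    rw [h1]
    by_cases hx : x ∈ Ici t
    · rw [indicator_of_mem hx, ← Complex.exp_conj]
      congr 2
      simp
    · rw [h2 (not_le.1 hx), zero_mul, zero_mul]
  choose! k hkV hkr using hex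
  have hlt : ∀ w : ℂ, c < w.im → ∀ z ∈ upperHalf, fourier (k w) z =
      Complex.I * (quotE t φ ψ Θ z * (starRingEnd ℂ) (quotE t φ ψ Θ w) -
      quotF t φ ψ Θ z * (starRingEnd ℂ) (quotF t φ ψ Θ w)) / (z - (starRingEnd ℂ) w) := by
    intro w hw
    obtain ⟨j, hjV, hjr, hjF⟩ := exists_kernel_of_lt H ht hφ hψ hw
    have hw' : w ∈ upperHalf := H.c_pos.trans hw
    have : k w - j = 0 := by
      rw [← inner_self_eq_zero (𝕜 := ℂ)]
      have hV := sub_mem (hkV w hw') hjV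
      rw [inner_sub_left, hkr w hw' _ hV, hjr _ hV, sub_self]
    rw [sub_eq_zero.1 this]
    exact hjF
  refine ⟨k, fun w hw => ⟨hkV w hw, hkr w hw, ?_⟩⟩
  -- Hermitian symmetry transfers the restriction Im w > c to the variable z, in which both sides
  -- are analytic, so the formula continues to all of the half-plane.
  have hsymm : ∀ z ∈ upperHalf, fourier (k w) z = (starRingEnd ℂ) (fourier (k z) w) := fun z hz => by
    rw [← hkr z hz _ (hkV w hw), ← hkr w hw _ (hkV z hz), inner_conj_symm]
  have hne : ∀ z ∈ upperHalf, z - (starRingEnd ℂ) w ≠ 0 := fun z hz h0 => by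
    have := congrArg Complex.im h0
    have hz : 0 < z.im := hz
    have hw : 0 < w.im := hw
    simp at this; linarith
  refine eqOn_upperHalf (c := c) (differentiableOn_fourier (Lp.memLp _)
    (mem_aboveSubmodule.1 (hkV w hw).1)) ?_ fun z hz => ?_
  · exact (((differentiableOn_quotE H hφ hψ).mul_const _).sub
      ((differentiableOn_quotF H hφ hψ).mul_const _) |>.const_mul _).div
      (differentiableOn_id.sub_const _) hne
  · have hz' : z ∈ upperHalf := H.c_pos.trans hz
    rw [hsymm z hz', hlt z hz w hw]
    have h1 := hne z hz'
    have h2 : (starRingEnd ℂ) w - z ≠ 0 := by rwa [← neg_ne_zero, neg_sub]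
    simp only [map_div₀, map_mul, map_sub, Complex.conj_conj, Complex.conj_I]
    rw [div_eq_div_iff h2 h1]
    ring

/-- The diagonal value of the kernel is ‖k w‖² = (|e(w)|² - |f(w)|²)/(2 Im w), which is nonnegative.
-/
theorem norm_quotF_le {w : ℂ} (hw : w ∈ upperHalf) : ‖quotF t φ ψ Θ w‖ ≤ ‖quotE t φ ψ Θ w‖ := by
  obtain ⟨k, hk⟩ := exists_kernel H ht hφ hψ
  obtain ⟨h1, h2, h3⟩ := hk w hw
  have h4 := h2 _ h1
  have hw0 : 0 < w.im := hw
  rw [h3 w hw, inner_self_eq_norm_sq_to_K, Complex.mul_conj, Complex.mul_conj, Complex.sub_conj,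
    eq_div_iff (mul_ne_zero (by exact_mod_cast (mul_pos two_pos hw0).ne') Complex.I_ne_zero)] at h4
  have h5 : ((‖k w‖ ^ 2 * (2 * w.im) : ℝ) : ℂ) =
      ((Complex.normSq (quotE t φ ψ Θ w) - Complex.normSq (quotF t φ ψ Θ w) : ℝ) : ℂ) := by
    apply mul_right_cancel₀ Complex.I_ne_zero
    rw [Complex.ofReal_mul, Complex.ofReal_sub, mul_assoc, Complex.ofReal_pow]
    exact h4.trans (mul_comm _ _)
  have h6 := Complex.ofReal_injective h5
  rw [Complex.normSq_eq_norm_sq, Complex.normSq_eq_norm_sq] at h6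
  refine (sq_le_sq₀ (norm_nonneg _) (norm_nonneg _)).1 ?_
  have : 0 ≤ ‖k w‖ ^ 2 * (2 * w.im) := by positivity
  linarith

/-- A zero of e would by `norm_quotF_le` be a zero of f too. Then both p(z) - σΘ(z)p(-z) vanish, and
the Wronskian identity would give 2 = 0. -/
theorem quotE_ne_zero {w : ℂ} (hw : w ∈ upperHalf) : quotE t φ ψ Θ w ≠ 0 := fun h0 => by
  have h1 := norm_quotF_le H ht hφ hψ hw
  rw [h0, norm_zero, norm_le_zero_iff] at h1
  have hW := wronskian H ht hφ hψ w
  rw [quotE] at h0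
  rw [quotF] at h1
  have : (2 : ℂ) = 0 := by
    linear_combination -hW + h0 * (entirePart t φ (-w) + entirePart t ψ (-w)) +
      h1 * (entirePart t φ (-w) - entirePart t ψ (-w))
  norm_num at this

/-- On the boundary conjugation exchanges p(x) and p(-x), so the limits of e and f satisfy f = ϑ
conj e with |ϑ| = 1. The Wronskian identity on the real line keeps the limit of e away from zero. -/
theorem isInner_quotient : IsInner fun z => quotF t φ ψ Θ z / quotE t φ ψ Θ z := by
  refine ⟨(differentiableOn_quotF H hφ hψ).div (differentiableOn_quotE H hφ hψ)
    fun z hz => quotE_ne_zero H ht hφ hψ hz, ⟨1, fun z hz => ?_⟩, ?_⟩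
  · rw [norm_div, div_le_one (norm_pos_iff.2 (quotE_ne_zero H ht hφ hψ hz))]
    exact norm_quotF_le H ht hφ hψ hz
  · filter_upwards [H.symbol_boundary] with x ⟨ϑ, hϑ, hlim⟩
    have hpath : Tendsto (fun y : ℝ => (x : ℂ) + y * Complex.I) (𝓝[>] 0) (𝓝 (x : ℂ)) := by
      have : Continuous fun y : ℝ => (x : ℂ) + y * Complex.I := by fun_prop
      have h := this.tendsto 0
      simp only [Complex.ofReal_zero, zero_mul, add_zero] at h
      exact h.mono_left nhdsWithin_le_nhds
    have hpc : Continuous (entirePart t ψ) := (differentiable_entirePart hψ.1).continuous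
    have hqc : Continuous (entirePart t φ) := (differentiable_entirePart hφ.1).continuous
    have l1 := (hpc.tendsto x).comp hpath
    have l2 := ((hpc.comp continuous_neg).tendsto x).comp hpath
    have l3 := (hqc.tendsto x).comp hpath
    have l4 := ((hqc.comp continuous_neg).tendsto x).comp hpath
    let e0 := ((entirePart t ψ x + ϑ * entirePart t ψ (-x)) +
      (entirePart t φ x - ϑ * entirePart t φ (-x))) / 2
    let f0 := ((entirePart t ψ x + ϑ * entirePart t ψ (-x)) -
      (entirePart t φ x - ϑ * entirePart t φ (-x))) / 2
    have le : Tendsto (fun y : ℝ => quotE t φ ψ Θ (x + y * Complex.I)) (𝓝[>] 0) (𝓝 e0) :=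
      ((l1.add (hlim.mul l2)).add (l3.sub (hlim.mul l4))).div_const 2
    have lf : Tendsto (fun y : ℝ => quotF t φ ψ Θ (x + y * Complex.I)) (𝓝[>] 0) (𝓝 f0) :=
      ((l1.add (hlim.mul l2)).sub (l3.sub (hlim.mul l4))).div_const 2
    have hϑ2 : ϑ * (starRingEnd ℂ) ϑ = 1 := by rw [Complex.mul_conj']; simp [hϑ]
    have hp := conj_entirePart (t := t) (φ := ψ) (x : ℂ)
    have hp' := conj_entirePart (t := t) (φ := ψ) (-x : ℂ)
    have hq := conj_entirePart (t := t) (φ := φ) (x : ℂ)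
    have hq' := conj_entirePart (t := t) (φ := φ) (-x : ℂ)
    simp only [Complex.conj_ofReal, map_neg, neg_neg] at hp hp' hq hq'
    have hf0 : f0 = ϑ * (starRingEnd ℂ) e0 := by
      simp only [e0, f0, map_div₀, map_add, map_sub, map_mul, hp, hp', hq, hq', Complex.conj_ofNat]
      linear_combination (entirePart t φ x - entirePart t ψ x) / 2 * hϑ2
    have hnorm : ‖f0‖ = ‖e0‖ := by rw [hf0, norm_mul, hϑ, one_mul, RCLike.norm_conj]
    have he0 : e0 ≠ 0 := fun h0 => by
      have h1 : f0 = 0 := by rw [hf0, h0]; simp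
      have hW := wronskian H ht hφ hψ x
      simp only [e0] at h0
      simp only [f0] at h1
      have : (2 : ℂ) = 0 := by
        linear_combination -hW + h0 * (entirePart t φ (-x) + entirePart t ψ (-x)) +
          h1 * (entirePart t φ (-x) - entirePart t ψ (-x))
      norm_num at this
    have := (lf.div le he0).norm
    rw [norm_div, hnorm, div_self (norm_ne_zero_iff.2 he0)] at this
    exact this

end kernel

/-! ### The quotients of `E(t, ·)` -/

section quotients

variable {E : ℂ → ℂ} {Z : Set ℂ} {c : ℝ} {Θ : ℂ → ℂ} (hE : ∃ z, z ∉ Z ∧ E z ≠ 0)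
  (h1 : CondK1 E c Z) (hΘ : ∀ z ∈ upperHalf, z ∉ Z → sharp E z = Θ z * E z)

include hE h1 in
theorem exists_mem_upperHalf_ne_zero : ∃ z ∈ upperHalf, z ∉ Z ∧ E z ≠ 0 := by
  have hcount : (Z ∪ {z | z ∉ Z ∧ E z = 0}).Countable := h1.countable.union (h1.countable_zeros hE)
  obtain ⟨z, hz, hz2⟩ := (hcount.dense_compl ℝ).inter_open_nonempty upperHalf isOpen_upperHalf
    ⟨Complex.I, by simp [upperHalf]⟩
  simp only [mem_compl_iff, mem_union, mem_ofPred_eq, not_or, not_and] at hz2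
  exact ⟨z, hz, hz2.1, hz2.2 hz2.1⟩

/-- The function `E(t, ·)`. -/
noncomputable def evolved (E : ℂ → ℂ) (t : ℝ) (φ ψ : ℝ → ℝ) (z : ℂ) : ℂ :=
  (E z * entirePart t ψ z + sharp E z * entirePart t ψ (-z)) / 2 +
    (E z * entirePart t φ z - sharp E z * entirePart t φ (-z)) / 2

/-- `sharp` exchanges E with E^♯ and p(z) with p(-z). It therefore fixes the summand from Ψ and
changes the sign of the one from Φ. -/
theorem sharp_evolved (t : ℝ) (φ ψ : ℝ → ℝ) (z : ℂ) : sharp (evolved E t φ ψ) z =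
    (E z * entirePart t ψ z + sharp E z * entirePart t ψ (-z)) / 2 -
    (E z * entirePart t φ z - sharp E z * entirePart t φ (-z)) / 2 := by
  have hs : (starRingEnd ℂ) (sharp E ((starRingEnd ℂ) z)) = E z := by simp [sharp]
  have hs' : (starRingEnd ℂ) (E ((starRingEnd ℂ) z)) = sharp E z := rfl
  rw [sharp, evolved]
  simp only [map_add, map_sub, map_mul, map_div₀, Complex.conj_ofNat, hs, hs', conj_entirePart,
    Complex.conj_conj, map_neg, neg_neg]
  ring

include hΘ

theorem evolved_eq (t : ℝ) (φ ψ : ℝ → ℝ) {z : ℂ} (hz : z ∈ upperHalf) (hzZ : z ∉ Z) :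
    evolved E t φ ψ z = E z * quotE t φ ψ Θ z := by
  rw [evolved, quotE, hΘ z hz hzZ]; ring

theorem sharp_evolved_eq (t : ℝ) (φ ψ : ℝ → ℝ) {z : ℂ} (hz : z ∈ upperHalf) (hzZ : z ∉ Z) :
    sharp (evolved E t φ ψ) z = E z * quotF t φ ψ Θ z := by
  rw [sharp_evolved, quotF, hΘ z hz hzZ]; ring

end quotients

/-! ### Shifting contours in the upper half-plane -/

/-- An integrable function cannot stay above a positive level on a half-line; this selects
rectangles whose vertical sides contribute nothing in the limit. -/
theorem exists_tendsto_zero_of_integrable {k : ℝ → ℝ} (hk : Integrable k) :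
    ∃ R : ℕ → ℝ, Tendsto R atTop atTop ∧ Tendsto (fun n => k (R n)) atTop (𝓝 0) := by
  have h : ∀ n : ℕ, ∃ R : ℝ, (n : ℝ) ≤ R ∧ ‖k R‖ < 1 / ((n : ℝ) + 1) := fun n => by
    by_contra! hc
    have h1 := hk.measure_norm_ge_lt_top (ε := 1 / ((n : ℝ) + 1)) (by positivity)
    have h2 : Ici (n : ℝ) ⊆ {x | 1 / ((n : ℝ) + 1) ≤ ‖k x‖} := fun x hx => hc x hx
    have h3 := (measure_mono h2).trans_lt h1
    simp at h3
  choose R hR1 hR2 using h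
  refine ⟨R, tendsto_atTop_mono hR1 tendsto_natCast_atTop_atTop, ?_⟩
  exact squeeze_zero_norm (fun n => (hR2 n).le) tendsto_one_div_add_atTop_nhds_zero_nat

/-- Cauchy's theorem on rectangles. The integrals of |G| over the vertical sides form an integrable
function of the abscissa by Fubini, so they tend to zero along a sequence on both sides at once. -/
theorem integral_slice_eq {G : ℂ → ℂ} (hG : DifferentiableOn ℂ G upperHalf) {v₁ v₂ : ℝ}
    (h1 : 0 < v₁) (h12 : v₁ ≤ v₂) (hi1 : Integrable (slice G v₁)) (hi2 : Integrable (slice G v₂))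
    (hi : Integrable (fun p : ℝ × ℝ => slice G p.2 p.1)
      (volume.prod (volume.restrict (Ioc v₁ v₂)))) :
    ∫ u, slice G v₁ u = ∫ u, slice G v₂ u := by
  let h : ℝ → ℝ := fun x => ∫ y in Ioc v₁ v₂, ‖slice G y x‖
  have hh : Integrable h := hi.integral_norm_prod_left
  obtain ⟨R, hR, hRk⟩ := exists_tendsto_zero_of_integrable (hh.add hh.comp_neg)
  have hvert : ∀ x : ℝ, ‖∫ y in v₁..v₂, G (x + y * Complex.I)‖ ≤ h x := fun x => by
    rw [intervalIntegral.integral_of_le h12]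
    exact norm_integral_le_integral_norm _
  have hh0 : ∀ x, 0 ≤ h x := fun x => integral_nonneg fun _ => norm_nonneg _
  have hrect : ∀ x : ℝ, (∫ u in -x..x, slice G v₁ u) - (∫ u in -x..x, slice G v₂ u) =
      -(Complex.I * ∫ y in v₁..v₂, G (x + y * Complex.I)) +
      Complex.I * ∫ y in v₁..v₂, G ((-x : ℝ) + y * Complex.I) := fun x => by
    have := Complex.integral_boundary_rect_eq_zero_of_differentiableOn G
      ((-x : ℝ) + v₁ * Complex.I) (x + v₂ * Complex.I) (hG.mono fun s hs => by
        have := hs.2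
        simp only [mem_preimage, Complex.add_im, Complex.ofReal_im, Complex.mul_im,
          Complex.ofReal_re, Complex.I_im, mul_one, Complex.I_re, mul_zero, add_zero, zero_add,
          uIcc_of_le h12] at this
        exact h1.trans_le this.1)
    simp only [Complex.add_im, Complex.ofReal_im, Complex.mul_im, Complex.ofReal_re, Complex.I_im,
      mul_one, Complex.I_re, mul_zero, add_zero, zero_add, Complex.add_re, Complex.mul_re,
      sub_zero, smul_eq_mul] at this
    simp only [slice]
    linear_combination this
  have t1 := intervalIntegral_tendsto_integral hi1 (tendsto_neg_atTop_atBot.comp hR) hR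
  have t2 := intervalIntegral_tendsto_integral hi2 (tendsto_neg_atTop_atBot.comp hR) hR
  have t3 : Tendsto (fun n => (∫ u in -R n..R n, slice G v₁ u) - ∫ u in -R n..R n, slice G v₂ u)
      atTop (𝓝 0) := by
    refine squeeze_zero_norm (fun n => ?_) hRk
    rw [hrect]
    refine (norm_add_le _ _).trans ?_
    rw [norm_neg, norm_mul, norm_mul, Complex.norm_I, one_mul, one_mul]
    exact add_le_add (hvert _) (hvert _)
  exact sub_eq_zero.1 (tendsto_nhds_unique (t1.sub t2) t3)

/-! ### Elementary facts on the Hardy space -/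

theorem continuous_slice {F : ℂ → ℂ} (hF : DifferentiableOn ℂ F upperHalf) {v : ℝ} (hv : 0 < v) :
    Continuous (slice F v) := by
  refine hF.continuousOn.comp_continuous (by fun_prop) fun u => ?_
  simpa [upperHalf] using hv

theorem exists_hardy_bound {F : ℂ → ℂ} (hF : F ∈ hardySpace) :
    ∃ M : ℝ≥0, ∀ v : ℝ, 0 < v → ∫⁻ u : ℝ, ‖slice F v u‖ₑ ^ 2 ≤ M := by
  refine ⟨(⨆ v ∈ Ioi (0 : ℝ), ∫⁻ u : ℝ, ‖slice F v u‖ₑ ^ 2).toNNReal, fun v hv => ?_⟩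
  rw [ENNReal.coe_toNNReal hF.2.ne]
  exact le_iSup₂ (f := fun (v : ℝ) (_ : v ∈ Ioi (0 : ℝ)) => ∫⁻ u : ℝ, ‖slice F v u‖ₑ ^ 2) v hv

theorem lintegral_sq_eq_eLpNorm_sq (g : ℝ → ℂ) : ∫⁻ x, ‖g x‖ₑ ^ 2 = eLpNorm g 2 volume ^ 2 := by
  rw [eLpNorm_eq_lintegral_rpow_enorm_toReal (by norm_num) (by norm_num)]
  simp only [ENNReal.toReal_ofNat, one_div, ENNReal.rpow_ofNat]
  rw [← ENNReal.rpow_natCast, ← ENNReal.rpow_mul]; simp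

theorem memLp_of_lintegral_sq_lt_top {g : ℝ → ℂ} (hg : AEStronglyMeasurable g volume)
    (h : ∫⁻ x, ‖g x‖ₑ ^ 2 < ⊤) : MemLp g 2 volume := by
  rw [lintegral_sq_eq_eLpNorm_sq, ENNReal.pow_lt_top_iff] at h
  exact ⟨hg, h.resolve_right (by norm_num)⟩

theorem memLp_slice {F : ℂ → ℂ} (hF : F ∈ hardySpace) {v : ℝ} (hv : 0 < v) :
    MemLp (slice F v) 2 volume := by
  obtain ⟨M, hM⟩ := exists_hardy_bound hF
  exact memLp_of_lintegral_sq_lt_top (continuous_slice hF.1 hv).aestronglyMeasurable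
    ((hM v hv).trans_lt (by simp))

theorem integral_norm_slice_sq_le {F : ℂ → ℂ} (hF : F ∈ hardySpace) {M : ℝ≥0}
    (hM : ∀ v : ℝ, 0 < v → ∫⁻ u : ℝ, ‖slice F v u‖ₑ ^ 2 ≤ M) {v : ℝ} (hv : 0 < v) :
    ∫ u, ‖slice F v u‖ ^ 2 ≤ M := by
  rw [integral_eq_lintegral_of_nonneg_ae (Eventually.of_forall fun _ => by positivity)
    (by have := continuous_slice hF.1 hv; fun_prop : Continuous fun u =>
      ‖slice F v u‖ ^ 2).aestronglyMeasurable]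
  refine ENNReal.toReal_le_coe_of_le_coe ((lintegral_congr fun u => ?_).trans_le (hM v hv))
  rw [ENNReal.ofReal_pow (norm_nonneg _), ofReal_norm]

theorem integral_inv_sq_add_sq (a : ℝ) {d : ℝ} (hd : 0 < d) :
    (Integrable fun x : ℝ => ((x - a) ^ 2 + d ^ 2)⁻¹) ∧
    ∫ x : ℝ, ((x - a) ^ 2 + d ^ 2)⁻¹ = Real.pi / d := by
  have e : (fun x : ℝ => ((x - a) ^ 2 + d ^ 2)⁻¹) =
      fun x : ℝ => (d ^ 2)⁻¹ * (1 + ((x - a) / d) ^ 2)⁻¹ := by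
    ext x
    rw [← mul_inv]; congr 1; field_simp; ring
  rw [e]
  constructor
  · exact ((integrable_inv_one_add_sq.comp_div hd.ne').comp_sub_right a).const_mul _
  · rw [integral_const_mul, integral_sub_right_eq_self (fun x : ℝ => (1 + (x / d) ^ 2)⁻¹) a,
      Measure.integral_comp_div (fun x : ℝ => (1 + x ^ 2)⁻¹) d, integral_univ_inv_one_add_sq,
      abs_of_pos hd, smul_eq_mul]
    field_simp

section vanish

variable {F : ℂ → ℂ} (hF : F ∈ hardySpace) {z : ℂ} (hz : z ∈ upperHalf) (hFz : F z = 0)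
include hF hz hFz

omit hFz in
theorem differentiableOn_dslope_upperHalf : DifferentiableOn ℂ (dslope F z) upperHalf :=
  (Complex.differentiableOn_dslope (isOpen_upperHalf.mem_nhds hz)).2 hF.1

/-- Away from z the quotient is split by s/d ≤ s² + 1/d² into two integrable pieces; near z
compactness bounds the removable singularity. The bound is uniform for heights in a compact
interval, as the contour shift requires. -/
theorem exists_norm_slice_dslope_le {v₁ v₂ : ℝ} (h1 : 0 < v₁) : ∃ C, 0 ≤ C ∧ ∀ y ∈ Icc v₁ v₂,
    ∀ x, ‖slice (dslope F z) y x‖ ≤ ‖slice F y x‖ ^ 2 + C * ((x - z.re) ^ 2 + 1 ^ 2)⁻¹ := by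
  have hcomp : IsCompact (Icc (z.re - 1) (z.re + 1) ×ℂ Icc v₁ v₂) := isCompact_Icc.reProdIm isCompact_Icc
  obtain ⟨C, hC⟩ := hcomp.exists_bound_of_continuousOn
    ((differentiableOn_dslope_upperHalf hF hz).continuousOn.mono fun s hs => h1.trans_le hs.2.1)
  refine ⟨2 * (|C| + 1), by positivity, fun y hy x => ?_⟩
  have hpos : 0 < (x - z.re) ^ 2 + 1 ^ 2 := by positivity
  rcases le_or_gt |x - z.re| 1 with h | h
  · have h2 : ‖slice (dslope F z) y x‖ ≤ C := hC _ (by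
      rw [abs_le] at h
      refine ⟨?_, ?_⟩
      · simp; constructor <;> linarith
      · simpa using hy)
    refine h2.trans ((le_abs_self C).trans ?_)
    have h3 : (x - z.re) ^ 2 ≤ 1 := (sq_le_one_iff_abs_le_one _).2 h
    refine le_add_of_nonneg_of_le (by positivity) ?_
    rw [← div_eq_mul_inv, le_div_iff₀ hpos]
    nlinarith [abs_nonneg C]
  · have hd : 0 < |x - z.re| := by linarith
    have hre : |x - z.re| ≤ ‖(x : ℂ) + y * Complex.I - z‖ := by
      simpa using Complex.abs_re_le_norm ((x : ℂ) + y * Complex.I - z)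
    have hne : (x : ℂ) + y * Complex.I ≠ z := fun h0 => by
      rw [h0, sub_self, norm_zero] at hre; linarith
    have e : ‖slice (dslope F z) y x‖ = ‖slice F y x‖ / ‖(x : ℂ) + y * Complex.I - z‖ := by
      rw [slice, dslope_of_ne _ hne, slope_def_field, hFz, sub_zero, norm_div]; rfl
    rw [e]
    have h3 : ‖slice F y x‖ / ‖(x : ℂ) + y * Complex.I - z‖ ≤ ‖slice F y x‖ * |x - z.re|⁻¹ := by
      rw [div_eq_mul_inv]; gcongr
    refine h3.trans ?_
    have h4 : ‖slice F y x‖ * |x - z.re|⁻¹ ≤ ‖slice F y x‖ ^ 2 + (|x - z.re|⁻¹) ^ 2 := by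
      nlinarith [sq_nonneg (‖slice F y x‖ - |x - z.re|⁻¹), sq_nonneg (‖slice F y x‖ + |x - z.re|⁻¹)]
    refine h4.trans ?_
    gcongr
    rw [inv_pow, sq_abs, ← div_eq_mul_inv, inv_eq_one_div]
    have h5 : 1 < (x - z.re) ^ 2 := (one_lt_sq_iff_one_lt_abs _).2 h
    rw [div_le_div_iff₀ (by linarith) hpos]
    nlinarith [abs_nonneg C]

theorem integrable_slice_dslope {v : ℝ} (hv : 0 < v) : Integrable (slice (dslope F z) v) := by
  obtain ⟨C, hC0, hC⟩ := exists_norm_slice_dslope_le hF hz hFz (v₂ := v) hv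
  refine Integrable.mono' ((memLp_slice hF hv).integrable_norm_pow (by norm_num) |>.add
    ((integral_inv_sq_add_sq z.re one_pos).1.const_mul C))
    (continuous_slice (differentiableOn_dslope_upperHalf hF hz) hv).aestronglyMeasurable
    (Eventually.of_forall fun x => ?_)
  simpa using hC v ⟨le_rfl, le_rfl⟩ x

theorem integrable_prod_dslope {v₁ v₂ : ℝ} (h1 : 0 < v₁) :
    Integrable (fun p : ℝ × ℝ => slice (dslope F z) p.2 p.1)
      (volume.prod (volume.restrict (Ioc v₁ v₂))) := by
  obtain ⟨C, hC0, hC⟩ := exists_norm_slice_dslope_le hF hz hFz (v₂ := v₂) h1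
  obtain ⟨M, hM⟩ := exists_hardy_bound hF
  have hmeas : ∀ {G : ℂ → ℂ}, DifferentiableOn ℂ G upperHalf →
      AEStronglyMeasurable (fun p : ℝ × ℝ => slice G p.2 p.1)
        (volume.prod (volume.restrict (Ioc v₁ v₂))) := fun {G} hG => by
    have e : (volume : Measure ℝ).prod (volume.restrict (Ioc v₁ v₂)) =
        ((volume : Measure ℝ).prod volume).restrict (univ ×ˢ Ioc v₁ v₂) := by
      rw [← Measure.prod_restrict, Measure.restrict_univ]
    rw [e]
    refine ContinuousOn.aestronglyMeasurable ?_ (MeasurableSet.univ.prod measurableSet_Ioc)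
    refine hG.continuousOn.comp (by fun_prop) fun p hp => ?_
    have := hp.2.1
    simp only [upperHalf, mem_ofPred_eq]
    simp; linarith
  have i1 : Integrable (fun p : ℝ × ℝ => ‖slice F p.2 p.1‖ ^ 2)
      (volume.prod (volume.restrict (Ioc v₁ v₂))) := by
    have hm : AEStronglyMeasurable (fun p : ℝ × ℝ => ‖slice F p.2 p.1‖ ^ 2)
        (volume.prod (volume.restrict (Ioc v₁ v₂))) := (hmeas hF.1).norm.pow 2
    refine ⟨hm, ?_⟩
    rw [HasFiniteIntegral, lintegral_prod_symm _ hm.enorm]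
    have : ∀ᵐ y ∂(volume.restrict (Ioc v₁ v₂)), (∫⁻ x : ℝ, ‖‖slice F y x‖ ^ 2‖ₑ) ≤ M := by
      filter_upwards [ae_restrict_mem measurableSet_Ioc] with y hy
      refine (lintegral_congr fun u => ?_).trans_le (hM y (h1.trans hy.1))
      rw [enorm_pow, enorm_norm]
    refine (lintegral_mono_ae this).trans_lt ?_
    rw [lintegral_const]
    exact ENNReal.mul_lt_top (by simp) (by simp)
  have i2 : Integrable (fun p : ℝ × ℝ => C * ((p.1 - z.re) ^ 2 + 1 ^ 2)⁻¹ * 1)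
      (volume.prod (volume.restrict (Ioc v₁ v₂))) :=
    ((integral_inv_sq_add_sq z.re one_pos).1.const_mul C).mul_prod
      (integrable_const (1 : ℝ))
  refine (i1.add i2).mono' (hmeas (differentiableOn_dslope_upperHalf hF hz)) ?_
  have : ∀ᵐ p : ℝ × ℝ ∂(volume.prod (volume.restrict (Ioc v₁ v₂))), p.2 ∈ Ioc v₁ v₂ :=
    Measure.quasiMeasurePreserving_snd.ae (ae_restrict_mem measurableSet_Ioc)
  filter_upwards [this] with p hp
  rw [Pi.add_apply, mul_one]
  exact hC p.2 ⟨hp.1.le, hp.2⟩ p.1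

/-- Cauchy's theorem for a Hardy space function with a zero at `z`. -/
theorem integral_slice_dslope_eq_zero {v : ℝ} (hv : 0 < v) (hvz : v < z.im) :
    ∫ u, slice (dslope F z) v u = 0 := by
  obtain ⟨M, hM⟩ := exists_hardy_bound hF
  have hbound : ∀ n : ℕ, ‖∫ u, slice (dslope F z) v u‖ ≤
      ((M : ℝ) + Real.pi) * (1 / ((n : ℝ) + 1)) := fun n => by
    -- The contour is raised to distance a² above z. The weighted inequality s/d ≤ s²/a + a/d² then
    -- bounds both parts by a constant times 1/a.
    let a : ℝ := (n : ℝ) + 1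
    have ha : 0 < a := by positivity
    let w := z.im + a ^ 2
    have hw : 0 < w := by have hz : 0 < z.im := hz; positivity
    have hvw : v ≤ w := by simp only [w]; nlinarith
    rw [integral_slice_eq (differentiableOn_dslope_upperHalf hF hz) hv hvw
      (integrable_slice_dslope hF hz hFz hv) (integrable_slice_dslope hF hz hFz hw)
      (integrable_prod_dslope hF hz hFz hv)]
    obtain ⟨j1, j2⟩ := integral_inv_sq_add_sq z.re (d := a ^ 2) (by positivity)
    have i1 : Integrable fun u => ‖slice F w u‖ ^ 2 :=
      (memLp_slice hF hw).integrable_norm_pow (by norm_num)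
    have key : ‖∫ u, slice (dslope F z) w u‖ ≤
        ∫ u, (a⁻¹ * ‖slice F w u‖ ^ 2 + a * ((u - z.re) ^ 2 + (a ^ 2) ^ 2)⁻¹) := by
      refine norm_integral_le_of_norm_le ((i1.const_mul _).add (j1.const_mul _))
        (Eventually.of_forall fun x => ?_)
      have hn : ‖(x : ℂ) + w * Complex.I - z‖ ^ 2 = (x - z.re) ^ 2 + (a ^ 2) ^ 2 := by
        rw [← Complex.normSq_eq_norm_sq, Complex.normSq_apply]
        have e1 : ((x : ℂ) + w * Complex.I - z).re = x - z.re := by simp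
        have e2 : ((x : ℂ) + w * Complex.I - z).im = a ^ 2 := by
          simp only [Complex.sub_im, Complex.add_im, Complex.ofReal_im, Complex.mul_im,
            Complex.ofReal_re, Complex.I_im, Complex.I_re, w]; ring
        rw [e1, e2]; ring
      have hpos : 0 < ‖(x : ℂ) + w * Complex.I - z‖ := by
        have : 0 < (x - z.re) ^ 2 + (a ^ 2) ^ 2 := by positivity
        rw [← hn] at this
        exact lt_of_le_of_ne (norm_nonneg _) fun h0 => by rw [← h0] at this; simp at this
      have hne : (x : ℂ) + w * Complex.I ≠ z := fun h0 => by
        rw [h0, sub_self, norm_zero] at hpos; exact lt_irrefl _ hpos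
      rw [← hn, slice, dslope_of_ne _ hne, slope_def_field, hFz, sub_zero, norm_div]
      change ‖slice F w x‖ / _ ≤ _
      generalize ‖(x : ℂ) + w * Complex.I - z‖ = d at hpos
      generalize ‖slice F w x‖ = s
      have e : a⁻¹ * s ^ 2 + a * (d ^ 2)⁻¹ - s / d =
          a⁻¹ * ((s - a / d / 2) ^ 2 + 3 / 4 * (a / d) ^ 2) := by field_simp; ring
      have : 0 ≤ a⁻¹ * ((s - a / d / 2) ^ 2 + 3 / 4 * (a / d) ^ 2) := by positivity
      linarith
    refine key.trans ?_
    rw [integral_add (i1.const_mul _) (j1.const_mul _), integral_const_mul, integral_const_mul, j2]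
    have h3 := integral_norm_slice_sq_le hF hM hw
    calc a⁻¹ * (∫ u, ‖slice F w u‖ ^ 2) + a * (Real.pi / a ^ 2)
        ≤ a⁻¹ * M + a * (Real.pi / a ^ 2) := by gcongr
      _ = ((M : ℝ) + Real.pi) * (1 / a) := by field_simp
  have hlim : Tendsto (fun n : ℕ => ((M : ℝ) + Real.pi) * (1 / ((n : ℝ) + 1))) atTop (𝓝 0) := by
    simpa using tendsto_one_div_add_atTop_nhds_zero_nat.const_mul ((M : ℝ) + Real.pi)
  exact norm_le_zero_iff.1 (ge_of_tendsto' hlim hbound)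

end vanish

/-! ### The Paley–Wiener theorem -/

/-- The function `exp (-ix conj w)` on `[0, ∞)`. -/
noncomputable def halfExp (w : ℂ) : ℝ → ℂ :=
  (Ici 0).indicator fun x : ℝ => Complex.exp (-Complex.I * x * (starRingEnd ℂ) w)

theorem norm_halfExp (w : ℂ) (x : ℝ) :
    ‖halfExp w x‖ = (Ici 0).indicator (fun x : ℝ => Real.exp (-(x * w.im))) x := by
  by_cases hx : x ∈ Ici (0 : ℝ)
  · rw [halfExp, indicator_of_mem hx, indicator_of_mem hx, Complex.norm_exp]
    simp
  · rw [halfExp, indicator_of_notMem hx, indicator_of_notMem hx, norm_zero]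

theorem halfExp_of_neg (w : ℂ) {x : ℝ} (hx : x < 0) : halfExp w x = 0 :=
  indicator_of_notMem (not_le.2 hx) _

theorem aestronglyMeasurable_halfExp (w : ℂ) : AEStronglyMeasurable (halfExp w) volume :=
  (by fun_prop : Continuous fun x : ℝ =>
    Complex.exp (-Complex.I * x * (starRingEnd ℂ) w)).aestronglyMeasurable.indicator measurableSet_Ici

theorem memLp_halfExp {w : ℂ} (hw : w ∈ upperHalf) : MemLp (halfExp w) 2 volume :=
  (memLp_indicator_exp hw 0).of_le (aestronglyMeasurable_halfExp w)
    (Eventually.of_forall fun x => by rw [norm_halfExp]; exact le_abs_self _)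

theorem halfExp_mul_cexp (w s : ℂ) (x : ℝ) : halfExp w x * Complex.exp (Complex.I * x * s) =
    (Ici (0 : ℝ)).indicator (fun _ => (1 : ℂ)) x *
      Complex.exp (Complex.I * x * (s - (starRingEnd ℂ) w)) := by
  by_cases hx : x ∈ Ici (0 : ℝ)
  · rw [halfExp, indicator_of_mem hx, indicator_of_mem hx, one_mul, ← Complex.exp_add]
    congr 1; ring
  · rw [halfExp, indicator_of_notMem hx, indicator_of_notMem hx, zero_mul, zero_mul]

theorem integrable_halfExp {w : ℂ} (hw : w ∈ upperHalf) : Integrable (halfExp w) := by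
  have h := integrable_indicator_Ici_cexp (z := 0 - (starRingEnd ℂ) w)
    (by simpa using (show 0 < w.im from hw)) 0
  refine h.congr (Eventually.of_forall fun x => ?_)
  beta_reduce
  rw [← halfExp_mul_cexp]; simp

theorem fourier_halfExp {w s : ℂ} (h : 0 < s.im + w.im) :
    fourier (halfExp w) s = Complex.I / (s - (starRingEnd ℂ) w) := by
  have him : 0 < (s - (starRingEnd ℂ) w).im := by simpa using h
  have hne : s - (starRingEnd ℂ) w ≠ 0 := fun h0 => by rw [h0] at him; simp at him
  have h1 := fourier_indicator_Ici him 0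
  have e : fourier (halfExp w) s =
      fourier ((Ici 0).indicator fun _ => (1 : ℂ)) (s - (starRingEnd ℂ) w) :=
    integral_congr_ae (Eventually.of_forall fun x => halfExp_mul_cexp w s x)
  rw [e, eq_div_iff hne]
  simp only [Complex.ofReal_zero, mul_zero, zero_mul, Complex.exp_zero] at h1
  linear_combination Complex.I * h1 + fourier ((Ici 0).indicator fun _ => (1 : ℂ))
    (s - (starRingEnd ℂ) w) * (s - (starRingEnd ℂ) w) * Complex.I_sq

theorem integral_mul_conj_halfExp (g : ℝ → ℂ) (w : ℂ) :
    ∫ x, g x * (starRingEnd ℂ) (halfExp w x) = fourier ((Ici 0).indicator g) w := by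
  refine integral_congr_ae (Eventually.of_forall fun x => ?_)
  by_cases hx : x ∈ Ici (0 : ℝ)
  · simp only [halfExp, indicator_of_mem hx]
    rw [← Complex.exp_conj]
    congr 2
    simp
  · simp only [halfExp, indicator_of_notMem hx]; simp

/-- Functions in `L²(s, ∞)` are determined by their Fourier integrals. -/
theorem ae_eq_zero_of_fourier_eq_zero {f : ℝ → ℂ} (hf : MemLp f 2 volume) {s : ℝ}
    (hs : ∀ᵐ x, x < s → f x = 0) {v : ℝ} (hv : 0 < v)
    (h : ∀ u : ℝ, fourier f (u + v * Complex.I) = 0) : f =ᵐ[volume] 0 := by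
  have h1 := lintegral_fourier (integrable_mul_exp hf hs hv) (memLp_mul_exp hf hs hv)
  simp only [fourier_mul_exp, h, enorm_zero] at h1
  have h2 : ∫⁻ x, ‖f x * (Real.exp (-(x * v)) : ℂ)‖ₑ ^ 2 = 0 := by
    have h3 : ENNReal.ofReal (2 * Real.pi) ≠ 0 := by simpa using Real.pi_pos
    rw [zero_pow two_ne_zero, lintegral_zero] at h1
    exact (mul_eq_zero.1 h1.symm).resolve_left h3
  rw [lintegral_eq_zero_iff' ((memLp_mul_exp hf hs hv).1.enorm.pow_const 2)] at h2
  filter_upwards [h2] with x hx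
  simpa using hx

theorem lintegral_fourier_slice {f : ℝ → ℂ} (hf : MemLp f 2 volume) {s : ℝ}
    (hs : ∀ᵐ x, x < s → f x = 0) {v : ℝ} (hv : 0 < v) :
    ∫⁻ u : ℝ, ‖fourier f (u + v * Complex.I)‖ₑ ^ 2 =
      ENNReal.ofReal (2 * Real.pi) * ∫⁻ x, ‖f x * (Real.exp (-(x * v)) : ℂ)‖ₑ ^ 2 := by
  rw [← lintegral_fourier (integrable_mul_exp hf hs hv) (memLp_mul_exp hf hs hv)]
  simp only [fourier_mul_exp]

/-- The easy half of Paley–Wiener: Plancherel on each horizontal line, with damping factor at most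
one. -/
theorem mem_hardySpace_of_fourier {f : L2} (hf : f ∈ L2Above 0) {F : ℂ → ℂ}
    (hF : ∀ z ∈ upperHalf, F z = fourier f z) : F ∈ hardySpace := by
  refine ⟨(differentiableOn_fourier (Lp.memLp f) hf).congr hF, ?_⟩
  have hb : ∀ v : ℝ, 0 < v → ∫⁻ u : ℝ, ‖slice F v u‖ₑ ^ 2 ≤
      ENNReal.ofReal (2 * Real.pi) * ∫⁻ x, ‖f x‖ₑ ^ 2 := fun v hv => by
    have e : ∀ u : ℝ, slice F v u = fourier f (u + v * Complex.I) := fun u =>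
      hF _ (by simpa [upperHalf] using hv)
    simp only [e]
    rw [lintegral_fourier_slice (Lp.memLp f) hf hv]
    gcongr ENNReal.ofReal _ * ?_
    refine lintegral_mono_ae ?_
    filter_upwards [hf] with x hx
    gcongr
    rcases lt_or_ge x 0 with h | h
    · rw [hx h, zero_mul]
    · rw [enorm_mul]
      refine mul_le_of_le_one_right (zero_le) ?_
      rw [← ofReal_norm, Complex.norm_real, Real.norm_of_nonneg (Real.exp_nonneg _),
        ENNReal.ofReal_le_one, Real.exp_le_one_iff]
      have := mul_nonneg h hv.le
      linarith
  refine (iSup₂_le hb).trans_lt ?_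
  rw [lintegral_enorm_sq_eq]
  exact ENNReal.mul_lt_top ENNReal.ofReal_lt_top (by simp)

theorem hardySpace_sub_const_mul {F G : ℂ → ℂ} (hF : F ∈ hardySpace) (hG : G ∈ hardySpace) (a : ℂ) :
    (fun z => F z - a * G z) ∈ hardySpace := by
  obtain ⟨M, hM⟩ := exists_hardy_bound hF
  obtain ⟨N, hN⟩ := exists_hardy_bound hG
  refine ⟨hF.1.sub (hG.1.const_mul a), ?_⟩
  have hb : ∀ v : ℝ, 0 < v → ∫⁻ u : ℝ, ‖slice (fun z => F z - a * G z) v u‖ₑ ^ 2 ≤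
      2 * M + 2 * ‖a‖ₑ ^ 2 * N := fun v hv => by
    have hmF : Measurable fun u => ‖slice F v u‖ₑ ^ 2 :=
      ((continuous_slice hF.1 hv).measurable.enorm).pow_const 2
    have hmG : Measurable fun u => ‖slice G v u‖ₑ ^ 2 :=
      ((continuous_slice hG.1 hv).measurable.enorm).pow_const 2
    calc ∫⁻ u : ℝ, ‖slice (fun z => F z - a * G z) v u‖ₑ ^ 2
        ≤ ∫⁻ u : ℝ, (2 * ‖slice F v u‖ₑ ^ 2 + 2 * ‖a‖ₑ ^ 2 * ‖slice G v u‖ₑ ^ 2) := by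
          refine lintegral_mono fun u => ?_
          have h1 : ‖slice (fun z => F z - a * G z) v u‖ ^ 2 ≤
              2 * ‖slice F v u‖ ^ 2 + 2 * ‖a‖ ^ 2 * ‖slice G v u‖ ^ 2 := by
            have h2 : ‖slice (fun z => F z - a * G z) v u‖ ≤
                ‖slice F v u‖ + ‖a‖ * ‖slice G v u‖ := by
              rw [← norm_mul]; exact norm_sub_le _ _
            calc _ ≤ (‖slice F v u‖ + ‖a‖ * ‖slice G v u‖) ^ 2 := by gcongr
              _ ≤ _ := by nlinarith [sq_nonneg (‖slice F v u‖ - ‖a‖ * ‖slice G v u‖)]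
          have h3 := ENNReal.ofReal_le_ofReal h1
          rw [ENNReal.ofReal_add (by positivity) (by positivity),
            ENNReal.ofReal_mul (by positivity), ENNReal.ofReal_mul (by positivity),
            ENNReal.ofReal_mul (by positivity)] at h3
          simpa only [ENNReal.ofReal_pow (norm_nonneg _), ofReal_norm, ENNReal.ofReal_ofNat] using h3
      _ = 2 * (∫⁻ u : ℝ, ‖slice F v u‖ₑ ^ 2) + 2 * ‖a‖ₑ ^ 2 * ∫⁻ u : ℝ, ‖slice G v u‖ₑ ^ 2 := by
          rw [lintegral_add_left (hmF.const_mul _), lintegral_const_mul _ hmF,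
            lintegral_const_mul _ hmG]
      _ ≤ _ := by gcongr; exacts [hM v hv, hN v hv]
  refine (iSup₂_le hb).trans_lt ?_
  refine ENNReal.add_lt_top.2 ⟨ENNReal.mul_lt_top (by simp) (by simp),
    ENNReal.mul_lt_top (ENNReal.mul_lt_top (by simp) (by simp)) (by simp)⟩

theorem hardySpace_mul {F G : ℂ → ℂ} (hF : F ∈ hardySpace) (hG : DifferentiableOn ℂ G upperHalf)
    {C : ℝ} (hC : ∀ z ∈ upperHalf, ‖G z‖ ≤ C) : (fun z => G z * F z) ∈ hardySpace := by
  obtain ⟨M, hM⟩ := exists_hardy_bound hF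
  refine ⟨hG.mul hF.1, ?_⟩
  have hb : ∀ v : ℝ, 0 < v → ∫⁻ u : ℝ, ‖slice (fun z => G z * F z) v u‖ₑ ^ 2 ≤
      ENNReal.ofReal C ^ 2 * M := fun v hv => by
    calc ∫⁻ u : ℝ, ‖slice (fun z => G z * F z) v u‖ₑ ^ 2
        ≤ ∫⁻ u : ℝ, ENNReal.ofReal C ^ 2 * ‖slice F v u‖ₑ ^ 2 := by
          refine lintegral_mono fun u => ?_
          beta_reduce
          rw [slice, enorm_mul, mul_pow]
          gcongr
          · rw [← ofReal_norm]
            exact ENNReal.ofReal_le_ofReal (hC _ (by simpa [upperHalf] using hv))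
          · exact le_rfl
      _ = ENNReal.ofReal C ^ 2 * ∫⁻ u : ℝ, ‖slice F v u‖ₑ ^ 2 :=
          lintegral_const_mul _ (((continuous_slice hF.1 hv).measurable.enorm).pow_const 2)
      _ ≤ _ := by gcongr; exact hM v hv
  exact (iSup₂_le hb).trans_lt (ENNReal.mul_lt_top (by simp) (by simp))

theorem memLp_fourier_halfExp {w : ℂ} (hw : w ∈ upperHalf) :
    MemLp (fun u : ℝ => fourier (halfExp w) u) 2 volume := by
  have hc : Continuous fun u : ℝ => fourier (halfExp w) u := by
    have e : ∀ u : ℝ, fourier (halfExp w) u = Complex.I / (u - (starRingEnd ℂ) w) := fun u =>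
      fourier_halfExp (by simpa using (show 0 < w.im from hw))
    simp only [e]
    refine Continuous.div continuous_const (by fun_prop) fun u h0 => ?_
    have h1 := congrArg Complex.im h0
    have hw : 0 < w.im := hw
    simp at h1; linarith
  refine memLp_of_lintegral_sq_lt_top hc.aestronglyMeasurable ?_
  rw [lintegral_fourier (integrable_halfExp hw) (memLp_halfExp hw), lintegral_sq_eq_eLpNorm_sq]
  exact ENNReal.mul_lt_top ENNReal.ofReal_lt_top (ENNReal.pow_lt_top (memLp_halfExp hw).2)

/-- The Cauchy formula for Hardy space functions. -/
theorem integral_slice_mul_conj_fourier_halfExp {F : ℂ → ℂ} (hF : F ∈ hardySpace) {z : ℂ} {v : ℝ}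
    (hv : 0 < v) (hvz : v < z.im) : ∫ u, slice F v u *
      (starRingEnd ℂ) (fourier (halfExp (z - v * Complex.I)) u) = 2 * Real.pi * F z := by
  have hz : z ∈ upperHalf := hv.trans hvz
  have hw : z - v * Complex.I ∈ upperHalf := by simpa [upperHalf] using hvz
  have hI : Complex.I ∈ upperHalf := by simp [upperHalf]
  -- A Hardy function with known transform and no zero in the half-plane. Subtracting a multiple of
  -- it makes F vanish at z, so Cauchy's theorem applies, while for m itself the formula is
  -- Parseval.
  let m := fourier (halfExp Complex.I)
  have hm : m ∈ hardySpace := mem_hardySpace_of_fourier (f := (memLp_halfExp hI).toLp _)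
    (by
      filter_upwards [(memLp_halfExp hI).coeFn_toLp] with x h1 h2
      rw [h1, halfExp_of_neg _ h2]) fun s _ => by
        rw [fourier_congr_ae (memLp_halfExp hI).coeFn_toLp]
  have hmz : m z ≠ 0 := by
    have hz0 : 0 < z.im := hz
    simp only [m]
    rw [fourier_halfExp (by simp; linarith)]
    refine div_ne_zero Complex.I_ne_zero fun h0 => ?_
    have := congrArg Complex.im h0
    simp at this; linarith
  let a := F z / m z
  have hFm := hardySpace_sub_const_mul hF hm a
  have h0 := integral_slice_dslope_eq_zero hFm hz (by simp only [a]; field_simp; ring) hv hvz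
  have hconj : ∀ u : ℝ, (starRingEnd ℂ) (fourier (halfExp (z - v * Complex.I)) u) =
      -Complex.I / (u + v * Complex.I - z) := fun u => by
    rw [fourier_halfExp (by simpa using hvz), map_div₀, map_sub, Complex.conj_conj,
      Complex.conj_ofReal, Complex.conj_I]
    congr 1; ring
  have h1 : ∫ u, slice (fun z => F z - a * m z) v u *
      (starRingEnd ℂ) (fourier (halfExp (z - v * Complex.I)) u) = 0 := by
    rw [← mul_zero (-Complex.I), ← h0, ← integral_const_mul]
    refine integral_congr_ae (Eventually.of_forall fun u => ?_)
    have hne : (u : ℂ) + v * Complex.I ≠ z := fun h2 => by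
      have := congrArg Complex.im h2
      simp at this; linarith
    have hz0 : F z - a * m z = 0 := by simp only [a]; field_simp; ring
    beta_reduce
    rw [hconj, slice, slice, dslope_of_ne _ hne, slope_def_field, hz0, sub_zero]
    ring
  have hL2 := memLp_fourier_halfExp hw
  have hL2' : MemLp (fun u : ℝ => (starRingEnd ℂ) (fourier (halfExp (z - v * Complex.I)) u)) 2
      volume := hL2.star
  have i1 : Integrable fun u => slice F v u *
      (starRingEnd ℂ) (fourier (halfExp (z - v * Complex.I)) u) :=
    (memLp_slice hF hv).integrable_mul hL2'
  have i2 : Integrable fun u => slice m v u *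
      (starRingEnd ℂ) (fourier (halfExp (z - v * Complex.I)) u) :=
    (memLp_slice hm hv).integrable_mul hL2'
  have h2 : ∫ u, slice m v u * (starRingEnd ℂ) (fourier (halfExp (z - v * Complex.I)) u) =
      2 * Real.pi * m z := by
    have hneg : ∀ᵐ x : ℝ, x < 0 → halfExp Complex.I x = 0 :=
      Eventually.of_forall fun x hx => halfExp_of_neg _ hx
    have := integral_fourier_mul_conj (integrable_mul_exp (memLp_halfExp hI) hneg hv)
      (memLp_mul_exp (memLp_halfExp hI) hneg hv) (integrable_halfExp hw) (memLp_halfExp hw)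
    simp only [fourier_mul_exp] at this
    refine Eq.trans this ?_
    congr 1
    rw [integral_mul_conj_halfExp]
    refine integral_congr_ae (Eventually.of_forall fun x => ?_)
    by_cases hx : x ∈ Ici (0 : ℝ)
    · beta_reduce
      rw [indicator_of_mem hx, mul_assoc, Complex.ofReal_exp, ← Complex.exp_add]
      congr 2
      push_cast
      linear_combination (-(x : ℂ) * v) * Complex.I_sq
    · simp only [halfExp, indicator_of_notMem hx, zero_mul]
  have h3 : ∫ u, slice (fun z => F z - a * m z) v u *
      (starRingEnd ℂ) (fourier (halfExp (z - v * Complex.I)) u) =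
      (∫ u, slice F v u * (starRingEnd ℂ) (fourier (halfExp (z - v * Complex.I)) u)) -
      a * ∫ u, slice m v u * (starRingEnd ℂ) (fourier (halfExp (z - v * Complex.I)) u) := by
    rw [← integral_const_mul, ← integral_sub i1 (i2.const_mul a)]
    refine integral_congr_ae (Eventually.of_forall fun u => ?_)
    simp only [slice]; ring
  rw [h1, h2] at h3
  have h4 : a * m z = F z := by simp only [a]; field_simp
  linear_combination -h3 + 2 * Real.pi * h4

/-- A continuous function in `L²(ℝ)` is a Fourier transform, in the weak sense. -/
theorem exists_fourier_dual {Φ : ℝ → ℂ} (hΦc : Continuous Φ) (hΦ : MemLp Φ 2 volume) :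
    ∃ g : L2, ∀ h : ℝ → ℂ, Integrable h → MemLp h 2 volume →
      ∫ u : ℝ, Φ u * (starRingEnd ℂ) (fourier h u) = 2 * Real.pi * ∫ x, g x * (starRingEnd ℂ) (h x) := by
  have hne : -(2 * Real.pi) ≠ 0 := by simp
  -- The dilation by -2π compensates for the normalisation of `𝓕`.
  have hG : MemLp (fun y : ℝ => Φ (-(2 * Real.pi) * y)) 2 volume := by
    rw [memLp_two_iff_integrable_sq_norm (by fun_prop : Continuous fun y : ℝ =>
      Φ (-(2 * Real.pi) * y)).aestronglyMeasurable]
    rw [memLp_two_iff_integrable_sq_norm hΦ.1] at hΦ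
    exact hΦ.comp_mul_left' hne
  refine ⟨𝓕⁻ (hG.toLp _), fun h h1 h2 => ?_⟩
  have e0 := Lp.inner_fourier_eq (h2.toLp h) (𝓕⁻ (hG.toLp _) : L2)
  rw [FourierTransform.fourier_fourierInv_eq, inner_L2_eq, inner_L2_eq] at e0
  have e1 : ∫ x, (𝓕⁻ (hG.toLp _) : L2) x * (starRingEnd ℂ) (h2.toLp h x) =
      ∫ x, (𝓕⁻ (hG.toLp _) : L2) x * (starRingEnd ℂ) (h x) := by
    refine integral_congr_ae ?_
    filter_upwards [h2.coeFn_toLp] with x hx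
    rw [hx]
  have e2 : ∫ x, (hG.toLp _) x * (starRingEnd ℂ) ((𝓕 (h2.toLp h) : L2) x) =
      ∫ y : ℝ, Φ (-(2 * Real.pi) * y) * (starRingEnd ℂ) (𝓕 h y) := by
    refine integral_congr_ae ?_
    filter_upwards [hG.coeFn_toLp, coeFn_fourier_toLp h1 h2] with x hx hx2
    rw [hx, hx2]
  have e3 : ∀ y : ℝ, 𝓕 h y = fourier h (-(2 * Real.pi) * y : ℝ) := fun y => by
    rw [fourier_eq_fourierIntegral]
    have := Real.pi_pos
    field_simp
  rw [← e1, ← e0, e2]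
  simp only [e3]
  rw [Measure.integral_comp_mul_left (fun u : ℝ => Φ u * (starRingEnd ℂ) (fourier h u))]
  rw [inv_neg, abs_neg, abs_of_pos (by positivity), Complex.real_smul]
  push_cast
  rw [← mul_assoc, mul_inv_cancel₀ (by exact_mod_cast Real.two_pi_pos.ne'), one_mul]

/-- The L² function g dual to the slice may live on the whole line, but the Cauchy kernels are
transforms of functions on [0,∞) and see only the part of g there. That part already reproduces F
above height v. -/
theorem exists_fourier_of_slice {F : ℂ → ℂ} (hF : F ∈ hardySpace) {v : ℝ} (hv : 0 < v) :
    ∃ h : ℝ → ℂ, MemLp h 2 volume ∧ (∀ᵐ x, x < 0 → h x = 0) ∧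
      ∀ z ∈ upperHalf, fourier h z = F (z + v * Complex.I) := by
  obtain ⟨g, hg⟩ := exists_fourier_dual (continuous_slice hF.1 hv) (memLp_slice hF hv)
  refine ⟨(Ici 0).indicator g, (Lp.memLp g).indicator measurableSet_Ici,
    Eventually.of_forall fun x hx => indicator_of_notMem (not_le.2 hx) _, fun z hz => ?_⟩
  have h1 := integral_slice_mul_conj_fourier_halfExp hF (z := z + v * Complex.I) hv (by
    have hz : 0 < z.im := hz
    simpa using hz)
  rw [add_sub_cancel_right, hg _ (integrable_halfExp hz) (memLp_halfExp hz),
    integral_mul_conj_halfExp] at h1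
  exact mul_left_cancel₀ (mul_ne_zero two_ne_zero (by exact_mod_cast Real.pi_ne_zero)) h1

/-- The Paley–Wiener theorem for the upper half-plane. -/
theorem exists_fourier_of_mem_hardySpace {F : ℂ → ℂ} (hF : F ∈ hardySpace) :
    ∃ g ∈ L2Above 0, ∀ z ∈ upperHalf, F z = fourier g z := by
  obtain ⟨M, hM⟩ := exists_hardy_bound hF
  choose! h hm h0 hh using fun (v : ℝ) (hv : 0 < v) => exists_fourier_of_slice hF hv
  -- The function found at height v should be g damped by exp(-xv), so the one at height 1
  -- determines the candidate. Injectivity of the transform shows that all heights below 1 agree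
  -- with it.
  let g : ℝ → ℂ := fun x => h 1 x * (Real.exp x : ℂ)
  have hgv : ∀ v, 0 < v → v < 1 → ∀ᵐ x : ℝ, g x * (Real.exp (-(x * v)) : ℂ) = h v x := by
    intro v hv hv1
    have hv' : 0 < 1 - v := by linarith
    have hd := (memLp_mul_exp (hm v hv) (h0 v hv) hv').sub (hm 1 one_pos)
    have hd0 : ∀ᵐ x : ℝ, x < 0 → ((fun x => h v x * (Real.exp (-(x * (1 - v))) : ℂ)) - h 1) x = 0 := by
      filter_upwards [h0 v hv, h0 1 one_pos] with x h1 h2 hx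
      rw [Pi.sub_apply, h1 hx, h2 hx]; simp
    have hz := ae_eq_zero_of_fourier_eq_zero hd hd0 one_pos fun u => by
      have hz1 : (u : ℂ) + (1 : ℝ) * Complex.I ∈ upperHalf := by simp [upperHalf]
      have hz2 : (u : ℂ) + (1 : ℝ) * Complex.I + (1 - v : ℝ) * Complex.I ∈ upperHalf := by
        simp [upperHalf]; linarith
      have i1 := (integrable_mul_cexp_iff (hm v hv).1 ((u : ℂ) + (1 : ℝ) * Complex.I +
        (1 - v : ℝ) * Complex.I)).2 (integrable_norm_mul_exp (hm v hv) (h0 v hv) hz2)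
      have i2 := (integrable_mul_cexp_iff (hm 1 one_pos).1 ((u : ℂ) + (1 : ℝ) * Complex.I)).2
        (integrable_norm_mul_exp (hm 1 one_pos) (h0 1 one_pos) hz1)
      have e : fourier ((fun x => h v x * (Real.exp (-(x * (1 - v))) : ℂ)) - h 1)
          (u + (1 : ℝ) * Complex.I) = fourier (h v) ((u : ℂ) + (1 : ℝ) * Complex.I +
            (1 - v : ℝ) * Complex.I) - fourier (h 1) (u + (1 : ℝ) * Complex.I) := by
        rw [fourier, fourier, fourier, ← integral_sub i1 i2]
        refine integral_congr_ae (Eventually.of_forall fun x => ?_)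
        beta_reduce
        have : (Real.exp (-(x * (1 - v))) : ℂ) * Complex.exp (Complex.I * x *
            ((u : ℂ) + (1 : ℝ) * Complex.I)) = Complex.exp (Complex.I * x *
            ((u : ℂ) + (1 : ℝ) * Complex.I + (1 - v : ℝ) * Complex.I)) := by
          rw [Complex.ofReal_exp, ← Complex.exp_add]
          congr 1
          push_cast
          linear_combination (-(x : ℂ) * (1 - v)) * Complex.I_sq
        rw [Pi.sub_apply, sub_mul, mul_assoc, this]
      rw [e, hh v hv _ hz2, hh 1 one_pos _ hz1, sub_eq_zero]
      congr 1
      push_cast; ring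
    filter_upwards [hz] with x hx
    have hx' : h 1 x = h v x * (Real.exp (-(x * (1 - v))) : ℂ) := (sub_eq_zero.1 hx).symm
    simp only [g]
    rw [hx', mul_assoc, mul_assoc, ← Complex.ofReal_mul, ← Complex.ofReal_mul, ← Real.exp_add,
      ← Real.exp_add]
    have : -(x * (1 - v)) + (x + -(x * v)) = 0 := by ring
    rw [this]; simp
  have hg0 : ∀ᵐ x, x < 0 → g x = 0 := by
    filter_upwards [h0 1 one_pos] with x hx hlt
    simp only [g]; rw [hx hlt, zero_mul]
  have hgm : AEStronglyMeasurable g volume :=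
    (hm 1 one_pos).1.mul (by fun_prop : Continuous fun x : ℝ => (Real.exp x : ℂ)).aestronglyMeasurable
  have hbound : ∀ y, 0 < y → y < 1 →
      ∫⁻ x, ‖g x * (Real.exp (-(x * y)) : ℂ)‖ₑ ^ 2 ≤ M := by
    intro y hy hy1
    -- Half of the damping turns g into `h (y / 2)`; the other half moves the transform of the
    -- latter up to height y, where the Hardy bound applies.
    have hy2 : 0 < y / 2 := by positivity
    have e1 : ∫⁻ x, ‖g x * (Real.exp (-(x * y)) : ℂ)‖ₑ ^ 2 =
        ∫⁻ x, ‖h (y / 2) x * (Real.exp (-(x * (y / 2))) : ℂ)‖ₑ ^ 2 := by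
      refine lintegral_congr_ae ?_
      filter_upwards [hgv (y / 2) hy2 (by linarith)] with x hx
      rw [← hx, mul_assoc (g x), ← Complex.ofReal_mul, ← Real.exp_add]
      rw [show -(x * (y / 2)) + -(x * (y / 2)) = -(x * y) by ring]
    have e2 := lintegral_fourier_slice (hm _ hy2) (h0 _ hy2) hy2
    have e3 : ∀ u : ℝ, fourier (h (y / 2)) (u + (y / 2 : ℝ) * Complex.I) = slice F y u := fun u => by
      rw [hh _ hy2 _ (by simpa [upperHalf] using hy), slice]
      congr 1; push_cast; ring
    simp only [e3] at e2
    rw [e1]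
    refine le_trans ?_ ((e2.symm.trans_le (hM y hy)))
    refine le_mul_of_one_le_left (zero_le) ?_
    rw [ENNReal.one_le_ofReal]
    linarith [Real.pi_gt_three]
  -- The bound is uniform in the damping, and Fatou removes the damping.
  have hgL : MemLp g 2 volume := by
    refine memLp_of_lintegral_sq_lt_top hgm ?_
    let y : ℕ → ℝ := fun n => 1 / ((n : ℝ) + 2)
    have hy0 : ∀ n, 0 < y n := fun n => by positivity
    have hy1 : ∀ n, y n < 1 := fun n => by
      simp only [y]; rw [div_lt_one (by positivity)]; linarith [(n.cast_nonneg : (0 : ℝ) ≤ n)]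
    have hyl : Tendsto y atTop (𝓝 0) := by
      have := (tendsto_add_atTop_iff_nat (f := fun n : ℕ => 1 / ((n : ℝ) + 1)) 1).2
        tendsto_one_div_add_atTop_nhds_zero_nat
      refine this.congr fun n => ?_
      simp only [y]; push_cast; congr 1; ring
    have hlim : ∀ x, Tendsto (fun n => ‖g x * (Real.exp (-(x * y n)) : ℂ)‖ₑ ^ 2) atTop
        (𝓝 (‖g x‖ₑ ^ 2)) := fun x => by
      have hc : Continuous fun s : ℝ => ‖g x * (Real.exp (-(x * s)) : ℂ)‖ₑ ^ 2 := by fun_prop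
      have := (hc.tendsto 0).comp hyl
      simpa [Function.comp_def] using this
    calc ∫⁻ x, ‖g x‖ₑ ^ 2
        = ∫⁻ x, liminf (fun n => ‖g x * (Real.exp (-(x * y n)) : ℂ)‖ₑ ^ 2) atTop :=
          lintegral_congr fun x => (hlim x).liminf_eq.symm
      _ ≤ liminf (fun n => ∫⁻ x, ‖g x * (Real.exp (-(x * y n)) : ℂ)‖ₑ ^ 2) atTop :=
          lintegral_liminf_le' fun n => ((hgm.mul (by fun_prop : Continuous fun x : ℝ =>
            (Real.exp (-(x * y n)) : ℂ)).aestronglyMeasurable).enorm.pow_const 2)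
      _ ≤ M := by
          refine (liminf_le_liminf (Eventually.of_forall fun n => hbound _ (hy0 n) (hy1 n))).trans ?_
          simp
      _ < ⊤ := by simp
  refine ⟨hgL.toLp g, ?_, fun z hz => ?_⟩
  · filter_upwards [hgL.coeFn_toLp, hg0] with x h1 h2 hx
    rw [h1, h2 hx]
  · rw [fourier_congr_ae hgL.coeFn_toLp]
    have hz0 : 0 < z.im := hz
    let v := min z.im 1 / 2
    have hv : 0 < v := by positivity
    have hv1 : v < 1 := by
      have := min_le_right z.im 1
      simp only [v]; linarith
    have hvz : v < z.im := by
      have := min_le_left z.im 1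
      simp only [v]; linarith
    have e : fourier g z = fourier (h v) (z - v * Complex.I) := by
      refine integral_congr_ae ?_
      filter_upwards [hgv v hv hv1] with x hx
      have h1 : (Real.exp (-(x * v)) : ℂ) * Complex.exp (Complex.I * x * (z - v * Complex.I)) =
          Complex.exp (Complex.I * x * z) := by
        rw [Complex.ofReal_exp, ← Complex.exp_add]
        congr 1
        push_cast
        linear_combination (-(x : ℂ) * v) * Complex.I_sq
      rw [← hx, mul_assoc (g x), h1]
    rw [e, hh v hv _ (by simpa [upperHalf] using hvz), sub_add_cancel]

/-- The inner product of the Hardy space is the inner product of the inverse Fourier transforms. -/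
theorem tendsto_integral_slice {f g : L2} (hf : f ∈ L2Above 0) (hg : g ∈ L2Above 0) {F G : ℂ → ℂ}
    (hF : ∀ z ∈ upperHalf, F z = fourier f z) (hG : ∀ z ∈ upperHalf, G z = fourier g z) :
    Tendsto (fun v : ℝ => ∫ u : ℝ, slice F v u * (starRingEnd ℂ) (slice G v u)) (𝓝[>] 0)
      (𝓝 (2 * Real.pi * inner ℂ g f)) := by
  have hint : Integrable fun x => f x * (starRingEnd ℂ) (g x) :=
    (Lp.memLp f).integrable_mul (Lp.memLp g).star
  have h1 : Tendsto (fun v : ℝ => ∫ x, (f x * (Real.exp (-(x * v)) : ℂ)) *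
      (starRingEnd ℂ) (g x * (Real.exp (-(x * v)) : ℂ))) (𝓝[>] 0)
      (𝓝 (∫ x, f x * (starRingEnd ℂ) (g x))) := by
    refine tendsto_integral_filter_of_dominated_convergence
      (fun x => ‖f x * (starRingEnd ℂ) (g x)‖) ?_ ?_ hint.norm ?_
    · refine Eventually.of_forall fun v => ?_
      have hc : AEStronglyMeasurable (fun x : ℝ => (Real.exp (-(x * v)) : ℂ)) volume :=
        (by fun_prop : Continuous fun x : ℝ => (Real.exp (-(x * v)) : ℂ)).aestronglyMeasurable
      exact ((Lp.memLp f).1.mul hc).mul ((Lp.memLp g).1.mul hc).star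
    · filter_upwards [self_mem_nhdsWithin] with v hv
      have hv : 0 < v := hv
      filter_upwards [hf] with x hx
      rcases lt_or_ge x 0 with h | h
      · rw [hx h]; simp
      · have h2 : ‖(Real.exp (-(x * v)) : ℂ)‖ ≤ 1 := by
          rw [Complex.norm_real, Real.norm_of_nonneg (Real.exp_nonneg _), Real.exp_le_one_iff]
          have := mul_nonneg h hv.le
          linarith
        rw [norm_mul, norm_mul, RCLike.norm_conj, norm_mul, norm_mul, RCLike.norm_conj]
        exact mul_le_mul (mul_le_of_le_one_right (norm_nonneg _) h2)
          (mul_le_of_le_one_right (norm_nonneg _) h2) (by positivity) (norm_nonneg _)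
    · refine Eventually.of_forall fun x => ?_
      have hc : Continuous fun v : ℝ => (f x * (Real.exp (-(x * v)) : ℂ)) *
        (starRingEnd ℂ) (g x * (Real.exp (-(x * v)) : ℂ)) := by
        refine Continuous.mul (by fun_prop) (Complex.continuous_conj.comp (by fun_prop))
      have := (hc.tendsto 0).mono_left (nhdsWithin_le_nhds (s := Ioi 0))
      simpa using this
  rw [inner_L2_eq]
  refine (h1.const_mul (2 * Real.pi : ℂ)).congr' ?_
  filter_upwards [self_mem_nhdsWithin] with v hv
  have hv : 0 < v := hv
  rw [← integral_fourier_mul_conj (integrable_mul_exp (Lp.memLp f) hf hv)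
    (memLp_mul_exp (Lp.memLp f) hf hv) (integrable_mul_exp (Lp.memLp g) hg hv)
    (memLp_mul_exp (Lp.memLp g) hg hv)]
  refine integral_congr_ae (Eventually.of_forall fun u => ?_)
  have hmem : (u : ℂ) + v * Complex.I ∈ upperHalf := by simpa [upperHalf] using hv
  beta_reduce
  rw [fourier_mul_exp, fourier_mul_exp, slice, slice, hF _ hmem, hG _ hmem]

/-! ### Families of vectors with the same Gram matrix -/

section gram

variable {ι H : Type*} [NormedAddCommGroup H] [InnerProductSpace ℂ H] {a b : ι → H}

theorem inner_linearCombination_eq (hab : ∀ i j, inner ℂ (a i) (a j) = inner ℂ (b i) (b j)) (i : ι)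
    (x : ι →₀ ℂ) : inner ℂ (b i) (Finsupp.linearCombination ℂ b x) =
      inner ℂ (a i) (Finsupp.linearCombination ℂ a x) := by
  induction x using Finsupp.induction_linear with
  | zero => simp
  | add x y hx hy => rw [map_add, map_add, inner_add_right, inner_add_right, hx, hy]
  | single j s => simp [hab]

theorem norm_linearCombination_eq (hab : ∀ i j, inner ℂ (a i) (a j) = inner ℂ (b i) (b j))
    (x : ι →₀ ℂ) : ‖Finsupp.linearCombination ℂ b x‖ = ‖Finsupp.linearCombination ℂ a x‖ := by
  have h : ∀ y : ι →₀ ℂ, inner ℂ (Finsupp.linearCombination ℂ b y) (Finsupp.linearCombination ℂ b x) =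
      inner ℂ (Finsupp.linearCombination ℂ a y) (Finsupp.linearCombination ℂ a x) := fun y => by
    induction y using Finsupp.induction_linear with
    | zero => simp
    | add y z hy hz => rw [map_add, map_add, inner_add_left, inner_add_left, hy, hz]
    | single j s =>
      rw [Finsupp.linearCombination_single, Finsupp.linearCombination_single, inner_smul_left,
        inner_smul_left, inner_linearCombination_eq hab]
  rw [norm_eq_sqrt_re_inner (𝕜 := ℂ), norm_eq_sqrt_re_inner (𝕜 := ℂ), h]

/-- If `a` is total in `U` and has the Gram matrix of a family `b` in a closed subspace `W`, then
the coordinates of an element of `U` are the coordinates of an element of `W`. -/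
theorem exists_inner_eq_of_gram_eq [CompleteSpace H]
    (hab : ∀ i j, inner ℂ (a i) (a j) = inner ℂ (b i) (b j)) {U W : Submodule ℂ H}
    (haU : ∀ i, a i ∈ U) (htot : ∀ g ∈ U, (∀ i, inner ℂ (a i) g = 0) → g = 0)
    (hbW : ∀ i, b i ∈ W) (hU : IsClosed (U : Set H)) (hW : IsClosed (W : Set H))
    {f : H} (hf : f ∈ U) : ∃ g ∈ W, ∀ i, inner ℂ (b i) g = inner ℂ (a i) f := by
  let S := (Submodule.span ℂ (range a)).topologicalClosure
  have hSU : S ≤ U := Submodule.topologicalClosure_minimal _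
    (Submodule.span_le.2 (range_subset_iff.2 haU)) hU
  have : CompleteSpace S := (Submodule.isClosed_topologicalClosure _).completeSpace_coe
  have hfS : f ∈ S := by
    -- Totality within U: the component of f orthogonal to the closed span is annihilated by every a
    -- i and still lies in U.
    have h0 : f - S.starProjection f = 0 :=
      htot _ (U.sub_mem hf (hSU (S.starProjection_apply_mem f))) fun i =>
        S.inner_right_of_mem_orthogonal
          (Submodule.le_topologicalClosure _ (Submodule.subset_span (mem_range_self i)))
          (S.sub_starProjection_mem_orthogonal f)
    rw [sub_eq_zero.1 h0]
    exact S.starProjection_apply_mem f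
  obtain ⟨y, hy, hlim⟩ := mem_closure_iff_seq_limit.1 (show f ∈ closure _ from hfS)
  have hy' : ∀ n, ∃ x, Finsupp.linearCombination ℂ a x = y n := fun n => by
    have := hy n
    rwa [SetLike.mem_coe, ← Finsupp.range_linearCombination] at this
  choose x hx using hy'
  -- Equal Gram matrices give equal norms for equal coefficients, so approximating combinations of
  -- the a i become a Cauchy sequence of combinations of the b i.
  let z := fun n => Finsupp.linearCombination ℂ b (x n)
  have hz : CauchySeq z := by
    have hc := hlim.cauchySeq
    rw [cauchySeq_iff_tendsto_dist_atTop_0] at hc ⊢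
    refine hc.congr fun n => ?_
    rw [dist_eq_norm, dist_eq_norm, ← hx, ← hx, ← map_sub, ← map_sub, norm_linearCombination_eq hab]
  obtain ⟨g, hg⟩ := cauchySeq_tendsto_of_complete hz
  refine ⟨g, hW.mem_of_tendsto hg (Eventually.of_forall fun n => ?_), fun i => ?_⟩
  · exact Submodule.span_le.2 (range_subset_iff.2 hbW)
      (Finsupp.range_linearCombination (R := ℂ) (v := b) ▸ LinearMap.mem_range_self _ (x n))
  · refine tendsto_nhds_unique (tendsto_const_nhds.inner hg) ?_
    refine (tendsto_const_nhds.inner hlim).congr fun n => ?_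
    rw [← hx, inner_linearCombination_eq hab]

end gram

/-! ### Model subspaces -/

theorem fourier_injective_of_mem {f : L2} {s : ℝ} (hf : f ∈ L2Above s)
    (h : ∀ z ∈ upperHalf, fourier f z = 0) : f = 0 := by
  have h1 := ae_eq_zero_of_fourier_eq_zero (Lp.memLp f) hf one_pos fun u => h _ (by simp [upperHalf])
  exact Lp.ext (h1.trans (Lp.coeFn_zero ..).symm)

/-- The Szegő kernel of `L²(0, ∞)`. -/
noncomputable def szego {w : ℂ} (hw : w ∈ upperHalf) : L2 := (memLp_halfExp hw).toLp _

theorem szego_mem {w : ℂ} (hw : w ∈ upperHalf) : szego hw ∈ L2Above 0 := by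
  filter_upwards [(memLp_halfExp hw).coeFn_toLp] with x h1 h2
  rw [szego, h1, halfExp_of_neg _ h2]

theorem fourier_szego {w : ℂ} (hw : w ∈ upperHalf) {z : ℂ} (hz : z ∈ upperHalf) :
    fourier (szego hw) z = Complex.I / (z - (starRingEnd ℂ) w) := by
  rw [szego, fourier_congr_ae (memLp_halfExp hw).coeFn_toLp,
    fourier_halfExp (add_pos (show 0 < z.im from hz) (show 0 < w.im from hw))]

theorem inner_szego {w : ℂ} (hw : w ∈ upperHalf) {g : L2} (hg : g ∈ L2Above 0) :
    inner ℂ (szego hw) g = fourier g w := by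
  have h1 : (Ici (0 : ℝ)).indicator g =ᵐ[volume] g := by
    filter_upwards [hg] with x hx
    by_cases h : x ∈ Ici (0 : ℝ)
    · rw [indicator_of_mem h]
    · rw [indicator_of_notMem h, hx (not_le.1 h)]
  rw [inner_L2_eq, ← fourier_congr_ae h1, ← integral_mul_conj_halfExp]
  refine integral_congr_ae ?_
  filter_upwards [(memLp_halfExp hw).coeFn_toLp] with x hx
  rw [szego, hx]

theorem fourier_mem_hardySpace {f : L2} (hf : f ∈ L2Above 0) : fourier f ∈ hardySpace :=
  mem_hardySpace_of_fourier hf fun _ _ => rfl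

/-- The elements of `L²(0, ∞)` whose Fourier integrals lie in `θ H²`. -/
noncomputable def innerRange (θ : ℂ → ℂ) : Set L2 :=
  {s | s ∈ L2Above 0 ∧ ∃ h ∈ L2Above 0, ∀ z ∈ upperHalf, fourier s z = θ z * fourier h z}

/-- The inverse Fourier transform of the model subspace. -/
noncomputable def modelSubmodule (θ : ℂ → ℂ) : Submodule ℂ L2 :=
  aboveSubmodule 0 ⊓ (Submodule.span ℂ (innerRange θ))ᗮ

theorem isClosed_modelSubmodule (θ : ℂ → ℂ) : IsClosed (modelSubmodule θ : Set L2) :=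
  (isClosed_aboveSubmodule 0).inter (Submodule.isClosed_orthogonal _)

theorem mem_modelSubmodule {θ : ℂ → ℂ} {g : L2} :
    g ∈ modelSubmodule θ ↔ g ∈ L2Above 0 ∧ ∀ s ∈ innerRange θ, inner ℂ s g = 0 := by
  rw [modelSubmodule, Submodule.mem_inf, mem_aboveSubmodule]
  refine and_congr_right fun _ => ⟨fun h s hs => h s (Submodule.subset_span hs), fun h => ?_⟩
  rw [Submodule.mem_orthogonal]
  intro u hu
  have : Submodule.span ℂ (innerRange θ) ≤ (Submodule.span ℂ {g})ᗮ := Submodule.span_le.2 fun s hs =>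
    Submodule.mem_orthogonal_singleton_iff_inner_left.2 (h s hs)
  exact Submodule.mem_orthogonal_singleton_iff_inner_left.1 (this hu)

section inner

variable {θ : ℂ → ℂ} (hθ : IsInner θ)
include hθ

theorem exists_innerRange {h : L2} (hh : h ∈ L2Above 0) :
    ∃ s ∈ L2Above 0, ∀ z ∈ upperHalf, fourier s z = θ z * fourier h z := by
  obtain ⟨M, hM⟩ := hθ.bounded
  obtain ⟨s, hs, hs2⟩ := exists_fourier_of_mem_hardySpace
    (hardySpace_mul (fourier_mem_hardySpace hh) hθ.differentiableOn hM)
  exact ⟨s, hs, fun z hz => (hs2 z hz).symm⟩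

/-- Dominated convergence: θ is bounded, and each Szegő kernel is dominated on horizontal lines by
its explicit boundary function. This avoids boundary values of general Hardy functions. -/
theorem tendsto_integral_defect {w : ℂ} (hw : w ∈ upperHalf) :
    Tendsto (fun v : ℝ => ∫ u : ℝ, (‖(1 - ‖slice θ v u‖ ^ 2 : ℝ)‖ *
      ‖slice (fourier (szego hw)) v u‖) ^ 2) (𝓝[>] 0) (𝓝 0) := by
  obtain ⟨M, hM⟩ := hθ.bounded
  have hw0 : 0 < w.im := hw
  have hbI : Integrable fun u : ℝ => (1 + M ^ 2) ^ 2 * ‖fourier (halfExp w) u‖ ^ 2 :=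
    ((memLp_two_iff_integrable_sq_norm (memLp_fourier_halfExp hw).1).1
      (memLp_fourier_halfExp hw)).const_mul _
  have hmem : ∀ (v u : ℝ), 0 < v → (u : ℂ) + v * Complex.I ∈ upperHalf := fun v u hv => by
    simpa [upperHalf] using hv
  suffices h : Tendsto (fun v : ℝ => ∫ u : ℝ, (‖(1 - ‖slice θ v u‖ ^ 2 : ℝ)‖ *
      ‖slice (fourier (szego hw)) v u‖) ^ 2) (𝓝[>] 0) (𝓝 (∫ _ : ℝ, (0 : ℝ))) by
    rwa [integral_zero] at h
  have hle : ∀ v u : ℝ, 0 < v →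
      ‖slice (fourier (szego hw)) v u‖ ≤ ‖fourier (halfExp w) u‖ := fun v u hv => by
    rw [slice, fourier_szego hw (hmem v u hv), fourier_halfExp (by simpa using hw0), norm_div,
      norm_div]
    have hpos : 0 < ‖(u : ℂ) - (starRingEnd ℂ) w‖ := norm_pos_iff.2 fun h0 => by
      have := congrArg Complex.im h0
      simp at this; linarith
    refine div_le_div_of_nonneg_left (norm_nonneg _) hpos ?_
    rw [Complex.norm_eq_sqrt_sq_add_sq, Complex.norm_eq_sqrt_sq_add_sq]
    refine Real.sqrt_le_sqrt ?_
    simp only [Complex.sub_re, Complex.add_re, Complex.sub_im, Complex.add_im, Complex.ofReal_re,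
      Complex.ofReal_im, Complex.mul_re, Complex.mul_im, Complex.I_re, Complex.I_im, Complex.conj_re,
      Complex.conj_im]
    nlinarith [mul_pos hv hw0]
  refine tendsto_integral_filter_of_dominated_convergence _ ?_ ?_ hbI ?_
  · filter_upwards [self_mem_nhdsWithin] with v hv
    have c1 := continuous_slice hθ.differentiableOn hv
    have c2 := continuous_slice (fourier_mem_hardySpace (szego_mem hw)).1 hv
    exact (by fun_prop : Continuous fun u : ℝ => (‖(1 - ‖slice θ v u‖ ^ 2 : ℝ)‖ *
      ‖slice (fourier (szego hw)) v u‖) ^ 2).aestronglyMeasurable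
  · filter_upwards [self_mem_nhdsWithin] with v hv
    refine Eventually.of_forall fun u => ?_
    rw [Real.norm_of_nonneg (by positivity), mul_pow]
    have h1 : ‖(1 - ‖slice θ v u‖ ^ 2 : ℝ)‖ ≤ 1 + M ^ 2 := by
      refine (norm_sub_le _ _).trans ?_
      rw [norm_one, norm_pow, norm_norm]
      gcongr
      exact hM _ (hmem v u hv)
    gcongr
    exact hle v u hv
  · filter_upwards [hθ.boundary] with x hx
    have h1 : Tendsto (fun v => ((1 + M ^ 2) ^ 2 * ‖fourier (halfExp w) x‖ ^ 2)) (𝓝[>] (0 : ℝ))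
      (𝓝 ((1 + M ^ 2) ^ 2 * ‖fourier (halfExp w) x‖ ^ 2)) := tendsto_const_nhds
    have h2 : Tendsto (fun v : ℝ => (‖(1 - ‖slice θ v x‖ ^ 2 : ℝ)‖ *
        ‖fourier (halfExp w) x‖) ^ 2) (𝓝[>] 0) (𝓝 0) := by
      have := (((tendsto_const_nhds (x := (1 : ℝ))).sub (hx.pow 2)).norm.mul_const
        ‖fourier (halfExp w) x‖).pow 2
      simpa using this
    refine squeeze_zero' (Eventually.of_forall fun v => by positivity) ?_ h2
    filter_upwards [self_mem_nhdsWithin] with v hv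
    gcongr
    exact hle v x hv

/-- Multiplication by an inner function is isometric. -/
theorem inner_eq_of_fourier_eq_mul {w : ℂ} (hw : w ∈ upperHalf) {h f g : L2} (hh : h ∈ L2Above 0)
    (hf : f ∈ L2Above 0) (hg : g ∈ L2Above 0)
    (hfh : ∀ z ∈ upperHalf, fourier f z = θ z * fourier h z)
    (hgw : ∀ z ∈ upperHalf, fourier g z = θ z * fourier (szego hw) z) :
    inner ℂ g f = fourier h w := by
  rw [← inner_szego hw hh]
  have l1 := tendsto_integral_slice hf hg (fun z _ => rfl) (fun z _ => rfl)
  have l2 := tendsto_integral_slice hh (szego_mem hw) (fun z _ => rfl) (fun z _ => rfl)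
  have hH := fourier_mem_hardySpace hh
  have hS := fourier_mem_hardySpace (szego_mem hw)
  obtain ⟨N, hN⟩ := exists_hardy_bound hH
  obtain ⟨M, hM⟩ := hθ.bounded
  -- On each line the difference of the pairings is h against (1 - |θ|²) times the Szegő kernel.
  -- Hölder bounds it by the Hardy norm of h times the vanishing defect.
  have l3 : Tendsto (fun v : ℝ =>
      (∫ u : ℝ, slice (fourier h) v u * (starRingEnd ℂ) (slice (fourier (szego hw)) v u)) -
      ∫ u : ℝ, slice (fourier f) v u * (starRingEnd ℂ) (slice (fourier g) v u)) (𝓝[>] 0) (𝓝 0) := by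
    have hd := tendsto_integral_defect hθ hw
    have hd2 : Tendsto (fun v : ℝ => (N : ℝ) ^ (1 / 2 : ℝ) * (∫ u : ℝ, (‖(1 - ‖slice θ v u‖ ^ 2 : ℝ)‖ *
      ‖slice (fourier (szego hw)) v u‖) ^ 2) ^ (1 / 2 : ℝ)) (𝓝[>] 0) (𝓝 0) := by
      have := (hd.rpow_const (p := 1 / 2) (Or.inr (by norm_num))).const_mul ((N : ℝ) ^ (1 / 2 : ℝ))
      simpa using this
    refine squeeze_zero_norm' ?_ hd2
    filter_upwards [self_mem_nhdsWithin] with v hv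
    have hv : 0 < v := hv
    have hmem : ∀ u : ℝ, (u : ℂ) + v * Complex.I ∈ upperHalf := fun u => by
      simpa [upperHalf] using hv
    have mH := memLp_slice hH hv
    have mS := memLp_slice hS hv
    have mf := memLp_slice (fourier_mem_hardySpace hf) hv
    have mg := memLp_slice (fourier_mem_hardySpace hg) hv
    have c1 := continuous_slice hθ.differentiableOn hv
    have mR : MemLp (fun u => ((1 - ‖slice θ v u‖ ^ 2 : ℝ) : ℂ) * slice (fourier (szego hw)) v u) 2
        volume := by
      refine (mS.const_mul ((1 + M ^ 2 : ℝ) : ℂ)).of_le ((by fun_prop : Continuous fun u =>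
        ((1 - ‖slice θ v u‖ ^ 2 : ℝ) : ℂ)).aestronglyMeasurable.mul mS.1) (Eventually.of_forall fun u => ?_)
      rw [norm_mul, norm_mul, Complex.norm_real, Complex.norm_real]
      gcongr 1
      refine ((norm_sub_le _ _).trans ?_).trans (le_abs_self _)
      rw [norm_one, norm_pow, norm_norm]
      gcongr
      exact hM _ (hmem u)
    have e : (∫ u : ℝ, slice (fourier h) v u * (starRingEnd ℂ) (slice (fourier (szego hw)) v u)) -
        (∫ u : ℝ, slice (fourier f) v u * (starRingEnd ℂ) (slice (fourier g) v u)) =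
        ∫ u : ℝ, slice (fourier h) v u * (starRingEnd ℂ)
          (((1 - ‖slice θ v u‖ ^ 2 : ℝ) : ℂ) * slice (fourier (szego hw)) v u) := by
      have i1 : Integrable fun u => slice (fourier h) v u *
          (starRingEnd ℂ) (slice (fourier (szego hw)) v u) := mH.integrable_mul mS.star
      have i2 : Integrable fun u => slice (fourier f) v u *
          (starRingEnd ℂ) (slice (fourier g) v u) := mf.integrable_mul mg.star
      rw [← integral_sub i1 i2]
      refine integral_congr_ae (Eventually.of_forall fun u => ?_)
      simp only [slice]
      rw [hfh _ (hmem u), hgw _ (hmem u)]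
      have h1 := Complex.mul_conj' (θ (u + v * Complex.I))
      simp only [map_mul, Complex.conj_ofReal]
      push_cast
      linear_combination (-fourier h (u + v * Complex.I) *
        (starRingEnd ℂ) (fourier (szego hw) (u + v * Complex.I))) * h1
    rw [e]
    have hholder := integral_mul_norm_le_Lp_mul_Lq Real.HolderConjugate.two_two (μ := volume)
      (f := slice (fourier h) v) (g := fun u => ((1 - ‖slice θ v u‖ ^ 2 : ℝ) : ℂ) *
        slice (fourier (szego hw)) v u)
      (by rwa [ENNReal.ofReal_ofNat]) (by rwa [ENNReal.ofReal_ofNat])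
    calc _ ≤ ∫ u : ℝ, ‖slice (fourier h) v u * (starRingEnd ℂ)
          (((1 - ‖slice θ v u‖ ^ 2 : ℝ) : ℂ) * slice (fourier (szego hw)) v u)‖ :=
          norm_integral_le_integral_norm _
      _ = ∫ u : ℝ, ‖slice (fourier h) v u‖ *
          ‖((1 - ‖slice θ v u‖ ^ 2 : ℝ) : ℂ) * slice (fourier (szego hw)) v u‖ := by
          simp only [norm_mul, RCLike.norm_conj]
      _ ≤ (∫ u : ℝ, ‖slice (fourier h) v u‖ ^ 2) ^ (1 / 2 : ℝ) *
          (∫ u : ℝ, (‖(1 - ‖slice θ v u‖ ^ 2 : ℝ)‖ * ‖slice (fourier (szego hw)) v u‖) ^ 2) ^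
            (1 / 2 : ℝ) := by
          simpa only [norm_mul, Complex.norm_real, Real.rpow_two] using hholder
      _ ≤ _ := by
          gcongr 1
          exact Real.rpow_le_rpow (integral_nonneg fun u => by positivity)
            (integral_norm_slice_sq_le hH hN hv) (by norm_num)
  have h2 := tendsto_nhds_unique l3 (l2.sub l1)
  have hpi : (2 * Real.pi : ℂ) ≠ 0 := by exact_mod_cast Real.two_pi_pos.ne'
  rw [← mul_sub] at h2
  exact (sub_eq_zero.1 ((mul_eq_zero.1 h2.symm).resolve_left hpi)).symm

/-- The reproducing kernels of the model subspace. -/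
theorem exists_modelKernel {w : ℂ} (hw : w ∈ upperHalf) : ∃ k ∈ modelSubmodule θ,
    (∀ g ∈ modelSubmodule θ, inner ℂ k g = fourier g w) ∧ ∀ z ∈ upperHalf, fourier k z =
      Complex.I * (1 - θ z * (starRingEnd ℂ) (θ w)) / (z - (starRingEnd ℂ) w) := by
  have hε := szego_mem hw
  -- Subtracting conj θ(w) times θ·Szegő from the Szegő kernel removes the component in θH²;
  -- `inner_eq_of_fourier_eq_mul` verifies the orthogonality.
  obtain ⟨s, hs, hsF⟩ := exists_innerRange hθ hε
  have hfk : ∀ z ∈ upperHalf, fourier (((1 : ℂ) • szego hw + (-(starRingEnd ℂ) (θ w)) • s : L2) : ℝ → ℂ) z =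
      Complex.I * (1 - θ z * (starRingEnd ℂ) (θ w)) / (z - (starRingEnd ℂ) w) := fun z hz => by
    rw [fourier_add_of_mem hε hs _ _ hz, hsF z hz, fourier_szego hw hz]
    ring
  refine ⟨_, mem_modelSubmodule.2 ⟨mem_aboveSubmodule.1 ?_, ?_⟩, fun g hg => ?_, hfk⟩
  · exact Submodule.add_mem _ (Submodule.smul_mem _ _ (mem_aboveSubmodule.2 hε))
      (Submodule.smul_mem _ _ (mem_aboveSubmodule.2 hs))
  · rintro r ⟨hr, h, hh, hrh⟩
    rw [inner_add_right, inner_smul_right, inner_smul_right, ← inner_conj_symm, inner_szego hw hr,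
      ← inner_conj_symm r s, inner_eq_of_fourier_eq_mul hθ hw hh hr hs hrh hsF, hrh w hw, map_mul]
    ring
  · obtain ⟨hg0, hg⟩ := mem_modelSubmodule.1 hg
    rw [inner_add_left, inner_smul_left, inner_smul_left, inner_szego hw hg0,
      hg s ⟨hs, _, hε, hsF⟩]
    simp

/-- Paley–Wiener in both directions, with `tendsto_integral_slice` identifying the limit of slice
pairings with 2π times the L² inner product. -/
theorem mem_modelSpace_iff {F : ℂ → ℂ} :
    F ∈ modelSpace θ ↔ ∃ g ∈ modelSubmodule θ, ∀ z ∈ upperHalf, F z = fourier g z := by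
  have hpi : (2 * Real.pi : ℂ) ≠ 0 := by exact_mod_cast Real.two_pi_pos.ne'
  constructor
  · rintro ⟨hF, ho⟩
    obtain ⟨g, hg, hgF⟩ := exists_fourier_of_mem_hardySpace hF
    refine ⟨g, mem_modelSubmodule.2 ⟨hg, ?_⟩, hgF⟩
    rintro s ⟨hs, h, hh, hsh⟩
    have := tendsto_nhds_unique (ho _ (fourier_mem_hardySpace hh))
      (tendsto_integral_slice hg hs hgF fun z hz => (hsh z hz).symm)
    exact (mul_eq_zero.1 this.symm).resolve_left hpi
  · rintro ⟨g, hg, hgF⟩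
    obtain ⟨hg0, hg⟩ := mem_modelSubmodule.1 hg
    refine ⟨mem_hardySpace_of_fourier hg0 hgF, fun h hh => ?_⟩
    obtain ⟨r, hr, hrh⟩ := exists_fourier_of_mem_hardySpace hh
    obtain ⟨s, hs, hsr⟩ := exists_innerRange hθ hr
    have := tendsto_integral_slice hg0 hs hgF (G := fun z => θ z * h z) fun z hz => by
      rw [hsr z hz, hrh z hz]
    rwa [hg s ⟨hs, r, hr, hsr⟩, mul_zero] at this

end inner

/-- The description of `F(V_t)` by a model subspace. -/
theorem fourierImage_spaceV {K : ℝ → ℝ} {c : ℝ} {T : L2 →L[ℂ] L2} {Θ : ℂ → ℂ}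
    (H : HankelSystem K c T Θ) {t : ℝ} (ht : 0 ≤ t) {φ ψ : ℝ → ℝ} (hφ : IsSol K t 1 φ)
    (hψ : IsSol K t (-1) ψ) : fourierImage (spaceV T t) = multiple (quotE t φ ψ Θ)
      (modelSpace fun z => quotF t φ ψ Θ z / quotE t φ ψ Θ z) := by
  obtain ⟨k, hk⟩ := exists_kernel H ht hφ hψ
  let θ : ℂ → ℂ := fun z => quotF t φ ψ Θ z / quotE t φ ψ Θ z
  have hθ : IsInner θ := isInner_quotient H ht hφ hψ
  choose m hmM hmI hmF using fun w : upperHalf => exists_modelKernel hθ w.2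
  let e := quotE t φ ψ Θ
  have he : ∀ w : upperHalf, e w ≠ 0 := fun w => quotE_ne_zero H ht hφ hψ w.2
  have he' : ∀ w : upperHalf, (starRingEnd ℂ) (e w) ≠ 0 := fun w =>
    (map_ne_zero (starRingEnd ℂ)).2 (he w)
  -- Dividing out conj e(w) turns the kernel of V_t into a family with the Gram matrix of the model
  -- kernels, whose coordinates are the transform divided by e. The Gram lemma then applies in both
  -- directions.
  let a : upperHalf → L2 := fun w => ((starRingEnd ℂ) (e w))⁻¹ • k w
  have haV : ∀ w, a w ∈ spaceVSubmodule T t := fun w => Submodule.smul_mem _ _ (hk w w.2).1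
  have hVt : ∀ g ∈ spaceVSubmodule T t, g ∈ L2Above t := fun g hg => mem_aboveSubmodule.1 hg.1
  have haI : ∀ w, ∀ g ∈ spaceVSubmodule T t, inner ℂ (a w) g = (e w)⁻¹ * fourier g w := fun w g hg => by
    rw [inner_smul_left, (hk w w.2).2.1 g hg, map_inv₀, Complex.conj_conj]
  have hgram : ∀ z w, inner ℂ (a z) (a w) = inner ℂ (m z) (m w) := fun z w => by
    have h1 := (hk w w.2).2.2 z z.2
    have h2 : fourier (a w) z = ((starRingEnd ℂ) (e w))⁻¹ * fourier (k w) z := by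
      have h := fourier_add_of_mem (hVt _ (hk w w.2).1) (hVt _ (hk w w.2).1)
        ((starRingEnd ℂ) (e w))⁻¹ 0 z.2
      rwa [zero_smul, add_zero, zero_mul, add_zero] at h
    rw [haI z _ (haV w), hmI z _ (hmM w), h2, h1, hmF w z z.2]
    have := he z
    have := he' w
    simp only [θ, map_div₀]
    simp only [e] at *
    field_simp
  have htotV : ∀ g ∈ spaceVSubmodule T t, (∀ w, inner ℂ (a w) g = 0) → g = 0 := fun g hg h =>
    fourier_injective_of_mem (hVt g hg) fun z hz => by
      have := h ⟨z, hz⟩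
      rw [haI _ g hg] at this
      exact (mul_eq_zero.1 this).resolve_left (inv_ne_zero (he ⟨z, hz⟩))
  have htotM : ∀ g ∈ modelSubmodule θ, (∀ w, inner ℂ (m w) g = 0) → g = 0 := fun g hg h =>
    fourier_injective_of_mem (mem_modelSubmodule.1 hg).1 fun z hz => by
      rw [← hmI ⟨z, hz⟩ g hg]
      exact h ⟨z, hz⟩
  ext F
  constructor
  · rintro ⟨f, hf, hF⟩
    have hf' := (mem_spaceVSubmodule H.invol).2 hf
    obtain ⟨g, hg, hgf⟩ := exists_inner_eq_of_gram_eq hgram haV htotV hmM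
      (isClosed_spaceVSubmodule T t) (isClosed_modelSubmodule θ) hf'
    refine ⟨fourier g, (mem_modelSpace_iff hθ).2 ⟨g, hg, fun _ _ => rfl⟩, fun z hz => ?_⟩
    have h1 := hgf ⟨z, hz⟩
    rw [hmI _ g hg, haI _ f hf'] at h1
    rw [hF z hz]
    exact (inv_mul_eq_iff_eq_mul₀ (he ⟨z, hz⟩)).1 h1.symm
  · rintro ⟨G, hG, hF⟩
    obtain ⟨g, hg, hgG⟩ := (mem_modelSpace_iff hθ).1 hG
    obtain ⟨f, hf, hgf⟩ := exists_inner_eq_of_gram_eq (fun z w => (hgram z w).symm) hmM htotM haV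
      (isClosed_modelSubmodule θ) (isClosed_spaceVSubmodule T t) hg
    refine ⟨f, (mem_spaceVSubmodule H.invol).1 hf, fun z hz => ?_⟩
    have h1 := hgf ⟨z, hz⟩
    rw [hmI _ g hg, haI _ f hf] at h1
    rw [hF z hz, hgG z hz]
    exact ((inv_mul_eq_iff_eq_mul₀ (he ⟨z, hz⟩)).1 h1).symm

end LacunaryCanonical

/-! ### Assembly of the main theorem -/

theorem mainTheorem8 (E : ℂ → ℂ) (c : ℝ) (Z : Set ℂ) (K : ℝ → ℝ)
    (hE : ∃ z, z ∉ Z ∧ E z ≠ 0)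
    (h1 : LacunaryCanonical.CondK1 E c Z) (h2 : LacunaryCanonical.CondK2 E c K)
    (h3 : LacunaryCanonical.CondK3 K) (h4 : LacunaryCanonical.CondK4 K)
    (h5 : LacunaryCanonical.CondK5 K) :
    ∃ T : LacunaryCanonical.L2 →L[ℂ] LacunaryCanonical.L2,
      LacunaryCanonical.IsHankelLimit K T ∧
      ∀ t : ℝ, 0 ≤ t →
        (∃! φ : ℝ → ℝ, LacunaryCanonical.IsPhi K t φ) ∧
        (∃! ψ : ℝ → ℝ, LacunaryCanonical.IsPsi K t ψ) ∧
        ∀ φ ψ : ℝ → ℝ, LacunaryCanonical.IsPhi K t φ → LacunaryCanonical.IsPsi K t ψ →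
          ∃ A B Et : ℂ → ℂ,
            LacunaryCanonical.IsContinuation E c Z t ψ A ∧
            LacunaryCanonical.IsContinuation E c Z t φ (fun z => -Complex.I * B z) ∧
            (∀ z, Et z = A z - Complex.I * B z) ∧
            ∃ q θ : ℂ → ℂ,
              LacunaryCanonical.IsQuotient Z Et E q ∧
              LacunaryCanonical.IsQuotient Z (LacunaryCanonical.sharp Et) Et θ ∧
              LacunaryCanonical.IsInner θ ∧
              LacunaryCanonical.fourierImage (LacunaryCanonical.spaceV T t) =
                LacunaryCanonical.multiple q (LacunaryCanonical.modelSpace θ) := by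
  open LacunaryCanonical in
  obtain ⟨T, Θ, hT, H, hΘ⟩ := exists_hankelSystem hE h1 h2 h3 h5
  refine ⟨T, hT, fun t ht => ⟨?_, ?_, fun φ ψ hφ hψ => ?_⟩⟩
  · obtain ⟨φ, hφ⟩ := exists_isSol h2.cont h3 (norm_truncOp_lt_one h2.cont h3 h5 t) abs_one
    exact ⟨φ, isSol_one_iff.1 hφ, fun φ' hφ' => isSol_unique h2.cont h3
      (norm_truncOp_lt_one h2.cont h3 h5 t) abs_one (isSol_one_iff.2 hφ') hφ⟩
  · have h : |(-1 : ℝ)| = 1 := by simp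
    obtain ⟨ψ, hψ⟩ := exists_isSol h2.cont h3 (norm_truncOp_lt_one h2.cont h3 h5 t) h
    exact ⟨ψ, isSol_neg_one_iff.1 hψ, fun ψ' hψ' => isSol_unique h2.cont h3
      (norm_truncOp_lt_one h2.cont h3 h5 t) h (isSol_neg_one_iff.2 hψ') hψ⟩
  · rw [← isSol_one_iff] at hφ
    rw [← isSol_neg_one_iff] at hψ
    obtain ⟨z₀, hz₀, hz₀Z, hEz₀⟩ := exists_mem_upperHalf_ne_zero hE h1
    -- B is i times the continuation attached to Φ, so that -iB is that continuation. In both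
    -- quotients E cancels, which leaves `quotE` and the ratio of `quotF` to `quotE`.
    refine ⟨fun z => (E z * entirePart t ψ z + sharp E z * entirePart t ψ (-z)) / 2,
      fun z => Complex.I * ((E z * entirePart t φ z - sharp E z * entirePart t φ (-z)) / 2),
      evolved E t φ ψ, ?_, ?_, fun z => ?_, quotE t φ ψ Θ,
      fun z => quotF t φ ψ Θ z / quotE t φ ψ Θ z,
      ⟨⟨z₀, hz₀, hz₀Z, hEz₀⟩, differentiableOn_quotE H hφ hψ, fun z hz hzZ h0 => ?_⟩,
      ⟨⟨z₀, hz₀, hz₀Z, ?_⟩, (isInner_quotient H ht hφ hψ).1, fun z hz hzZ h0 => ?_⟩,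
      isInner_quotient H ht hφ hψ, fourierImage_spaceV H ht hφ hψ⟩
    · simpa using isContinuation h1 H hΘ ht hψ
    · have e : (fun z => -Complex.I * (Complex.I *
          ((E z * entirePart t φ z - sharp E z * entirePart t φ (-z)) / 2))) = fun z =>
          (E z * entirePart t φ z - ((1 : ℝ) : ℂ) * sharp E z * entirePart t φ (-z)) / 2 := by
        funext z
        rw [← mul_assoc, neg_mul, Complex.I_mul_I]
        push_cast; ring
      rw [e]
      exact isContinuation h1 H hΘ ht hφ
    · rw [← mul_assoc, Complex.I_mul_I, evolved]
      ring
    · rw [evolved_eq hΘ t φ ψ hz hzZ, mul_div_cancel_left₀ _ h0]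
    · rw [evolved_eq hΘ t φ ψ hz₀ hz₀Z]
      exact mul_ne_zero hEz₀ (quotE_ne_zero H ht hφ hψ hz₀)
    · rw [evolved_eq hΘ t φ ψ hz hzZ] at h0 ⊢
      rw [sharp_evolved_eq hΘ t φ ψ hz hzZ, mul_div_mul_left _ _ (left_ne_zero_of_mul h0)]
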